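/- Let $(p_k)_{k\ge 1}$ be a probability distribution on the positive integers with $p_k<1$ for all $k$ and finite mean $m=\sum_k k\,p_k$ (hence $m>1$), and let $0<\lambda<m$. All trees are infinite, locally finite, rooted and leafless (every vertex has at least one child), and are considered up to isomorphism. *The biased walk.* On a tree $T$ with root $e$, the $\lambda$-biased random walk moves from $e$ to a uniformly chosen child, and from a vertex $x\ne e$ with $\nu(x)$ children to its parent with probability $\lambda/(\nu(x)+\lambda)$ and to each child with probability $1/(\nu(x)+\lambda)$. Let $T_*$ be $T$ with an additional vertex $e_*$ attached to $e$ as its parent, rooted at $e_*$, and let $\beta(T)$ be the probability that the $\lambda$-biased walk on $T_*$ started at $e$ never hits $e_*$. Let $\mathcal C(T)$ be the effective conductance from $e$ to infinity of the network on $T$ in which the edges between levels $n$ and $n+1$ have conductance $\lambda^{-n}$, i.e. the total conductance at $e$ times the probability that the network random walk (which is the $\lambda$-biased walk on $T$) started at $e$ never returns to $e$. The $\lambda$-harmonic measure of $T$ is the law of the ray obtained by loop-erasing the trajectory of the $\lambda$-biased walk on $T$ started at $e$ (this walk is transient for almost every Galton–Watson tree). *Marked trees.* For trees $T,T^+$ with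 roots $e,e^+$, let $T\bowtie T^+$ be the tree rooted at $e^+$ obtained by joining $e$ and $e^+$ by an edge. Let $\mathcal T^*$ be the space of isomorphism classes of pairs $(T\bowtie T^+,\xi)$ where $\xi=(\xi_0,\xi_1,\dots)$ is a ray with $\xi_0=e^+$, $\xi_1=e$ (equivalently: of trees in which all vertices have degree at least two, with a marked ray starting at the root). Consider the Markov chain on $\mathcal T^*$ with the following transitions $\mathsf p_{\mathsf{RW}_\lambda}$ (the environment seen from a walk $\lambda$-biased towards the marked ray). From $(T,\xi)$ with root $\xi_0$ of degree $\nu(\xi_0)$, for each neighbour $x\neq\xi_1$ of $\xi_0$, with probability $\frac1{\nu(\xi_0)-1+\lambda}$ the tree is re-rooted at $x$ and the new ray is $(x,\xi_0,\xi_1,\dots)$; with probability $\frac{\lambda}{\nu(\xi_0)-1+\lambda}$ it is re-rooted at $\xi_1$ and the new ray is $(\xi_1,\xi_2,\dots)$. *The measure.* Let $\mathbb T,\mathbb T^+$ be independent Galton–Watson trees with offspring distribution $(p_k)$, let $\nu^+$ be the number of children of the root of $\mathbb T^+$ in $\mathbb T^+$, and, given $(\mathbb T,\mathbb T^+)$,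 let $\mathcal R$ be a ray of $\mathbb T$ distributed according to the $\lambda$-harmonic measure of $\mathbb T$, extended to a ray of $\mathbb T\bowtie\mathbb T^+$ by putting the root of $\mathbb T^+$ in front. Let $\mathbf{AGW}_\lambda$ be the measure on $\mathcal T^*$ that is absolutely continuous with respect to the law of $(\mathbb T\bowtie\mathbb T^+,\mathcal R)$ with density $$c_\lambda^{-1}\,\frac{(\lambda+\nu^+)\,\beta(\mathbb T)}{\lambda-1+\beta(\mathbb T)+\mathcal C(\mathbb T^+)},\qquad c_\lambda=E\left[\frac{(\lambda+\nu^+)\,\beta(\mathbb T)}{\lambda-1+\beta(\mathbb T)+\mathcal C(\mathbb T^+)}\right].$$ **Proposition.** $\mathbf{AGW}_\lambda$ is a probability measure, and the Markov chain with transition probabilities $\mathsf p_{\mathsf{RW}_\lambda}$ and initial distribution $\mathbf{AGW}_\lambda$ is stationary: $\mathbf{AGW}_\lambda$ is invariant under $\mathsf p_{\mathsf{RW}_\lambda}$, and the law of the whole trajectory $(Y_n)_{n\ge0}$ of the chain is invariant under the time shift. -/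

import Mathlib

open MeasureTheory ProbabilityTheory
open scoped ENNReal NNReal

noncomputable section

namespace BiasedWalk

/-! ### Markov chains -/

/-- The law of the Markov chain `(X_0, X_1, ...)` with transition kernel `κ` started at `X_0 = s`,
as a kernel in `s` (Ionescu-Tulcea). -/
def chain {S : Type*} [MeasurableSpace S] (κ : Kernel S S) [IsMarkovKernel κ] :
    Kernel S (ℕ → S) :=
  (Kernel.traj (X := fun _ => S)
      (fun n => κ.comap (fun h : (i : Finset.Iic n) → S => h ⟨n, Finset.mem_Iic.2 le_rfl⟩)
        (measurable_pi_apply _)) 0).comap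
    (fun s _ => s) (measurable_pi_lambda _ fun _ => measurable_id)

/-- The law of the Markov chain with transition kernel `κ` and initial distribution `μ`. -/
def chainLaw {S : Type*} [MeasurableSpace S] (κ : Kernel S S) [IsMarkovKernel κ]
    (μ : Measure S) : Measure (ℕ → S) :=
  μ.bind (chain κ)

/-- The time shift on sequences. -/
def shift {S : Type*} (ω : ℕ → S) : ℕ → S := fun n => ω (n + 1)

/-! ### Rooted leafless trees -/

/-- Vertices are labelled by finite words of natural numbers. -/
abbrev Vertex := List ℕ

instance : MeasurableSpace Vertex := ⊤
instance : DiscreteMeasurableSpace Vertex := ⟨fun _ => trivial⟩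
instance : MeasurableSpace ℕ+ := ⊤
instance : DiscreteMeasurableSpace ℕ+ := ⟨fun _ => trivial⟩

/-- An infinite, locally finite, leafless rooted tree in Ulam-Harris labelling: the root is the
empty word, and the vertex `u` has the `T u ≥ 1` children `u ++ [i]`, `i < T u`. The values of `T`
at words which cannot be reached from the root in this way are irrelevant. -/
abbrev PTree := Vertex → ℕ+

namespace PTree

/-- `v` is a child of `u`. -/
def IsChild (T : PTree) (u v : Vertex) : Prop := ∃ i < (T u : ℕ), v = u ++ [i]

/-- The vertices of the tree. -/
inductive IsVertex (T : PTree) : Vertex → Prop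
  | root : IsVertex T []
  | child {u v : Vertex} : IsVertex T u → T.IsChild u v → IsVertex T v

/-- `ξ` is an infinite ray of `T` emanating from the root. -/
def IsRay (T : PTree) (ξ : ℕ → Vertex) : Prop :=
  ξ 0 = [] ∧ ∀ n, T.IsChild (ξ n) (ξ (n + 1))

/-- The tree `T_*`: a parent `e_*` is attached to the root `e` of `T`, and `T_*` is rooted at
`e_*`. The word of `e_*` is `[]`, and the vertex `u` of `T` becomes `0 :: u`. -/
def star (T : PTree) : PTree
  | [] => 1
  | 0 :: u => T u
  | (_ + 1) :: _ => 1

/-- The tree obtained from `T` and `S` by joining their roots by an edge, rooted at the root of `S`.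
The root of `T` is its child with label `0`, and the children of the root of `S` are
relabelled by `1, 2, ...`. -/
def join (T S : PTree) : PTree
  | [] => S [] + 1
  | 0 :: u => T u
  | (i + 1) :: u => S (i :: u)

/-- The underlying graph (the tree is the connected component of `[]`). -/
def graph (T : PTree) : SimpleGraph Vertex where
  Adj u v := T.IsChild u v ∨ T.IsChild v u
  symm := ⟨fun _ _ h => h.symm⟩
  loopless := ⟨fun u h => by
    rcases h with ⟨i, -, h⟩ | ⟨i, -, h⟩ <;> simpa using congrArg List.length h⟩

end PTree

/-- The Galton-Watson measure with offspring distribution `p` on the positive integers: the numbers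
of children `T u` are independent with law `p`. -/
def GW (p : PMF ℕ+) : Measure PTree := Measure.infinitePi fun _ => p.toMeasure

instance (p : PMF ℕ+) : IsProbabilityMeasure (GW p) := by unfold GW; infer_instance

/-- The mean of the offspring distribution. -/
def mean (p : PMF ℕ+) : ℝ≥0∞ := ∑' k : ℕ+, (k : ℝ≥0∞) * p k

/-! ### The biased random walk on a rooted tree -/

/-- One step of the `lam`-biased walk from a vertex `u` having `d` children: from the root all
children are equally likely; from another vertex the parent has weight `lam` and each child
weight `1`. -/
def stepMeasure (lam : ℝ≥0) (d : ℕ+) (u : Vertex) : Measure Vertex :=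
  if u = [] then ∑ i ∈ Finset.range d, (1 / (d : ℝ≥0∞)) • Measure.dirac (u ++ [i])
  else (lam / (d + lam : ℝ≥0∞)) • Measure.dirac u.dropLast +
    ∑ i ∈ Finset.range d, (1 / (d + lam : ℝ≥0∞)) • Measure.dirac (u ++ [i])

instance (lam : ℝ≥0) (d : ℕ+) (u : Vertex) : IsProbabilityMeasure (stepMeasure lam d u) := by
  constructor
  have hd : (d : ℝ≥0∞) ≠ 0 := by simp
  have hd' : (d : ℝ≥0∞) ≠ ∞ := by simp
  unfold stepMeasure
  split_ifs
  · simp [ENNReal.mul_inv_cancel hd hd']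
  · simp only [Measure.add_apply, Measure.finsetSum_apply, Measure.smul_apply, measure_univ,
      smul_eq_mul, mul_one, Finset.sum_const, Finset.card_range, nsmul_eq_mul]
    rw [mul_one_div, ← ENNReal.add_div, add_comm]
    exact ENNReal.div_self (by simp) (by simp)

/-- The transition kernel of the walk, as a function of the tree and the current position. -/
def step (lam : ℝ≥0) : Kernel (PTree × Vertex) Vertex where
  toFun x := stepMeasure lam (x.1 x.2) x.2
  measurable' := by
    apply measurable_from_prod_countable_left
    intro u
    exact (measurable_of_countable (fun d : ℕ+ => stepMeasure lam d u)).comp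
      (measurable_pi_apply u)

instance (lam : ℝ≥0) : IsMarkovKernel (step lam) :=
  ⟨fun x => inferInstanceAs (IsProbabilityMeasure (stepMeasure lam (x.1 x.2) x.2))⟩

/-- The same transition on pairs (tree, position), where the tree never changes. -/
def treeStep (lam : ℝ≥0) : Kernel (PTree × Vertex) (PTree × Vertex) :=
  (Kernel.deterministic Prod.fst measurable_fst) ×ₖ step lam

instance (lam : ℝ≥0) : IsMarkovKernel (treeStep lam) := by unfold treeStep; infer_instance

/-- `walk lam (T, u)` is the law of the trajectory of the `lam`-biased walk on `T` started at `u`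
(the walk on the frozen tree `T`). -/
def walk (lam : ℝ≥0) : Kernel (PTree × Vertex) (ℕ → Vertex) :=
  (chain (treeStep lam)).map fun ω n => (ω n).2

/-- The escape probability: the probability that the walk on `T_*` started at `e` never hits
`e_*`. -/
def escape (lam : ℝ≥0) (T : PTree) : ℝ :=
  (walk lam (T.star, [0])).real {X | ∀ n, X n ≠ []}

open Classical in
/-- The electric network on `T`: an edge between the levels `n` and `n + 1` has conductance
`lam ^ (-n)`. -/
def edgeConductance (lam : ℝ≥0) (T : PTree) (u v : Vertex) : ℝ≥0∞ :=
  if T.IsChild u v then (lam : ℝ≥0∞)⁻¹ ^ u.length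
  else if T.IsChild v u then (lam : ℝ≥0∞)⁻¹ ^ v.length
  else 0

/-- The total conductance of the edges at `u`. -/
def vertexConductance (lam : ℝ≥0) (T : PTree) (u : Vertex) : ℝ≥0∞ :=
  ∑' v, edgeConductance lam T u v

/-- The effective conductance of the network `T` from its root to infinity: the total conductance
at the root times the probability that the network walk started at the root never returns there.
The network walk moves from `u` to `v` with probability
`edgeConductance u v / vertexConductance u`; it is the `lam`-biased walk,
see `step_eq_edgeConductance_div`. -/
def effConductance (lam : ℝ≥0) (T : PTree) : ℝ :=
  (vertexConductance lam T []).toReal * (walk lam (T, [])).real {X | ∀ n, 1 ≤ n → X n ≠ []}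

lemma edgeConductance_eq (lam : ℝ≥0) (hlam : lam ≠ 0) (T : PTree) {u : Vertex}
    (hu : T.IsVertex u) (v : Vertex) :
    edgeConductance lam T u v = ((lam : ℝ≥0∞)⁻¹ ^ u.length *
      (if u = [] then (T u : ℝ≥0∞) else T u + lam)) * step lam (T, u) {v} := by
  classical
  have hd : (T u : ℝ≥0∞) ≠ 0 := by simp
  have hd' : (T u : ℝ≥0∞) ≠ ∞ := by simp
  have hl : (lam : ℝ≥0∞) ≠ 0 := by simpa using hlam
  have hs0 : (T u + lam : ℝ≥0∞) ≠ 0 := by simp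
  have hs : (T u + lam : ℝ≥0∞) ≠ ∞ := by simp
  have hsum : ∀ c : ℝ≥0∞, (∑ i ∈ Finset.range (T u), c • Measure.dirac (u ++ [i])) {v} =
      if T.IsChild u v then c else 0 := by
    intro c
    simp only [Measure.finsetSum_apply, Measure.smul_apply, smul_eq_mul,
      Measure.dirac_apply' _ (measurableSet_singleton v)]
    split_ifs with h
    · obtain ⟨i, hi, rfl⟩ := h
      rw [Finset.sum_eq_single i]
      · simp
      · intro j _ hj
        simp [hj]
      · simp [hi]
    · refine Finset.sum_eq_zero fun i hi => ?_
      have : u ++ [i] ≠ v := fun h' => h ⟨i, Finset.mem_range.1 hi, h'.symm⟩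
      simp [this]
  change _ = _ * stepMeasure lam (T u) u {v}
  unfold stepMeasure edgeConductance
  cases hu with
  | root =>
    have hn : ¬ T.IsChild v [] := by rintro ⟨i, -, h⟩; simp at h
    simp only [if_true, hn, if_false, hsum, List.length_nil, pow_zero, one_mul]
    split_ifs
    · rw [mul_one_div, ENNReal.div_self hd hd']
    · simp
  | @child w _ hw h =>
    obtain ⟨j, hj, rfl⟩ := h
    have hne : w ++ [j] ≠ [] := by simp
    have hpar : T.IsChild v (w ++ [j]) ↔ w = v := by
      constructor
      · rintro ⟨i, -, h⟩
        exact (List.append_inj' h rfl).1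
      · rintro rfl
        exact ⟨j, hj, rfl⟩
    have hnc : ¬ T.IsChild (w ++ [j]) w := by
      rintro ⟨i, -, h⟩
      simpa [add_assoc] using congrArg List.length h
    rw [if_neg hne, if_neg hne, Measure.add_apply, hsum, Measure.smul_apply,
      Measure.dirac_apply' _ (measurableSet_singleton v), List.dropLast_concat]
    simp only [hpar]
    by_cases hwv : w = v
    · subst hwv
      simp only [hnc, if_false, if_true, Set.indicator_of_mem (Set.mem_singleton w), Pi.one_apply,
        smul_eq_mul, mul_one, add_zero, List.length_append, List.length_singleton]
      rw [mul_assoc, ENNReal.mul_div_cancel hs0 hs, pow_succ, mul_assoc,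
        ENNReal.inv_mul_cancel hl ENNReal.coe_ne_top, mul_one]
    · simp only [hwv, if_false, Set.indicator_of_notMem (s := {v}) (a := w) (by simpa using hwv),
        smul_eq_mul, mul_zero, zero_add]
      split_ifs
      · rw [mul_assoc, mul_one_div, ENNReal.div_self hs0 hs, mul_one]
      · simp

/-- The random walk on the network is the `lam`-biased walk. -/
lemma step_eq_edgeConductance_div (lam : ℝ≥0) (hlam : lam ≠ 0) (T : PTree) {u : Vertex}
    (hu : T.IsVertex u) (v : Vertex) :
    step lam (T, u) {v} = edgeConductance lam T u v / vertexConductance lam T u := by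
  have htot : ∑' v, step lam (T, u) {v} = 1 := by
    have := (step lam (T, u)).tsum_indicator_apply_singleton Set.univ MeasurableSet.univ
    simpa using this
  unfold vertexConductance
  simp only [edgeConductance_eq lam hlam T hu]
  rw [ENNReal.tsum_mul_left, htot, mul_one, mul_comm]
  refine (ENNReal.mul_div_cancel_right ?_ ?_).symm
  · refine mul_ne_zero (pow_ne_zero _ (by simp)) ?_
    split_ifs <;> simp
  · refine ENNReal.mul_ne_top (ENNReal.pow_ne_top (by simpa using hlam)) ?_
    split_ifs <;> simp

/-! ### Harmonic measure -/

/-- The last time the path `X` visits `v`. -/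
def lastVisit (X : ℕ → Vertex) (v : Vertex) : ℕ := sSup {n | X n = v}

/-- The chronological loop-erasure of a transient path: it starts at `X 0`, and
each step is the one that `X` makes after its last visit to the current vertex. -/
def loopErasure (X : ℕ → Vertex) : ℕ → Vertex
  | 0 => X 0
  | n + 1 => X (lastVisit X (loopErasure X n) + 1)

/-- The `lam`-harmonic measure of `T`: the law of the loop-erased trajectory of the `lam`-biased
walk on `T` started at the root. -/
def harmonicMeasure (lam : ℝ≥0) : Kernel PTree (ℕ → Vertex) :=
  ((walk lam).comap (fun T => (T, ([] : Vertex))) (by fun_prop)).map loopErasure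

/-! ### Trees with a marked ray -/

/-- A labelled representative of a tree with a marked ray. The tree is the connected component of
`ray 0` in `graph`, its root is `ray 0`. All degrees are at least two: the trees are those obtained
by joining the roots of two leafless rooted trees by an edge, the first edge of the ray.
In a tree, a path of adjacent vertices is a ray (is injective) iff it never backtracks. -/
structure MarkedTree where
  graph : SimpleGraph Vertex
  ray : ℕ → Vertex
  acyclic : graph.IsAcyclic
  finite_neighborSet : ∀ v, graph.Reachable (ray 0) v → (graph.neighborSet v).Finite
  two_le_degree : ∀ v, graph.Reachable (ray 0) v → 2 ≤ (graph.neighborSet v).ncard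
  ray_adj : ∀ n, graph.Adj (ray n) (ray (n + 1))
  ray_ne : ∀ n, ray n ≠ ray (n + 2)

namespace MarkedTree

/-- The vertex set of the tree. -/
def verts (A : MarkedTree) : Set Vertex := {v | A.graph.Reachable (A.ray 0) v}

/-- Isomorphism of trees with a marked ray. -/
def Iso (A B : MarkedTree) : Prop :=
  ∃ φ : Vertex → Vertex, Set.BijOn φ A.verts B.verts ∧
    (∀ u ∈ A.verts, ∀ v ∈ A.verts, B.graph.Adj (φ u) (φ v) ↔ A.graph.Adj u v) ∧
    ∀ n, φ (A.ray n) = B.ray n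

lemma ray_mem (A : MarkedTree) (n : ℕ) : A.ray n ∈ A.verts := by
  induction n with
  | zero => exact SimpleGraph.Reachable.refl _
  | succ n ih => exact SimpleGraph.Reachable.trans ih (A.ray_adj n).reachable

lemma mem_of_adj (A : MarkedTree) {u v : Vertex} (hu : u ∈ A.verts) (h : A.graph.Adj u v) :
    v ∈ A.verts := SimpleGraph.Reachable.trans hu h.reachable

instance setoid : Setoid MarkedTree where
  r := Iso
  iseqv := by
    refine ⟨fun A => ⟨id, Set.bijOn_id _, by simp, by simp⟩, ?_, ?_⟩
    · rintro A B ⟨φ, hφ, hadj, hray⟩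
      have hinv := hφ.invOn_invFunOn
      refine ⟨Function.invFunOn φ A.verts, hφ.symm hinv.symm, ?_, ?_⟩
      · intro u hu v hv
        have hb := hφ.symm hinv.symm
        rw [← hadj _ (hb.mapsTo hu) _ (hb.mapsTo hv), hinv.2 hu, hinv.2 hv]
      · intro n
        rw [← hray n]
        exact hinv.1 (A.ray_mem n)
    · rintro A B C ⟨φ, hφ, hadj, hray⟩ ⟨ψ, hψ, hadj', hray'⟩
      refine ⟨ψ ∘ φ, hψ.comp hφ, ?_, ?_⟩
      · intro u hu v hv
        rw [← hadj u hu v hv]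
        exact hadj' _ (hφ.mapsTo hu) _ (hφ.mapsTo hv)
      · intro n
        simp [hray, hray']

/-- The σ-algebra generated by the adjacency indicators and the vertices of the ray. -/
instance : MeasurableSpace MarkedTree :=
  MeasurableSpace.comap (fun A => ((fun u v => A.graph.Adj u v : Vertex → Vertex → Prop), A.ray))
    inferInstance

lemma measurable_adj (u v : Vertex) : Measurable fun A : MarkedTree => A.graph.Adj u v :=
  (measurable_pi_apply v).comp <| (measurable_pi_apply u).comp <|
    measurable_fst.comp (comap_measurable _)

lemma measurable_ray (n : ℕ) : Measurable fun A : MarkedTree => A.ray n :=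
  (measurable_pi_apply n).comp <| measurable_snd.comp (comap_measurable _)

/-- The number of edges incident to the root. -/
def rootDegree (A : MarkedTree) : ℕ := (A.graph.neighborSet (A.ray 0)).ncard

open Classical in
/-- The marked ray after moving the root to its neighbour `x`: if `x` is the next vertex of the
ray, the old root is deleted from the ray, otherwise `x` is put in front of it. -/
def moveRay (A : MarkedTree) (x : Vertex) : ℕ → Vertex :=
  if x = A.ray 1 then fun n => A.ray (n + 1)
  else fun n => Nat.casesOn n x A.ray

open Classical in
/-- The re-rooted tree at the neighbour `x` of the root, with the new marked ray (the
value is irrelevant if `x` is not a neighbour of the root). -/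
def move (A : MarkedTree) (x : Vertex) : MarkedTree :=
  if hx : A.graph.Adj (A.ray 0) x then
    have h0 : A.graph.Reachable (A.moveRay x 0) (A.ray 0) := by
      unfold moveRay
      split_ifs with h
      · exact (A.ray_adj 0).symm.reachable
      · exact hx.symm.reachable
    { graph := A.graph
      ray := A.moveRay x
      acyclic := A.acyclic
      finite_neighborSet := fun v hv => A.finite_neighborSet v (h0.symm.trans hv)
      two_le_degree := fun v hv => A.two_le_degree v (h0.symm.trans hv)
      ray_adj := by
        unfold moveRay
        split_ifs with h
        · exact fun n => A.ray_adj _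
        · rintro (_ | n)
          · exact hx.symm
          · exact A.ray_adj n
      ray_ne := by
        unfold moveRay
        split_ifs with h
        · exact fun n => A.ray_ne _
        · rintro (_ | n)
          · exact h
          · exact A.ray_ne n }
  else A

open Classical in
/-- The probability that the walk biased towards the marked ray moves from the root to `x`. -/
def stepProb (lam : ℝ≥0) (A : MarkedTree) (x : Vertex) : ℝ≥0∞ :=
  if A.graph.Adj (A.ray 0) x then
    if x = A.ray 1 then lam / ((A.rootDegree - 1 : ℕ) + lam : ℝ≥0∞)
    else 1 / ((A.rootDegree - 1 : ℕ) + lam : ℝ≥0∞)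
  else 0

end MarkedTree

/-- The space of trees with a marked ray (up to isomorphism), with the quotient σ-algebra. -/
abbrev TreeStar := Quotient MarkedTree.setoid

namespace MarkedTree

/-- The law of the environment seen after one step. -/
def stepLaw (lam : ℝ≥0) (A : MarkedTree) : Measure TreeStar :=
  Measure.sum fun x => A.stepProb lam x • Measure.dirac (Quotient.mk setoid (A.move x))

lemma stepLaw_apply (lam : ℝ≥0) (A : MarkedTree) {s : Set TreeStar} (hs : MeasurableSet s) :
    A.stepLaw lam s =
      ∑' x, A.stepProb lam x * s.indicator 1 (Quotient.mk setoid (A.move x)) := by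
  simp [stepLaw, Measure.sum_apply _ hs, Measure.dirac_apply' _ hs]

lemma move_moveRay (A : MarkedTree) {x : Vertex} (hx : A.graph.Adj (A.ray 0) x) :
    (A.move x).graph = A.graph ∧ (A.move x).ray = A.moveRay x := by
  simp [move, hx]

lemma move_verts (A : MarkedTree) {x : Vertex} (hx : A.graph.Adj (A.ray 0) x) :
    (A.move x).verts = A.verts := by
  obtain ⟨h1, h2⟩ := A.move_moveRay hx
  have h0 : A.graph.Reachable (A.moveRay x 0) (A.ray 0) := by
    unfold moveRay
    split_ifs with h
    · exact (A.ray_adj 0).symm.reachable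
    · exact hx.symm.reachable
  ext v
  simp only [verts, h1, h2, Set.mem_ofPred_eq]
  exact ⟨fun h => h0.symm.trans h, fun h => h0.trans h⟩

/-- The law of the next environment does not depend on the labelling. -/
lemma stepLaw_congr (lam : ℝ≥0) {A B : MarkedTree} (h : Iso A B) :
    A.stepLaw lam = B.stepLaw lam := by
  obtain ⟨φ, hφ, hadj, hray⟩ := h
  have hmem : ∀ {x}, A.graph.Adj (A.ray 0) x → x ∈ A.verts := fun hx => A.mem_of_adj (A.ray_mem 0) hx
  have hbij : Set.BijOn φ (A.graph.neighborSet (A.ray 0)) (B.graph.neighborSet (B.ray 0)) := by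
    refine ⟨fun x hx => ?_, hφ.injOn.mono fun x hx => hmem hx, fun y hy => ?_⟩
    · change B.graph.Adj _ _
      rw [← hray]
      exact (hadj _ (A.ray_mem 0) _ (hmem hx)).2 hx
    · obtain ⟨x, hx, rfl⟩ := hφ.surjOn (B.mem_of_adj (B.ray_mem 0) hy)
      refine ⟨x, ?_, rfl⟩
      change B.graph.Adj _ _ at hy
      rw [← hray] at hy
      exact (hadj _ (A.ray_mem 0) _ hx).1 hy
  have hdeg : A.rootDegree = B.rootDegree := by
    unfold rootDegree
    rw [← hbij.image_eq, hbij.injOn.ncard_image]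
  have hone : ∀ x, A.graph.Adj (A.ray 0) x → (φ x = B.ray 1 ↔ x = A.ray 1) := by
    intro x hx
    rw [← hray 1]
    exact ⟨fun h => hφ.injOn (hmem hx) (A.ray_mem 1) h, fun h => by rw [h]⟩
  have hmove : ∀ x, A.graph.Adj (A.ray 0) x →
      (Quotient.mk setoid (A.move x)) = Quotient.mk setoid (B.move (φ x)) := by
    intro x hx
    have hx' : B.graph.Adj (B.ray 0) (φ x) := hbij.mapsTo hx
    obtain ⟨h1, h2⟩ := A.move_moveRay hx
    obtain ⟨h3, h4⟩ := B.move_moveRay hx'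
    refine Quotient.sound ⟨φ, ?_, ?_, ?_⟩
    · rw [move_verts A hx, move_verts B hx']; exact hφ
    · rw [move_verts A hx, h1, h3]; exact hadj
    · intro n
      rw [h2, h4]
      unfold moveRay
      simp only [hone x hx]
      split_ifs with h
      · exact hray _
      · cases n with
        | zero => rfl
        | succ n => exact hray n
  have hprob : ∀ x, A.graph.Adj (A.ray 0) x → A.stepProb lam x = B.stepProb lam (φ x) := by
    intro x hx
    have hx' : B.graph.Adj (B.ray 0) (φ x) := hbij.mapsTo hx
    simp [stepProb, hx, hx', hone x hx, hdeg]
  ext s hs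
  rw [stepLaw_apply lam A hs, stepLaw_apply lam B hs]
  have key : ∀ C : MarkedTree,
      (∑' x, C.stepProb lam x * s.indicator 1 (Quotient.mk setoid (C.move x))) =
      ∑' x : C.graph.neighborSet (C.ray 0),
        C.stepProb lam x * s.indicator 1 (Quotient.mk setoid (C.move x)) := by
    intro C
    symm
    apply tsum_subtype_eq_of_support_subset (s := C.graph.neighborSet (C.ray 0))
      (f := fun x => C.stepProb lam x * s.indicator 1 (Quotient.mk setoid (C.move x)))
    intro x hx
    by_contra hx'
    apply hx
    have : ¬ C.graph.Adj (C.ray 0) x := hx'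
    simp [stepProb, this]
  rw [key, key, ← (hbij.equiv φ).tsum_eq]
  refine tsum_congr fun x => ?_
  have : ((hbij.equiv φ x : B.graph.neighborSet (B.ray 0)) : Vertex) = φ x := rfl
  rw [this, ← hprob x x.2, ← hmove x x.2]

lemma stepLaw_univ (lam : ℝ≥0) (A : MarkedTree) : A.stepLaw lam Set.univ = 1 := by
  rw [stepLaw_apply lam A MeasurableSet.univ]
  simp only [Set.indicator_univ, Pi.one_apply, mul_one]
  have hfin := A.finite_neighborSet _ (A.ray_mem 0)
  have h2 := A.two_le_degree _ (A.ray_mem 0)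
  rw [tsum_eq_sum (s := hfin.toFinset) (fun x hx => by
    have : ¬ A.graph.Adj (A.ray 0) x := by simpa using hx
    simp [stepProb, this])]
  have h1 : A.ray 1 ∈ hfin.toFinset := by simpa using A.ray_adj 0
  have hcard : (hfin.toFinset.erase (A.ray 1)).card = A.rootDegree - 1 := by
    rw [Finset.card_erase_of_mem h1, rootDegree, Set.ncard_eq_toFinset_card _ hfin]
  rw [← Finset.add_sum_erase _ _ h1,
    Finset.sum_congr rfl (g := fun _ => 1 / ((A.rootDegree - 1 : ℕ) + lam : ℝ≥0∞)) (by
      intro x hx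
      rw [Finset.mem_erase] at hx
      have : A.graph.Adj (A.ray 0) x := by simpa using hx.2
      simp [stepProb, this, hx.1])]
  rw [Finset.sum_const, hcard, nsmul_eq_mul, mul_one_div]
  have : A.stepProb lam (A.ray 1) = lam / ((A.rootDegree - 1 : ℕ) + lam : ℝ≥0∞) := by
    simp [stepProb, A.ray_adj 0]
  rw [this, ← ENNReal.add_div, add_comm]
  apply ENNReal.div_self
  · have : A.rootDegree - 1 ≠ 0 := by unfold rootDegree; omega
    simp only [ne_eq, add_eq_zero, Nat.cast_eq_zero, not_and_or]
    exact Or.inl this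
  · exact ENNReal.add_ne_top.2 ⟨ENNReal.natCast_ne_top _, ENNReal.coe_ne_top⟩

lemma measurableSet_adj_ray (x : Vertex) :
    MeasurableSet {A : MarkedTree | A.graph.Adj (A.ray 0) x} := by
  have : {A : MarkedTree | A.graph.Adj (A.ray 0) x} =
      ⋃ u : Vertex, {A | A.ray 0 = u} ∩ {A | A.graph.Adj u x} := by ext A; simp
  rw [this]
  refine MeasurableSet.iUnion fun u => ?_
  exact (measurable_ray 0 (measurableSet_singleton u)).inter
    (measurableSet_setOfPred.2 (measurable_adj u x))

lemma measurableSet_eq_ray (x : Vertex) (n : ℕ) : MeasurableSet {A : MarkedTree | x = A.ray n} := by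
  have : {A : MarkedTree | x = A.ray n} = (fun A => A.ray n) ⁻¹' {x} := by
    ext A; exact eq_comm
  rw [this]
  exact measurable_ray n (measurableSet_singleton x)

lemma measurable_rootDegree : Measurable rootDegree := by
  classical
  have h : Measurable fun A : MarkedTree =>
      ∑' x : Vertex, (if A.graph.Adj (A.ray 0) x then 1 else 0 : ℝ≥0∞) :=
    Measurable.tsum fun x =>
      Measurable.ite (measurableSet_adj_ray x) measurable_const measurable_const
  have h2 : rootDegree = fun A : MarkedTree => ⌊(∑' x : Vertex,
      (if A.graph.Adj (A.ray 0) x then 1 else 0 : ℝ≥0∞)).toReal⌋₊ := by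
    ext A
    have hfin := A.finite_neighborSet _ (A.ray_mem 0)
    rw [tsum_eq_sum (s := hfin.toFinset) (fun x hx => by
      have : ¬ A.graph.Adj (A.ray 0) x := by simpa using hx
      simp [this])]
    rw [Finset.sum_congr rfl (g := fun _ => (1 : ℝ≥0∞)) (by
      intro x hx
      have : A.graph.Adj (A.ray 0) x := by simpa using hx
      simp [this])]
    simp [rootDegree, Set.ncard_eq_toFinset_card _ hfin]
  rw [h2]
  exact Nat.measurable_floor.comp h.ennreal_toReal

lemma measurable_stepProb (lam : ℝ≥0) (x : Vertex) :
    Measurable fun A : MarkedTree => A.stepProb lam x := by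
  unfold stepProb
  refine Measurable.ite (measurableSet_adj_ray x)
    (Measurable.ite (measurableSet_eq_ray x 1) ?_ ?_) measurable_const
  · exact (measurable_of_countable
      fun d : ℕ => (lam / ((d - 1 : ℕ) + lam : ℝ≥0∞) : ℝ≥0∞)).comp measurable_rootDegree
  · exact (measurable_of_countable
      fun d : ℕ => (1 / ((d - 1 : ℕ) + lam : ℝ≥0∞) : ℝ≥0∞)).comp measurable_rootDegree

lemma measurable_move (x : Vertex) : Measurable fun A : MarkedTree => A.move x := by
  classical
  refine measurable_comap_iff.2 (Measurable.prodMk ?_ ?_)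
  · have : ((fun A : MarkedTree => (fun u v => A.graph.Adj u v : Vertex → Vertex → Prop)) ∘
        fun A : MarkedTree => A.move x) = fun A : MarkedTree => (fun u v => A.graph.Adj u v) := by
      funext A
      by_cases h : A.graph.Adj (A.ray 0) x
      · simp [(A.move_moveRay h).1]
      · simp [move, h]
    change Measurable ((fun A : MarkedTree =>
      (fun u v => A.graph.Adj u v : Vertex → Vertex → Prop)) ∘ fun A : MarkedTree => A.move x)
    rw [this]
    exact measurable_fst.comp (comap_measurable _)
  · refine measurable_pi_iff.2 fun n => ?_
    have : (fun A : MarkedTree => (A.move x).ray n) = fun A : MarkedTree =>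
        if A.graph.Adj (A.ray 0) x then
          (if x = A.ray 1 then A.ray (n + 1) else Nat.casesOn n x A.ray)
        else A.ray n := by
      funext A
      by_cases h : A.graph.Adj (A.ray 0) x
      · simp only [(A.move_moveRay h).2, moveRay, h, if_true]
        split_ifs <;> rfl
      · simp [move, h]
    change Measurable (fun A : MarkedTree => (A.move x).ray n)
    rw [this]
    refine Measurable.ite (measurableSet_adj_ray x)
      (Measurable.ite (measurableSet_eq_ray x 1) (measurable_ray _) ?_) (measurable_ray _)
    cases n with
    | zero => exact measurable_const
    | succ n => exact measurable_ray n

lemma measurable_stepLaw (lam : ℝ≥0) : Measurable (stepLaw lam) := by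
  refine Measure.measurable_of_measurable_coe _ fun s hs => ?_
  simp only [stepLaw_apply lam _ hs]
  refine Measurable.tsum fun x => (measurable_stepProb lam x).mul ?_
  exact (measurable_one.indicator hs).comp (measurable_quotient_mk'.comp (measurable_move x))

end MarkedTree

/-- The Markov chain on trees with a marked ray: the environment seen from the walk which is
`lam`-biased towards the marked ray. -/
def rwKernel (lam : ℝ≥0) : Kernel TreeStar TreeStar where
  toFun := Quotient.lift (MarkedTree.stepLaw lam) fun _ _ h => MarkedTree.stepLaw_congr lam h
  measurable' := measurable_from_quotient.2 (MarkedTree.measurable_stepLaw lam)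

instance (lam : ℝ≥0) : IsMarkovKernel (rwKernel lam) :=
  ⟨fun q => Quotient.inductionOn q fun A => ⟨MarkedTree.stepLaw_univ lam A⟩⟩

/-! ### The augmented Galton-Watson measure -/

namespace PTree

lemma length_of_isChild {T : PTree} {u v : Vertex} (h : T.IsChild u v) :
    v.length = u.length + 1 := by
  obtain ⟨i, -, rfl⟩ := h
  simp

lemma isAcyclic_graph (T : PTree) : T.graph.IsAcyclic := by
  rw [SimpleGraph.isAcyclic_iff_forall_adj_isBridge]
  have key : ∀ u v, T.IsChild u v → T.graph.IsBridge s(u, v) := by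
    rintro u v ⟨i, hi, rfl⟩
    rw [SimpleGraph.isBridge_iff]
    rintro ⟨w⟩
    suffices H : ∀ (a b : Vertex), (T.graph.deleteEdges {s(u, u ++ [i])}).Walk a b →
        (u ++ [i] <+: a ↔ u ++ [i] <+: b) by
      have := ((H _ _ w).2 (List.prefix_refl _)).length_le
      simp at this
    have hchild : ∀ a b, T.IsChild a b → s(a, b) ≠ s(u, u ++ [i]) →
        (u ++ [i] <+: a ↔ u ++ [i] <+: b) := by
      rintro a _ ⟨j, -, rfl⟩ hne
      rw [List.prefix_concat_iff]
      refine ⟨Or.inr, ?_⟩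
      rintro (h | h)
      · obtain ⟨rfl, h2⟩ := List.append_inj' h rfl
        exact absurd (by rw [h2]) hne
      · exact h
    intro a b w
    induction w with
    | nil => rfl
    | cons h _ ih =>
      refine Iff.trans ?_ ih
      rw [SimpleGraph.deleteEdges_adj] at h
      rcases h with ⟨h | h, hne⟩
      · exact hchild _ _ h hne
      · exact (hchild _ _ h (by rw [Sym2.eq_swap]; exact hne)).symm
  intro u v h
  rcases h with h | h
  · exact key u v h
  · rw [Sym2.eq_swap]
    exact key v u h

lemma isVertex_of_reachable (T : PTree) {v : Vertex} (h : T.graph.Reachable [] v) :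
    T.IsVertex v := by
  obtain ⟨w⟩ := h
  suffices H : ∀ (a b : Vertex), T.graph.Walk a b → T.IsVertex a → T.IsVertex b from
    H _ _ w IsVertex.root
  intro a b w
  induction w with
  | nil => exact id
  | cons h _ ih =>
    intro ha
    apply ih
    rcases h with h | h
    · exact ha.child h
    · cases ha with
      | root => exact absurd (length_of_isChild h) (by simp)
      | child hu h' =>
        obtain ⟨i, -, rfl⟩ := h
        obtain ⟨j, -, h'⟩ := h'
        obtain ⟨rfl, -⟩ := List.append_inj' h' rfl
        exact hu

lemma finite_neighborSet (T : PTree) (u : Vertex) : (T.graph.neighborSet u).Finite := by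
  refine ((Finset.range (T u)).image (fun i => u ++ [i]) ∪ {u.dropLast}).finite_toSet.subset ?_
  rintro v (⟨i, hi, rfl⟩ | ⟨i, hi, h⟩)
  · simpa using Or.inr hi
  · simp [h]

lemma two_le_degree (T : PTree) (hT : 2 ≤ (T [] : ℕ)) {u : Vertex} (hu : T.IsVertex u) :
    2 ≤ (T.graph.neighborSet u).ncard := by
  have : 1 < (T.graph.neighborSet u).ncard := by
    rw [Set.one_lt_ncard (T.finite_neighborSet u)]
    cases hu with
    | root => exact ⟨[] ++ [0], Or.inl ⟨0, by omega, rfl⟩, [] ++ [1], Or.inl ⟨1, by omega, rfl⟩, by simp⟩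
    | @child w _ hw h =>
      refine ⟨w, Or.inr h, u ++ [0], Or.inl ⟨0, (T u).pos, rfl⟩, fun h' => ?_⟩
      have h1 := length_of_isChild h
      have h2 := congrArg List.length h'
      simp at h2
      omega
  exact this

/-- The tree `T`, whose root has at least two children, with a marked ray. -/
def marked (T : PTree) (hT : 2 ≤ (T [] : ℕ)) (ξ : ℕ → Vertex) (hξ : T.IsRay ξ) : MarkedTree where
  graph := T.graph
  ray := ξ
  acyclic := T.isAcyclic_graph
  finite_neighborSet v _ := T.finite_neighborSet v
  two_le_degree v hv := T.two_le_degree hT (T.isVertex_of_reachable (hξ.1 ▸ hv))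
  ray_adj n := Or.inl (hξ.2 n)
  ray_ne n h := by
    have h1 := length_of_isChild (hξ.2 n)
    have h2 := length_of_isChild (hξ.2 (n + 1))
    rw [show n + 1 + 1 = n + 2 from rfl, ← h] at h2
    omega

/-- A ray of `T`, seen as a ray of the tree obtained by joining `T` and `S`, which starts
from the root of `S`. -/
def joinRay (ξ : ℕ → Vertex) : ℕ → Vertex
  | 0 => []
  | n + 1 => 0 :: ξ n

lemma isRay_joinRay {T : PTree} (S : PTree) {ξ : ℕ → Vertex} (h : T.IsRay ξ) :
    (join T S).IsRay (joinRay ξ) := by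
  refine ⟨rfl, ?_⟩
  rintro (_ | n)
  · exact ⟨0, PNat.pos _, by simp [joinRay, h.1]⟩
  · obtain ⟨i, hi, h'⟩ := h.2 n
    exact ⟨i, hi, by simp [joinRay, h']⟩

end PTree

/-- Two rooted trees `T`, `S`, and a ray of `T`. -/
abbrev RayedPair := {x : (PTree × PTree) × (ℕ → Vertex) // x.1.1.IsRay x.2}

/-- The trees `T` and `S` joined by an edge between their roots, rooted at the root
of `S`, with the given ray of `T` marked. -/
def RayedPair.toTreeStar (x : RayedPair) : TreeStar :=
  Quotient.mk MarkedTree.setoid <|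
    (PTree.join x.1.1.1 x.1.1.2).marked
      (by have := (x.1.1.2 []).pos; simp only [PTree.join, PNat.add_coe, PNat.one_coe]; omega)
      (PTree.joinRay x.1.2) (PTree.isRay_joinRay _ x.2)

/-- The law of `((T, S), R)`: two independent Galton-Watson trees, and, given these, a
`lam`-harmonic ray `R` of `T`. -/
def pairLaw (p : PMF ℕ+) (lam : ℝ≥0) : Measure ((PTree × PTree) × (ℕ → Vertex)) :=
  ((GW p).prod (GW p)) ⊗ₘ ((harmonicMeasure lam).comap Prod.fst measurable_fst)

/-- The unnormalized density. The root of `S` has `S []` children in `S`. -/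
def density (lam : ℝ≥0) (T S : PTree) : ℝ :=
  (lam + (S [] : ℕ)) * escape lam T / (lam - 1 + escape lam T + effConductance lam S)

/-- The normalizing constant, the expectation of the density. -/
def normConst (p : PMF ℕ+) (lam : ℝ≥0) : ℝ≥0∞ :=
  ∫⁻ x, ENNReal.ofReal (density lam x.1 x.2) ∂((GW p).prod (GW p))

/-- The `lam`-augmented Galton-Watson measure on trees with a marked ray: the law of the marked
tree obtained by joining `T` and `S`, with the ray `R` of `T`, reweighted by the
normalized density. (The marked tree determines `(T, S)` up to isomorphism.) -/
def AGW (p : PMF ℕ+) (lam : ℝ≥0) : Measure TreeStar :=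
  (normConst p lam)⁻¹ •
    ((((pairLaw p lam).withDensity fun x => ENNReal.ofReal (density lam x.1.1 x.1.2)).comap
      (Subtype.val : RayedPair → _)).map RayedPair.toTreeStar)

end BiasedWalk

end

open MeasureTheory ProbabilityTheory
open scoped ENNReal NNReal

noncomputable section

namespace BiasedWalk

/-! ### The Markov property of `chain` -/

section Chain

variable {S S' : Type*} [MeasurableSpace S] [MeasurableSpace S']

/-! Write `C` for `effConductance`, `β` for `escape`, `T_i` for the subtree at the child `i` of the
root, and `ν` for the number of children of the root of `S`. A chain started from an invariant law
is stationary, so the substance is invariance under one step, which is checked on test functions as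
an identity between integrals over the pair `(T, S)`.

On a fixed tree, first-step analysis gives the conductance recursion `C(T) = ∑ β(T_i)`, `β = C /
(lam + C)` (`effConductance_eq_sum`, `escape_eq`). A last-exit decomposition at the root gives the
flow rule: `C(T)` times the harmonic measure of `T` is the sum over `i` of `β(T_i)` times the
harmonic measure of `T_i`, with the root put in front of the ray (`lintegral_harmonicMeasure_flow`).
The decomposition applies to events that ignore the beginning of the path, so the loop-erasure is
first identified with the limiting ray of the path.

On the random side, `exchange i` trades `T` for `S_i` and reverses the order of the two trees. It
only permutes independent labels, so it preserves the product law (`measurePreserving_exchange`). In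
the joined tree it is re-rooting at the child `i` of the root of `S` (`mk_move_succ`,
`mk_move_zero`).

With `W = (lam + C(T)) (lam + C(S)) - lam` the density is `(lam + ν) C(T) / W`. The factor `lam + ν`
cancels against the normalization of the step: a step to a child of the root of `S` has weight `C(T)
/ W`, the step along the ray `lam C(T) / W`. In the integral without a step, split `lam + ν = (lam +
C(S)) + ∑ (1 - β(S_i))`. By the flow rule the first part is a sum of terms `(lam + C(S)) / W ·
β(T_i)` (`flowTerm`), the second of terms `C(T) / W · (1 - β(S_i))` (`returnTerm`). Composed with
the exchange maps these become the outward and the inward steps, term by term. The reason is that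
`β(T) + C(S)` does not change when `T` and `S_i` trade places, so that `W / (lam + C(T))` is carried
along (`denom_exchange`).

For the normalization, the density is at most a constant times `lam + ν`, which is integrable
because the mean is finite. It is not almost surely zero as soon as `C(T) > 0` with positive
probability; recurrent trees have density zero, so no zero-one law is needed. For `lam < 1` every
tree is transient. Otherwise take `l` between `lam` and the mean: edge percolation with parameter `1
/ l` survives with positive probability, and the survival probability yields an explicit lower bound
for `β` through a supermartingale (`le_escape_of_subinvariant`,
`escape_pos_of_extinctionLim_lt_one`). -/

instance (κ : Kernel S S) [IsMarkovKernel κ] : IsMarkovKernel (chain κ) := by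
  unfold chain; infer_instance

/-- The sequence `x, ω 0, ω 1, ...`. -/
def consSeq {α : Type*} (x : α) (ω : ℕ → α) : ℕ → α
  | 0 => x
  | n + 1 => ω n

@[simp] lemma consSeq_zero {α : Type*} (x : α) (ω : ℕ → α) : consSeq x ω 0 = x := rfl
@[simp] lemma consSeq_succ {α : Type*} (x : α) (ω : ℕ → α) (n : ℕ) :
    consSeq x ω (n + 1) = ω n := rfl
@[simp] lemma shift_consSeq {α : Type*} (x : α) (ω : ℕ → α) : shift (consSeq x ω) = ω := rfl

lemma measurable_consSeq (x : S) : Measurable (consSeq x : (ℕ → S) → ℕ → S) := by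
  refine measurable_pi_iff.2 fun n => ?_
  cases n with
  | zero => exact measurable_const
  | succ n => exact measurable_pi_apply n

lemma measurable_shift : Measurable (shift : (ℕ → S) → ℕ → S) :=
  measurable_pi_iff.2 fun n => measurable_pi_apply (n + 1)

lemma chain_apply (κ : Kernel S S) [IsMarkovKernel κ] (x : S) :
    chain κ x = Kernel.traj (X := fun _ => S)
      (fun n => κ.comap (fun h : (i : Finset.Iic n) → S => h ⟨n, Finset.mem_Iic.2 le_rfl⟩)
        (measurable_pi_apply _)) 0 (fun _ => x) := rfl

/-- By construction the trajectory up to time `M + 1` is the composition product of the trajectory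
up to time `M` with the kernel, so the last coordinate can be integrated out. -/
lemma lintegral_chain_last (κ : Kernel S S) [IsMarkovKernel κ] (x : S) (M : ℕ)
    {f : ℕ → S → ℝ≥0∞} (hf : ∀ i, Measurable (f i)) :
    ∫⁻ ω, ∏ i ∈ Finset.range (M + 2), f i (ω i) ∂chain κ x =
      ∫⁻ ω, (∏ i ∈ Finset.range (M + 1), f i (ω i)) * ∫⁻ y, f (M + 1) y ∂κ (ω M)
        ∂chain κ x := by
  set K : (n : ℕ) → Kernel ((i : Finset.Iic n) → S) S := fun n =>
    κ.comap (fun h : (i : Finset.Iic n) → S => h ⟨n, Finset.mem_Iic.2 le_rfl⟩)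
        (measurable_pi_apply _) with hK
  have key := Kernel.partialTraj_compProd_eq_map_traj (X := fun _ => S) (κ := K)
    (a := 0) (b := M) (Nat.zero_le M) (x₀ := fun _ => x)
  let F : ((i : Finset.Iic M) → S) × S → ℝ≥0∞ := fun q =>
    (∏ i : Finset.Iic M, f i (q.1 i)) * f (M + 1) q.2
  have hF : Measurable F := by
    refine Measurable.mul (Finset.measurable_fun_prod _ fun i _ => ?_) ((hf _).comp measurable_snd)
    exact (hf _).comp ((measurable_pi_apply i).comp measurable_fst)
  have hprod : ∀ ω : ℕ → S, (∏ i : Finset.Iic M, f i (ω i)) =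
      ∏ i ∈ Finset.range (M + 1), f i (ω i) := by
    intro ω
    rw [show Finset.range (M + 1) = Finset.Iic M by ext; simp]
    exact Finset.prod_coe_sort (Finset.Iic M) (fun i => f i (ω i))
  have h1 : ∫⁻ q : (Finset.Iic M → S) × S, F q ∂((Kernel.partialTraj (X := fun _ => S) K 0 M (fun _ => x)) ⊗ₘ (K M)) =
      ∫⁻ ω, F (Preorder.frestrictLe M ω, ω (M + 1)) ∂chain κ x := by
    rw [key, lintegral_map hF (by fun_prop)]
    rfl
  have h2 : ∫⁻ q : (Finset.Iic M → S) × S, F q ∂((Kernel.partialTraj (X := fun _ => S) K 0 M (fun _ => x)) ⊗ₘ (K M)) =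
      ∫⁻ ω, ∫⁻ y, F (Preorder.frestrictLe M ω, y) ∂(κ (ω M)) ∂chain κ x := by
    rw [Measure.lintegral_compProd hF, ← Kernel.traj_map_frestrictLe_apply, lintegral_map]
    · rfl
    · exact hF.lintegral_kernel_prod_right'
    · fun_prop
  rw [h1] at h2
  have e1 : ∀ ω : ℕ → S, F (Preorder.frestrictLe M ω, ω (M + 1)) =
      ∏ i ∈ Finset.range (M + 2), f i (ω i) := by
    intro ω
    rw [Finset.prod_range_succ, ← hprod ω]
    rfl
  simp only [e1] at h2
  rw [h2]
  refine lintegral_congr fun ω => ?_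
  rw [← hprod ω, ← lintegral_const_mul _ (hf _)]
  rfl

lemma ae_chain_zero (κ : Kernel S S) [IsMarkovKernel κ] (x : S) {f : S → ℝ≥0∞}
    (hf : Measurable f) : ∫⁻ ω, f (ω 0) ∂chain κ x = f x := by
  have h := Kernel.traj_map_frestrictLe_apply (X := fun _ => S) (κ := (fun n =>
    κ.comap (fun h : (i : Finset.Iic n) → S => h ⟨n, Finset.mem_Iic.2 le_rfl⟩)
        (measurable_pi_apply _))) 0 0 (fun _ => x)
  have h' : ∫⁻ ω, f (ω 0) ∂chain κ x = ∫⁻ q, f (q ⟨0, by simp⟩) ∂((chain κ x).map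
      (Preorder.frestrictLe (π := fun _ => S) 0)) := by
    rw [lintegral_map (f := fun q : Finset.Iic 0 → S => f (q ⟨0, by simp⟩))
      (hf.comp (measurable_pi_apply _)) (by fun_prop)]
    rfl
  rw [h', chain_apply, h, Kernel.partialTraj_self, Kernel.id_apply]
  exact lintegral_dirac' (f := fun q : Finset.Iic 0 → S => f (q ⟨0, by simp⟩)) _
    (hf.comp (measurable_pi_apply _))

/-- The Ionescu-Tulcea construction peels off the last step, but first-step analysis needs the first
one. In the induction the last factor is integrated out and absorbed into the factor before it (the
functions `g`), which shortens the product by one. -/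
lemma lintegral_chain_first (κ : Kernel S S) [IsMarkovKernel κ] (M : ℕ) :
    ∀ (f : ℕ → S → ℝ≥0∞), (∀ i, Measurable (f i)) → ∀ x,
    ∫⁻ ω, ∏ i ∈ Finset.range (M + 2), f i (ω i) ∂chain κ x =
      f 0 x * ∫⁻ y, ∫⁻ ω, ∏ i ∈ Finset.range (M + 1), f (i + 1) (ω i) ∂chain κ y ∂κ x := by
  induction M with
  | zero =>
    intro f hf x
    rw [lintegral_chain_last κ x 0 hf]
    simp only [zero_add, Finset.prod_range_one]
    rw [ae_chain_zero κ x (f := fun z => f 0 z * ∫⁻ y, f 1 y ∂κ z)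
      ((hf 0).mul (hf 1).lintegral_kernel)]
    congr 1
    exact lintegral_congr fun y => (ae_chain_zero κ y (hf 1)).symm
  | succ M ih =>
    intro f hf x
    let g : ℕ → S → ℝ≥0∞ := fun i z =>
      if i = M + 1 then f (M + 1) z * ∫⁻ y, f (M + 2) y ∂κ z else f i z
    have hg : ∀ i, Measurable (g i) := by
      intro i
      by_cases h : i = M + 1
      · simp only [g, h, if_true]
        exact (hf _).mul (hf _).lintegral_kernel
      · simp only [g, h, if_false]
        exact hf i
    have e1 : ∀ ω : ℕ → S, (∏ i ∈ Finset.range (M + 2), f i (ω i)) *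
        ∫⁻ y, f (M + 1 + 1) y ∂κ (ω (M + 1)) = ∏ i ∈ Finset.range (M + 2), g i (ω i) := by
      intro ω
      rw [Finset.prod_range_succ, Finset.prod_range_succ _ (M + 1), mul_assoc]
      congr 1
      · refine Finset.prod_congr rfl fun i hi => ?_
        have : i ≠ M + 1 := by have := Finset.mem_range.1 hi; omega
        simp [g, this]
      · simp [g]
    have e2 : ∀ ω : ℕ → S, (∏ i ∈ Finset.range (M + 1), f (i + 1) (ω i)) *
        ∫⁻ y, f (M + 1 + 1) y ∂κ (ω M) = ∏ i ∈ Finset.range (M + 1), g (i + 1) (ω i) := by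
      intro ω
      rw [Finset.prod_range_succ, Finset.prod_range_succ _ M, mul_assoc]
      congr 1
      · refine Finset.prod_congr rfl fun i hi => ?_
        have : i ≠ M := by have := Finset.mem_range.1 hi; omega
        simp [g, this]
      · simp [g]
    rw [lintegral_chain_last κ x (M + 1) hf]
    simp only [e1]
    rw [ih g hg x]
    have : g 0 x = f 0 x := by simp [g]
    rw [this]
    congr 1
    refine lintegral_congr fun y => ?_
    rw [lintegral_chain_last κ y M (f := fun i => f (i + 1)) fun i => hf (i + 1)]
    simp only [e2]

/-- Finite measures on sequences are determined by the finite-dimensional boxes. -/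
lemma ext_of_boxes {μ ν : Measure (ℕ → S)} [IsFiniteMeasure μ] [IsFiniteMeasure ν]
    (h : ∀ (s : ℕ → Set S) (M : ℕ), (∀ i, MeasurableSet (s i)) →
      μ {ω | ∀ i < M + 1, ω i ∈ s i} = ν {ω | ∀ i < M + 1, ω i ∈ s i}) : μ = ν := by
  classical
  refine ext_of_generate_finite _ generateFrom_squareCylinders.symm
    (isPiSystem_squareCylinders (fun _ => MeasurableSpace.isPiSystem_measurableSet)
      fun _ => MeasurableSet.univ) ?_ ?_
  · rintro _ ⟨I, t, ht, rfl⟩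
    have := h (fun i => if i ∈ I then t i else Set.univ) (I.sup id) fun i => by
      split_ifs
      · exact ht i (Set.mem_univ i)
      · exact MeasurableSet.univ
    have e : {ω : ℕ → S | ∀ i < I.sup id + 1, ω i ∈ if i ∈ I then t i else Set.univ} =
        (I : Set ℕ).pi t := by
      ext ω
      simp only [Set.mem_ofPred_eq, Set.mem_pi, Finset.mem_coe]
      constructor
      · intro h i hi
        have := h i (Nat.lt_succ_of_le (Finset.le_sup (f := id) hi))
        rwa [if_pos hi] at this
      · intro h i _
        split_ifs with hi
        · exact h i hi
        · trivial
    rwa [e] at this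
  · simpa using h (fun _ => Set.univ) 0 fun _ => MeasurableSet.univ

lemma chain_box_succ (κ : Kernel S S) [IsMarkovKernel κ] (s : ℕ → Set S)
    (hs : ∀ i, MeasurableSet (s i)) (M : ℕ) (x : S) :
    chain κ x {ω | ∀ i < M + 2, ω i ∈ s i} =
      (s 0).indicator 1 x * ∫⁻ y, chain κ y {ω | ∀ i < M + 1, ω i ∈ s (i + 1)} ∂κ x := by
  have key : ∀ (t : ℕ → Set S), (∀ i, MeasurableSet (t i)) → ∀ (N : ℕ) (y : S),
      chain κ y {ω | ∀ i < N, ω i ∈ t i} =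
        ∫⁻ ω, ∏ i ∈ Finset.range N, (t i).indicator (1 : S → ℝ≥0∞) (ω i) ∂chain κ y := by
    intro t ht N y
    have hm : MeasurableSet {ω : ℕ → S | ∀ i < N, ω i ∈ t i} := by
      have : {ω : ℕ → S | ∀ i < N, ω i ∈ t i} =
          ⋂ i, ⋂ (_ : i < N), (fun ω : ℕ → S => ω i) ⁻¹' t i := by ext; simp
      rw [this]
      exact MeasurableSet.iInter fun i => MeasurableSet.iInter fun _ =>
        measurable_pi_apply i (ht i)
    rw [← lintegral_indicator_one hm]
    refine lintegral_congr fun ω => ?_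
    by_cases h : ∀ i < N, ω i ∈ t i
    · rw [Set.indicator_of_mem (by exact h)]
      symm
      refine Finset.prod_eq_one fun i hi => ?_
      simp [h i (Finset.mem_range.1 hi)]
    · rw [Set.indicator_of_notMem (by exact h)]
      push Not at h
      obtain ⟨i, hi, hi'⟩ := h
      symm
      exact Finset.prod_eq_zero (Finset.mem_range.2 hi) (by simp [hi'])
  rw [key s hs, lintegral_chain_first κ M (fun i => (s i).indicator 1)
    fun i => measurable_one.indicator (hs i)]
  congr 1
  exact lintegral_congr fun y => (key (fun i => s (i + 1)) (fun i => hs _) (M + 1) y).symm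

lemma chain_box_one (κ : Kernel S S) [IsMarkovKernel κ] (s : ℕ → Set S)
    (hs : ∀ i, MeasurableSet (s i)) (x : S) :
    chain κ x {ω | ∀ i < 0 + 1, ω i ∈ s i} = (s 0).indicator 1 x := by
  have hm : MeasurableSet {ω : ℕ → S | ω 0 ∈ s 0} := measurable_pi_apply 0 (hs 0)
  have e : {ω : ℕ → S | ∀ i < 0 + 1, ω i ∈ s i} = {ω : ℕ → S | ω 0 ∈ s 0} := by
    ext ω; simp
  rw [e, ← lintegral_indicator_one hm]
  exact ae_chain_zero κ x (f := (s 0).indicator 1) (measurable_one.indicator (hs 0))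

/-- The Markov property at time one. -/
lemma chain_eq_bind (κ : Kernel S S) [IsMarkovKernel κ] (x : S) :
    chain κ x = (κ x).bind ((chain κ).map (consSeq x)) := by
  have hmk : IsMarkovKernel ((chain κ).map (consSeq x)) :=
    Kernel.IsMarkovKernel.map _ (measurable_consSeq x)
  have : IsProbabilityMeasure ((κ x).bind ((chain κ).map (consSeq x))) := by
    infer_instance
  refine ext_of_boxes fun s M hs => ?_
  have hm : ∀ N : ℕ, MeasurableSet {ω : ℕ → S | ∀ i < N, ω i ∈ s i} := by
    intro N
    have : {ω : ℕ → S | ∀ i < N, ω i ∈ s i} =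
        ⋂ i, ⋂ (_ : i < N), (fun ω : ℕ → S => ω i) ⁻¹' s i := by ext; simp
    rw [this]
    exact MeasurableSet.iInter fun i => MeasurableSet.iInter fun _ =>
      measurable_pi_apply i (hs i)
  rw [Measure.bind_apply (hm _) (Kernel.measurable _).aemeasurable]
  simp only [Kernel.map_apply' _ (measurable_consSeq x) _ (hm _)]
  cases M with
  | zero =>
    rw [chain_box_one κ s hs]
    have : consSeq x ⁻¹' {ω : ℕ → S | ∀ i < 0 + 1, ω i ∈ s i} = {_ω : ℕ → S | x ∈ s 0} := by
      ext ω; simp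
    rw [this]
    by_cases hx : x ∈ s 0 <;> simp [hx]
  | succ M =>
    rw [chain_box_succ κ s hs]
    have : consSeq x ⁻¹' {ω : ℕ → S | ∀ i < M + 1 + 1, ω i ∈ s i} =
        {ω : ℕ → S | x ∈ s 0 ∧ ∀ i < M + 1, ω i ∈ s (i + 1)} := by
      ext ω
      simp only [Set.mem_preimage, Set.mem_ofPred_eq]
      constructor
      · exact fun h => ⟨h 0 (by omega), fun i hi => h (i + 1) (by omega)⟩
      · rintro ⟨h0, h⟩ (_ | i) hi
        · exact h0
        · exact h i (by omega)
    rw [this]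
    by_cases hx : x ∈ s 0 <;> simp [hx]

/-- First-step analysis, the form in which the Markov property is used for events below. -/
lemma chain_apply_eq_lintegral (κ : Kernel S S) [IsMarkovKernel κ] (x : S) {A : Set (ℕ → S)}
    (hA : MeasurableSet A) :
    chain κ x A = ∫⁻ y, chain κ y {ω | consSeq x ω ∈ A} ∂κ x := by
  conv_lhs => rw [chain_eq_bind]
  rw [Measure.bind_apply hA (Kernel.measurable _).aemeasurable]
  simp only [Kernel.map_apply' _ (measurable_consSeq x) _ hA]
  rfl

/-- A Markov chain started from an invariant law is stationary. -/
lemma measurePreserving_shift (κ : Kernel S S) [IsMarkovKernel κ] {μ : Measure S}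
    (h : Kernel.Invariant κ μ) : MeasurePreserving shift (chainLaw κ μ) (chainLaw κ μ) := by
  refine ⟨measurable_shift, ?_⟩
  ext A hA
  unfold chainLaw
  rw [Measure.map_apply measurable_shift hA,
    Measure.bind_apply (measurable_shift hA) (Kernel.measurable _).aemeasurable]
  have : ∀ x, chain κ x (shift ⁻¹' A) = ∫⁻ y, chain κ y A ∂κ x := fun x => by
    rw [chain_apply_eq_lintegral κ x (measurable_shift hA)]
    rfl
  simp only [this]
  have hb : (μ.bind κ).bind (chain κ) A = ∫⁻ x, ∫⁻ y, chain κ y A ∂κ x ∂μ := by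
    rw [Measure.bind_apply hA (Kernel.measurable _).aemeasurable,
      Measure.lintegral_bind (Kernel.measurable _).aemeasurable
        (Kernel.measurable_coe _ hA).aemeasurable]
  rw [← hb, h.def]

/-! ### Almost sure properties, lumping and exits of Markov chains -/

lemma chain_zero_mem (κ : Kernel S S) [IsMarkovKernel κ] (x : S) {s : Set S}
    (hs : MeasurableSet s) (hx : x ∈ s) : ∀ᵐ ω ∂chain κ x, ω 0 ∈ s := by
  have h := chain_box_one κ (fun _ => sᶜ) (fun _ => hs.compl) x
  rw [Set.indicator_of_notMem (by simpa using hx)] at h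
  rw [ae_iff]
  convert h using 2
  ext ω
  simp

/-- If every step respects the relation `R`, so does almost every trajectory. -/
lemma ae_chain_step (κ : Kernel S S) [IsMarkovKernel κ] {R : S → S → Prop}
    (hR : MeasurableSet {q : S × S | R q.1 q.2}) (h : ∀ x, ∀ᵐ y ∂κ x, R x y) (x : S) :
    ∀ᵐ ω ∂chain κ x, ∀ n, R (ω n) (ω (n + 1)) := by
  have hm : ∀ n, MeasurableSet {ω : ℕ → S | ¬ R (ω n) (ω (n + 1))} := fun n =>
    (hR.preimage (f := fun ω : ℕ → S => (ω n, ω (n + 1)))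
      ((measurable_pi_apply n).prodMk (measurable_pi_apply (n + 1)))).compl
  rw [ae_all_iff]
  intro n
  induction n generalizing x with
  | zero =>
    rw [ae_iff, chain_apply_eq_lintegral κ x (hm 0)]
    refine (lintegral_congr_ae ?_).trans lintegral_zero
    filter_upwards [h x] with y hy
    have := chain_zero_mem κ y (s := {z | R x z}) (measurable_prodMk_left hR) hy
    rw [ae_iff] at this
    exact this
  | succ n ih =>
    rw [ae_iff, chain_apply_eq_lintegral κ x (hm (n + 1))]
    refine (lintegral_congr fun y => ?_).trans lintegral_zero
    have := ih y
    rw [ae_iff] at this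
    exact this

/-- Two chains which are related by a map `f` while they stay in `D'` have the same law on the
event that they stay in `D'` forever. -/
lemma chain_lump (κ : Kernel S S) [IsMarkovKernel κ] (κ' : Kernel S' S') [IsMarkovKernel κ']
    {f : S → S'} (hf : Measurable f) {D' : Set S'} (hD : MeasurableSet D')
    (h : ∀ x, f x ∈ D' → ((κ x).map f).restrict D' = (κ' (f x)).restrict D') (x : S)
    {A : Set (ℕ → S')} (hA : MeasurableSet A) :
    chain κ x {ω | (fun n => f (ω n)) ∈ A ∧ ∀ n, f (ω n) ∈ D'} =
      chain κ' (f x) {ω | ω ∈ A ∧ ∀ n, ω n ∈ D'} := by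
  have hfm : Measurable fun (ω : ℕ → S) n => f (ω n) :=
    measurable_pi_iff.2 fun n => hf.comp (measurable_pi_apply n)
  have hstay : MeasurableSet {ω : ℕ → S' | ∀ n, ω n ∈ D'} := by
    have : {ω : ℕ → S' | ∀ n, ω n ∈ D'} = ⋂ n, (fun ω : ℕ → S' => ω n) ⁻¹' D' := by
      ext; simp
    rw [this]
    exact MeasurableSet.iInter fun n => measurable_pi_apply n hD
  have hboxm : ∀ {R : Type _} [MeasurableSpace R] (s : ℕ → Set R), (∀ i, MeasurableSet (s i)) →
      ∀ M : ℕ, MeasurableSet {ω : ℕ → R | ∀ i < M + 1, ω i ∈ s i} := by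
    intro R _ s hs M
    have : {ω : ℕ → R | ∀ i < M + 1, ω i ∈ s i} =
        ⋂ i, ⋂ (_ : i < M + 1), (fun ω : ℕ → R => ω i) ⁻¹' s i := by ext; simp
    rw [this]
    exact MeasurableSet.iInter fun i => MeasurableSet.iInter fun _ => measurable_pi_apply i (hs i)
  have box : ∀ (M : ℕ) (s : ℕ → Set S'), (∀ i, MeasurableSet (s i)) → (∀ i, s i ⊆ D') → ∀ x,
      chain κ x {ω | ∀ i < M + 1, f (ω i) ∈ s i} =
        chain κ' (f x) {ω | ∀ i < M + 1, ω i ∈ s i} := by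
    intro M
    induction M with
    | zero =>
      intro s hs _ x
      rw [chain_box_one κ' s hs]
      exact (chain_box_one κ (fun i => f ⁻¹' s i) (fun i => hf (hs i)) x).trans rfl
    | succ M ih =>
      intro s hs hsD x
      rw [chain_box_succ κ' s hs]
      refine (chain_box_succ κ (fun i => f ⁻¹' s i) (fun i => hf (hs i)) M x).trans ?_
      by_cases hx : f x ∈ s 0
      swap
      · simp [hx]
      have e : ∀ y, chain κ y {ω | ∀ i < M + 1, ω i ∈ f ⁻¹' s (i + 1)} =
          chain κ' (f y) {ω | ∀ i < M + 1, ω i ∈ s (i + 1)} := fun y =>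
        ih (fun i => s (i + 1)) (fun i => hs _) (fun i => hsD _) y
      simp only [e]
      congr 1
      -- The remaining box starts in a subset of `D'`, so `q` vanishes off `D'` and only the
      -- restrictions of the two step laws to `D'` matter.
      set q : S' → ℝ≥0∞ := fun y => chain κ' y {ω | ∀ i < M + 1, ω i ∈ s (i + 1)} with hq
      have hqm : Measurable q := Kernel.measurable_coe _ (hboxm _ (fun i => hs _) M)
      have hq0 : ∀ y, y ∉ D' → q y = 0 := by
        intro y hy
        have := chain_zero_mem κ' y hD.compl hy
        rw [ae_iff] at this
        refine measure_mono_null ?_ this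
        intro ω hω
        simpa using hsD _ (hω 0 (by omega))
      have hqi : ∀ m : Measure S', ∫⁻ y, q y ∂m = ∫⁻ y, q y ∂(m.restrict D') := by
        intro m
        rw [← lintegral_indicator hD]
        refine lintegral_congr fun y => ?_
        by_cases hy : y ∈ D'
        · simp [hy]
        · simp [hy, hq0 y hy]
      change ∫⁻ y, q (f y) ∂κ x = ∫⁻ y, q y ∂κ' (f x)
      rw [← lintegral_map hqm hf, hqi, hqi (κ' (f x)), h x (hsD 0 hx)]
  have heq : ((chain κ x).map fun ω n => f (ω n)).restrict {ω | ∀ n, ω n ∈ D'} =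
      (chain κ' (f x)).restrict {ω | ∀ n, ω n ∈ D'} := by
    refine ext_of_boxes fun s M hs => ?_
    rw [Measure.restrict_apply (hboxm s hs M), Measure.restrict_apply (hboxm s hs M),
      Measure.map_apply hfm ((hboxm s hs M).inter hstay)]
    -- The sides of an infinite box, which is the decreasing limit of finite boxes with sides inside
    -- `D'`. The value does not depend on the first argument; only `t 0` is used at the end.
    let t : ℕ → ℕ → Set S' := fun N i => if i < M + 1 then s i ∩ D' else D'
    have ht : ∀ N i, MeasurableSet (t N i) := by
      intro N i
      by_cases hi : i < M + 1
      · simp only [t, hi, if_true]; exact (hs i).inter hD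
      · simp only [t, hi, if_false]; exact hD
    have htD : ∀ N i, t N i ⊆ D' := by
      intro N i
      by_cases hi : i < M + 1
      · simp only [t, hi, if_true]; exact Set.inter_subset_right
      · simp only [t, hi, if_false]; exact subset_rfl
    have e : ∀ ω : ℕ → S', ω ∈ {ω : ℕ → S' | ∀ i < M + 1, ω i ∈ s i} ∩ {ω | ∀ n, ω n ∈ D'} ↔
        ∀ i, ω i ∈ t 0 i := by
      intro ω
      simp only [Set.mem_inter_iff, Set.mem_ofPred_eq, t]
      constructor
      · rintro ⟨h1, h2⟩ i
        split_ifs with hi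
        · exact ⟨h1 i hi, h2 i⟩
        · exact h2 i
      · intro h
        refine ⟨fun i hi => ?_, fun i => htD 0 i (h i)⟩
        have := h i
        rw [if_pos hi] at this
        exact this.1
    have e1 : {ω : ℕ → S' | ∀ i < M + 1, ω i ∈ s i} ∩ {ω | ∀ n, ω n ∈ D'} =
        ⋂ N : ℕ, {ω : ℕ → S' | ∀ i < N + 1, ω i ∈ t 0 i} := by
      ext ω
      rw [e]
      simp only [Set.mem_iInter, Set.mem_ofPred_eq]
      exact ⟨fun h N i _ => h i, fun h i => h i i (Nat.lt_succ_self i)⟩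
    have hm1 : ∀ N, MeasurableSet {ω : ℕ → S' | ∀ i < N + 1, ω i ∈ t 0 i} :=
      fun N => hboxm _ (ht 0) N
    have ha : Antitone fun N : ℕ => {ω : ℕ → S' | ∀ i < N + 1, ω i ∈ t 0 i} :=
      fun a b hab ω hω i hi => hω i (by omega)
    have t1 := tendsto_measure_iInter_atTop (μ := (chain κ x).map fun ω n => f (ω n))
      (fun N => (hm1 N).nullMeasurableSet) ha ⟨0, measure_ne_top _ _⟩
    have t2 := tendsto_measure_iInter_atTop (μ := chain κ' (f x))
      (fun N => (hm1 N).nullMeasurableSet) ha ⟨0, measure_ne_top _ _⟩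
    rw [← e1] at t1 t2
    have : (((chain κ x).map fun ω n => f (ω n)) ∘
          fun N : ℕ => {ω : ℕ → S' | ∀ i < N + 1, ω i ∈ t 0 i}) =
        (chain κ' (f x)) ∘ fun N : ℕ => {ω : ℕ → S' | ∀ i < N + 1, ω i ∈ t 0 i} := by
      funext N
      simp only [Function.comp]
      rw [Measure.map_apply hfm (hm1 N)]
      exact box N (t 0) (ht 0) (htD 0) x
    rw [this] at t1
    rw [← Measure.map_apply hfm ((hboxm s hs M).inter hstay)]
    exact tendsto_nhds_unique t1 t2
  have := congrArg (fun m => m A) heq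
  simp only [Measure.restrict_apply hA] at this
  rw [Measure.map_apply hfm (hA.inter hstay)] at this
  exact this

lemma chain_map (κ : Kernel S S) [IsMarkovKernel κ] (κ' : Kernel S' S') [IsMarkovKernel κ']
    {f : S → S'} (hf : Measurable f) (h : ∀ x, (κ x).map f = κ' (f x)) (x : S) :
    (chain κ x).map (fun ω n => f (ω n)) = chain κ' (f x) := by
  have hfm : Measurable fun (ω : ℕ → S) n => f (ω n) :=
    measurable_pi_iff.2 fun n => hf.comp (measurable_pi_apply n)
  ext A hA
  rw [Measure.map_apply hfm hA]
  have := chain_lump κ κ' hf MeasurableSet.univ (fun x _ => by rw [h]) x hA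
  simp only [Set.mem_univ, implies_true, and_true] at this
  exact this

/-- Decomposition of a shift-invariant event according to whether the chain leaves `D`, when the
only exit from `D` is `a`. -/
lemma chain_exit (κ : Kernel S S) [IsMarkovKernel κ] {D : Set S} (hD : MeasurableSet D) {a : S}
    (haD : a ∉ D) (hexit : ∀ x ∈ D, ∀ᵐ y ∂κ x, y ∈ D ∨ y = a) {A : Set (ℕ → S)}
    (hA : MeasurableSet A) (hinv : ∀ x ∈ D, ∀ ω, consSeq x ω ∈ A ↔ ω ∈ A) {x : S}
    (hx : x ∈ D) :
    chain κ x A = chain κ x {ω | ω ∈ A ∧ ∀ n, ω n ∈ D} +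
      chain κ x {ω | ∃ n, ω n ∉ D} * chain κ a A := by
  have hs1 : ∀ N : ℕ, MeasurableSet {ω : ℕ → S | ∀ n < N + 1, ω n ∈ D} := by
    intro N
    have : {ω : ℕ → S | ∀ i < N + 1, ω i ∈ D} =
        ⋂ i, ⋂ (_ : i < N + 1), (fun ω : ℕ → S => ω i) ⁻¹' D := by ext; simp
    rw [this]
    exact MeasurableSet.iInter fun i => MeasurableSet.iInter fun _ => measurable_pi_apply i hD
  have hAm : ∀ N : ℕ, MeasurableSet {ω : ℕ → S | ω ∈ A ∧ ∀ n < N + 1, ω n ∈ D} := fun N =>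
    hA.inter (hs1 N)
  have hsc : ∀ N : ℕ, MeasurableSet {ω : ℕ → S | ∃ n < N + 1, ω n ∉ D} := by
    intro N
    have : {ω : ℕ → S | ∃ n < N + 1, ω n ∉ D} = {ω : ℕ → S | ∀ n < N + 1, ω n ∈ D}ᶜ := by
      ext; simp
    rw [this]
    exact (hs1 N).compl
  -- The strong Markov property at the exit time, truncated at `N` and proved by induction through
  -- the first step: adding a state of `D` in front does not affect `A`. The state `a` has to be
  -- included because the first step may lead there; from `a` the exit has already happened and the
  -- identity is trivial.
  have key : ∀ (N : ℕ) (x : S), x ∈ D ∨ x = a → chain κ x A =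
      chain κ x {ω | ω ∈ A ∧ ∀ n < N + 1, ω n ∈ D} +
        chain κ x {ω | ∃ n < N + 1, ω n ∉ D} * chain κ a A := by
    have outside : ∀ N : ℕ, chain κ a A =
        chain κ a {ω | ω ∈ A ∧ ∀ n < N + 1, ω n ∈ D} +
        chain κ a {ω | ∃ n < N + 1, ω n ∉ D} * chain κ a A := by
      intro N
      have h0 := chain_zero_mem κ a hD.compl haD
      have h1 : chain κ a {ω | ω ∈ A ∧ ∀ n < N + 1, ω n ∈ D} = 0 := by
        rw [ae_iff] at h0
        refine measure_mono_null ?_ h0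
        intro ω hω
        simpa using hω.2 0 (by omega)
      have h2 : chain κ a {ω | ∃ n < N + 1, ω n ∉ D} = 1 := by
        rw [prob_compl_eq_zero_iff (hsc N) |>.symm]
        rw [ae_iff] at h0
        refine measure_mono_null ?_ h0
        intro ω hω h
        exact hω ⟨0, by omega, h⟩
      rw [h1, h2, zero_add, one_mul]
    intro N
    induction N with
    | zero =>
      rintro x (hx | rfl)
      · have h0 := chain_zero_mem κ x hD hx
        have h1 : chain κ x {ω | ∃ n < 0 + 1, ω n ∉ D} = 0 := by
          rw [ae_iff] at h0
          convert h0 using 2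
          ext; simp
        rw [h1, zero_mul, add_zero]
        refine measure_congr ?_
        filter_upwards [h0] with ω hω
        refine propext ⟨fun h => ⟨h, fun n hn => ?_⟩, fun h => h.1⟩
        obtain rfl : n = 0 := by omega
        exact hω
      · exact outside 0
    | succ N ih =>
      rintro x (hx | rfl)
      · rw [chain_apply_eq_lintegral κ x hA, chain_apply_eq_lintegral κ x (hAm (N + 1)),
          chain_apply_eq_lintegral κ x (hsc (N + 1))]
        have e1 : {ω | consSeq x ω ∈ A} = A := Set.ext fun ω => hinv x hx ω
        have e2 : {ω | consSeq x ω ∈ {ω | ω ∈ A ∧ ∀ n < N + 1 + 1, ω n ∈ D}} =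
            {ω | ω ∈ A ∧ ∀ n < N + 1, ω n ∈ D} := by
          ext ω
          simp only [Set.mem_ofPred_eq, hinv x hx]
          refine and_congr_right fun _ => ⟨fun h n hn => h (n + 1) (by omega), ?_⟩
          rintro h (_ | n) hn
          · exact hx
          · exact h n (by omega)
        have e3 : {ω | consSeq x ω ∈ {ω | ∃ n < N + 1 + 1, ω n ∉ D}} =
            {ω | ∃ n < N + 1, ω n ∉ D} := by
          ext ω
          simp only [Set.mem_ofPred_eq]
          constructor
          · rintro ⟨_ | n, hn, h⟩
            · exact absurd hx h
            · exact ⟨n, by omega, h⟩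
          · rintro ⟨n, hn, h⟩
            exact ⟨n + 1, by omega, h⟩
        rw [e1, e2, e3, ← lintegral_mul_const _ (Kernel.measurable_coe _ (hsc N)),
          ← lintegral_add_left (Kernel.measurable_coe _ (hAm N))]
        refine lintegral_congr_ae ?_
        filter_upwards [hexit x hx] with y hy
        exact ih y hy
      · exact outside (N + 1)
  have ha : Antitone fun N : ℕ => {ω : ℕ → S | ω ∈ A ∧ ∀ n < N + 1, ω n ∈ D} :=
    fun b c hbc ω hω => ⟨hω.1, fun i hi => hω.2 i (by omega)⟩
  have hmon : Monotone fun N : ℕ => {ω : ℕ → S | ∃ n < N + 1, ω n ∉ D} := by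
    rintro b c hbc ω ⟨n, hn, h⟩
    exact ⟨n, by omega, h⟩
  have t1 := tendsto_measure_iInter_atTop (μ := chain κ x)
      (fun N => (hAm N).nullMeasurableSet) ha ⟨0, measure_ne_top _ _⟩
  have t2 := tendsto_measure_iUnion_atTop (μ := chain κ x) hmon
  have e1 : ⋂ N : ℕ, {ω : ℕ → S | ω ∈ A ∧ ∀ n < N + 1, ω n ∈ D} =
      {ω | ω ∈ A ∧ ∀ n, ω n ∈ D} := by
    ext ω
    simp only [Set.mem_iInter, Set.mem_ofPred_eq]
    exact ⟨fun h => ⟨(h 0).1, fun n => (h n).2 n (by omega)⟩, fun h N => ⟨h.1, fun n _ => h.2 n⟩⟩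
  have e2 : ⋃ N : ℕ, {ω : ℕ → S | ∃ n < N + 1, ω n ∉ D} = {ω | ∃ n, ω n ∉ D} := by
    ext ω
    simp only [Set.mem_iUnion, Set.mem_ofPred_eq]
    exact ⟨fun ⟨_, n, _, h⟩ => ⟨n, h⟩, fun ⟨n, h⟩ => ⟨n, n, by omega, h⟩⟩
  rw [e1] at t1
  rw [e2] at t2
  have t3 := t1.add (ENNReal.Tendsto.mul_const t2 (b := chain κ a A)
    (Or.inr (measure_ne_top _ _)))
  refine tendsto_nhds_unique (tendsto_const_nhds (x := chain κ x A)) (t3.congr fun N => ?_)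
  exact (key N x (Or.inl hx)).symm

end Chain

/-! ### The walk on a fixed tree -/

/-- The transition kernel of the `lam`-biased walk on the tree `T`. -/
def stepOn (lam : ℝ≥0) (T : PTree) : Kernel Vertex Vertex where
  toFun u := stepMeasure lam (T u) u
  measurable' := measurable_of_countable _

lemma stepOn_apply (lam : ℝ≥0) (T : PTree) (u : Vertex) :
    stepOn lam T u = stepMeasure lam (T u) u := rfl

instance (lam : ℝ≥0) (T : PTree) : IsMarkovKernel (stepOn lam T) :=
  ⟨fun u => inferInstanceAs (IsProbabilityMeasure (stepMeasure lam (T u) u))⟩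

/-- The tree coordinate never moves, so `u ↦ (T, u)` intertwines the two kernels. From here on the
tree is a parameter. -/
lemma walk_eq_chain (lam : ℝ≥0) (T : PTree) (u : Vertex) :
    walk lam (T, u) = chain (stepOn lam T) u := by
  have h := chain_map (stepOn lam T) (treeStep lam) (f := fun u => (T, u)) (by fun_prop)
    (fun u => by
      have : treeStep lam (T, u) = (Measure.dirac T).prod (stepOn lam T u) := by
        unfold treeStep
        rw [Kernel.prod_apply, Kernel.deterministic_apply]
        rfl
      rw [this, Measure.dirac_prod]) u
  unfold walk
  rw [Kernel.map_apply _ (by fun_prop), ← h, Measure.map_map (by fun_prop) (by fun_prop)]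
  exact Measure.map_id

lemma lintegral_step_root (lam : ℝ≥0) (d : ℕ+) (f : Vertex → ℝ≥0∞) :
    ∫⁻ v, f v ∂stepMeasure lam d [] = ∑ i ∈ Finset.range d, 1 / (d : ℝ≥0∞) * f [i] := by
  simp [stepMeasure, lintegral_finsetSum_measure, lintegral_smul_measure]

lemma lintegral_step_of_ne (lam : ℝ≥0) (d : ℕ+) {u : Vertex} (hu : u ≠ []) (f : Vertex → ℝ≥0∞) :
    ∫⁻ v, f v ∂stepMeasure lam d u = lam / (d + lam : ℝ≥0∞) * f u.dropLast +
      ∑ i ∈ Finset.range d, 1 / (d + lam : ℝ≥0∞) * f (u ++ [i]) := by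
  simp [stepMeasure, hu, lintegral_finsetSum_measure, lintegral_smul_measure, lintegral_add_measure]

lemma ae_stepMeasure (lam : ℝ≥0) (d : ℕ+) (u : Vertex) :
    ∀ᵐ v ∂stepMeasure lam d u, (∃ i < (d : ℕ), v = u ++ [i]) ∨ (u ≠ [] ∧ v = u.dropLast) := by
  rw [ae_iff, ← lintegral_indicator_one (by measurability)]
  by_cases hu : u = []
  · subst hu
    rw [lintegral_step_root]
    refine Finset.sum_eq_zero fun i hi => ?_
    have := Finset.mem_range.1 hi
    simp [this]
  · rw [lintegral_step_of_ne lam d hu]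
    simp only [add_eq_zero]
    refine ⟨by simp [hu], Finset.sum_eq_zero fun i hi => ?_⟩
    have := Finset.mem_range.1 hi
    simp [this]

lemma isPrefix_dropLast {w x : Vertex} (h : w <+: x) (hne : x ≠ w) : w <+: x.dropLast := by
  obtain ⟨t, rfl⟩ := h
  have ht : t ≠ [] := by rintro rfl; simp at hne
  rw [List.dropLast_append_of_ne_nil ht]
  exact List.prefix_append _ _

lemma not_isPrefix_dropLast {w : Vertex} (hw : w ≠ []) : ¬ w <+: w.dropLast := by
  intro h
  have := h.length_le
  have h0 := List.length_pos_iff.2 hw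
  simp at this
  omega

/-- The only edge out of the subtree of `w` joins `w` to its parent. -/
lemma ae_stepMeasure_exit (lam : ℝ≥0) (d : ℕ+) {w x : Vertex} (h : w <+: x) :
    ∀ᵐ y ∂stepMeasure lam d x, w <+: y ∨ y = w.dropLast := by
  filter_upwards [ae_stepMeasure lam d x] with y hy
  rcases hy with ⟨i, -, rfl⟩ | ⟨-, rfl⟩
  · exact Or.inl (h.trans (List.prefix_append _ _))
  · by_cases hx : x = w
    · exact Or.inr (by rw [hx])
    · exact Or.inl (isPrefix_dropLast h hx)

/-- The subtree of `T` at the child with label `i` of the root. -/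
def sub (T : PTree) (i : ℕ) : PTree := fun u => T (i :: u)

lemma measurableSet_forall_vertex (D : Set Vertex) :
    MeasurableSet {X : ℕ → Vertex | ∀ n, X n ∈ D} := by
  have : {ω : ℕ → Vertex | ∀ n, ω n ∈ D} = ⋂ n, (fun ω : ℕ → Vertex => ω n) ⁻¹' D := by
    ext; simp
  rw [this]
  exact MeasurableSet.iInter fun n => measurable_pi_apply n (Set.to_countable D).measurableSet

lemma measurable_map_path (f : Vertex → Vertex) :
    Measurable fun (X : ℕ → Vertex) n => f (X n) :=
  measurable_pi_iff.2 fun n => (measurable_of_countable f).comp (measurable_pi_apply n)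

/-- The law of the walk on `T`, started at the root `e` and killed when it jumps
to the additional vertex `e_*` of `T_*`. -/
def killedWalk (lam : ℝ≥0) (T : PTree) : Measure (ℕ → Vertex) :=
  ((chain (stepOn lam T.star) [0]).restrict {X | ∀ n, X n ≠ []}).map fun X n => (X n).tail

instance (lam : ℝ≥0) (T : PTree) : IsFiniteMeasure (killedWalk lam T) := by
  unfold killedWalk; infer_instance

lemma killedWalk_apply (lam : ℝ≥0) (T : PTree) {A : Set (ℕ → Vertex)} (hA : MeasurableSet A) :
    killedWalk lam T A = chain (stepOn lam T.star) [0]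
      {X | (fun n => (X n).tail) ∈ A ∧ ∀ n, X n ≠ []} := by
  unfold killedWalk
  rw [Measure.map_apply (measurable_map_path _) hA,
    Measure.restrict_apply (measurable_map_path _ hA)]
  rfl

lemma killedWalk_univ (lam : ℝ≥0) (T : PTree) :
    killedWalk lam T Set.univ = ENNReal.ofReal (escape lam T) := by
  rw [killedWalk_apply lam T MeasurableSet.univ, escape, walk_eq_chain, Measure.real,
    ENNReal.ofReal_toReal (measure_ne_top _ _)]
  simp

lemma killedWalk_real_univ (lam : ℝ≥0) (T : PTree) :
    (killedWalk lam T).real Set.univ = escape lam T := by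
  rw [Measure.real, killedWalk_univ, escape, ENNReal.toReal_ofReal measureReal_nonneg]

/-- The only child of `e_*` has label `0`, so the walk never sees the meaningless words that start
with a positive label. -/
lemma ae_star_walk (lam : ℝ≥0) (T : PTree) :
    ∀ᵐ X ∂chain (stepOn lam T.star) [0], ∀ n, X n = [] ∨ [0] <+: X n := by
  have h1 := ae_chain_step (stepOn lam T.star)
    (R := fun x y => (x = [] ∨ [0] <+: x) → (y = [] ∨ [0] <+: y))
    ((Set.to_countable _).measurableSet) (fun x => by
      by_cases hx : x = []
      · subst hx
        filter_upwards [ae_stepMeasure lam (T.star []) []] with y hy _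
        rcases hy with ⟨i, hi, rfl⟩ | ⟨h, -⟩
        · simp [PTree.star] at hi
          simp [hi]
        · exact absurd rfl h
      · by_cases hx' : [0] <+: x
        · filter_upwards [ae_stepMeasure_exit lam (T.star x) hx'] with y hy _
          exact hy.symm
        · exact Filter.Eventually.of_forall fun y h => by tauto) [0]
  have h2 := chain_zero_mem (stepOn lam T.star) [0] (measurableSet_singleton [0]) rfl
  filter_upwards [h1, h2] with X hX h0 n
  induction n with
  | zero => right; rw [h0]
  | succ n ih => exact hX n ih

/-- The walk inside a subtree is the walk on that subtree, killed when it leaves. -/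
lemma chain_subtree (lam : ℝ≥0) (T U : PTree) {w : Vertex} (hw : w ≠ [])
    (hU : ∀ u, T (w ++ u) = U u) {A : Set (ℕ → Vertex)} (hA : MeasurableSet A) :
    chain (stepOn lam T) w {X | X ∈ A ∧ ∀ n, w <+: X n} =
      killedWalk lam U {Y | (fun n => w ++ Y n) ∈ A} := by
  -- Places the tree `U` with its extra parent inside `T`: the root goes to `w` and `e_*` to the
  -- parent of `w`. Meaningless words also go to that parent, so that `f v` is below `w` exactly
  -- when `v` is below `[0]`.
  let f : Vertex → Vertex := fun v => if [0] <+: v then w ++ v.tail else w.dropLast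
  have hf0 : ∀ u, f (0 :: u) = w ++ u := fun u => by simp [f]
  have hfD : ∀ v, w <+: f v ↔ [0] <+: v := by
    intro v
    by_cases h : [0] <+: v
    · simp [f, h]
    · simp only [f, h, if_false, iff_false]
      exact not_isPrefix_dropLast hw
  have hlump := chain_lump (stepOn lam U.star) (stepOn lam T) (f := f) (measurable_of_countable f)
    (D' := {v | w <+: v}) (Set.to_countable _).measurableSet (by
      intro x hx
      obtain ⟨u, rfl⟩ : ∃ u, x = 0 :: u := by
        obtain ⟨u, rfl⟩ := (hfD x).1 hx
        exact ⟨u, rfl⟩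
      congr 1
      refine Measure.ext_of_lintegral _ fun g hg => ?_
      rw [lintegral_map hg (measurable_of_countable f), stepOn_apply, stepOn_apply,
        lintegral_step_of_ne lam _ (by simp), hf0, lintegral_step_of_ne lam _ (by simp [hw]), hU]
      have hs : U.star (0 :: u) = U u := rfl
      rw [hs]
      have e1 : f (0 :: u).dropLast = (w ++ u).dropLast := by
        by_cases hu : u = []
        · subst hu; simp [f]
        · rw [List.dropLast_append_of_ne_nil hu, List.dropLast_cons_of_ne_nil hu, hf0]
      have e2 : ∀ i, f (0 :: u ++ [i]) = w ++ u ++ [i] := fun i => by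
        rw [List.cons_append, hf0, List.append_assoc]
      simp only [e1, e2]) [0] hA
  have hfw : f [0] = w := by simp [f]
  rw [hfw] at hlump
  refine hlump.symm.trans ?_
  rw [killedWalk_apply lam U (A := {Y | (fun n => w ++ Y n) ∈ A}) (measurable_map_path _ hA)]
  refine measure_congr ?_
  filter_upwards [ae_star_walk lam U] with X hX
  have e : ∀ n, w <+: f (X n) ↔ X n ≠ [] := by
    intro n
    rw [hfD]
    rcases hX n with h | h
    · simp [h]
    · simp only [h, true_iff]
      rintro h'
      simp [h'] at h
  refine propext ?_
  change ((fun n => f (X n)) ∈ A ∧ ∀ n, w <+: f (X n)) ↔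
    ((fun n => w ++ (X n).tail) ∈ A ∧ ∀ n, X n ≠ [])
  simp only [e]
  refine and_congr_left fun h => ?_
  have : (fun n => f (X n)) = fun n => w ++ (X n).tail := by
    funext n
    have : [0] <+: X n := (hX n).resolve_left (h n)
    simp [f, this]
  rw [this]

lemma chain_stay (lam : ℝ≥0) (T : PTree) {w : Vertex} (hw : w ≠ []) :
    chain (stepOn lam T) w {X | ∀ n, X n ≠ w.dropLast} =
      chain (stepOn lam T) w {X | ∀ n, w <+: X n} := by
  refine measure_congr ?_
  have h1 := ae_chain_step (stepOn lam T)
    (R := fun x y => w <+: x → (w <+: y ∨ y = w.dropLast))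
    ((Set.to_countable _).measurableSet) (fun x => by
      by_cases hx' : w <+: x
      · filter_upwards [ae_stepMeasure_exit lam (T x) hx'] with y hy _
        exact hy
      · exact Filter.Eventually.of_forall fun y h => absurd h hx') w
  have h2 := chain_zero_mem (stepOn lam T) w (measurableSet_singleton w) rfl
  filter_upwards [h1, h2] with X hX h0
  refine propext ⟨fun h n => ?_, fun h n h' => ?_⟩
  · induction n with
    | zero => rw [h0]
    | succ n ih => exact (hX n ih).resolve_right (h (n + 1))
  · have := h n
    rw [h'] at this
    exact not_isPrefix_dropLast hw this

lemma chain_subtree_univ (lam : ℝ≥0) (T U : PTree) {w : Vertex} (hw : w ≠ [])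
    (hU : ∀ u, T (w ++ u) = U u) :
    (chain (stepOn lam T) w).real {X | ∀ n, w <+: X n} = escape lam U := by
  have := chain_subtree lam T U hw hU MeasurableSet.univ
  simp only [Set.mem_univ, true_and, Set.ofPred_true] at this
  rw [Measure.real, this, ← killedWalk_real_univ]
  rfl

/-- A set of paths is invariant if it is not affected by an additional first step. -/
def ShiftInvariant (A : Set (ℕ → Vertex)) : Prop := ∀ x ω, consSeq x ω ∈ A ↔ ω ∈ A

/-- Either the walk stays below `w` forever, which is the killed walk on `U`, or it leaves to the
parent with probability `1 - β(U)` and starts afresh there, since `A` does not see the time spent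
below `w`. -/
lemma chain_descend (lam : ℝ≥0) (T U : PTree) {w : Vertex} (hw : w ≠ [])
    (hU : ∀ u, T (w ++ u) = U u) {A : Set (ℕ → Vertex)} (hA : MeasurableSet A)
    (hinv : ∀ x, w <+: x → ∀ ω, consSeq x ω ∈ A ↔ ω ∈ A) :
    (chain (stepOn lam T) w).real A = (killedWalk lam U).real {Y | (fun n => w ++ Y n) ∈ A} +
      (1 - escape lam U) * (chain (stepOn lam T) w.dropLast).real A := by
  have h := chain_exit (stepOn lam T) (D := {v | w <+: v}) (Set.to_countable _).measurableSet
    (a := w.dropLast) (not_isPrefix_dropLast hw)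
    (fun x hx => ae_stepMeasure_exit lam (T x) hx) hA hinv (x := w) (List.prefix_refl w)
  have h1 : (chain (stepOn lam T) w).real {ω | ∃ n, ω n ∉ {v | w <+: v}} = 1 - escape lam U := by
    have hc := probReal_compl_eq_one_sub (μ := chain (stepOn lam T) w)
      (measurableSet_forall_vertex {v | w <+: v})
    simp only [Set.mem_ofPred_eq] at hc ⊢
    rw [← chain_subtree_univ lam T U hw hU, ← hc]
    congr 1
    ext ω
    simp
  rw [← h1, Measure.real, h, ENNReal.toReal_add (measure_ne_top _ _)
    (ENNReal.mul_ne_top (measure_ne_top _ _) (measure_ne_top _ _)), ENNReal.toReal_mul]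
  congr 1
  rw [Measure.real, ← chain_subtree lam T U hw hU hA]
  rfl

/-! ### Series and parallel laws for the escape probability -/

lemma escape_nonneg (lam : ℝ≥0) (T : PTree) : 0 ≤ escape lam T := measureReal_nonneg

lemma escape_le_one (lam : ℝ≥0) (T : PTree) : escape lam T ≤ 1 := by
  unfold escape
  rw [walk_eq_chain]
  exact measureReal_le_one

lemma effConductance_nonneg (lam : ℝ≥0) (T : PTree) : 0 ≤ effConductance lam T :=
  mul_nonneg ENNReal.toReal_nonneg measureReal_nonneg

lemma chain_real_root (lam : ℝ≥0) (T : PTree) {A : Set (ℕ → Vertex)} (hA : MeasurableSet A) :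
    (T [] : ℝ) * (chain (stepOn lam T) []).real A =
      ∑ i ∈ Finset.range (T []), (chain (stepOn lam T) [i]).real {X | consSeq [] X ∈ A} := by
  have hd : (T [] : ℝ) ≠ 0 := by simp
  rw [Measure.real, chain_apply_eq_lintegral _ _ hA, stepOn_apply, lintegral_step_root,
    ENNReal.toReal_sum (fun i _ => ENNReal.mul_ne_top (by simp) (measure_ne_top _ _)),
    Finset.mul_sum]
  refine Finset.sum_congr rfl fun i _ => ?_
  rw [ENNReal.toReal_mul]
  simp [Measure.real, hd]

lemma chain_real_of_ne (lam : ℝ≥0) (T : PTree) {u : Vertex} (hu : u ≠ [])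
    {A : Set (ℕ → Vertex)} (hA : MeasurableSet A) :
    ((T u : ℝ) + lam) * (chain (stepOn lam T) u).real A =
      lam * (chain (stepOn lam T) u.dropLast).real {X | consSeq u X ∈ A} +
      ∑ i ∈ Finset.range (T u),
        (chain (stepOn lam T) (u ++ [i])).real {X | consSeq u X ∈ A} := by
  have hd : (0 : ℝ) < (T u : ℝ) + lam := by positivity
  have hf : ∀ (B : Set (ℕ → Vertex)) v, (1 / ((T u : ℝ≥0∞) + lam)) * chain (stepOn lam T) v B ≠ ∞ :=
    fun B v => ENNReal.mul_ne_top (by simp) (measure_ne_top _ _)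
  have hf' : ∀ (B : Set (ℕ → Vertex)) v, (lam / ((T u : ℝ≥0∞) + lam)) * chain (stepOn lam T) v B ≠ ∞ :=
    fun B v => ENNReal.mul_ne_top (ENNReal.div_ne_top (by simp) (by simp)) (measure_ne_top _ _)
  have ht : ((T u : ℝ≥0∞) + lam).toReal = (T u : ℝ) + lam := by
    rw [ENNReal.toReal_add (by simp) (by simp)]
    simp
  rw [Measure.real, chain_apply_eq_lintegral _ _ hA, stepOn_apply, lintegral_step_of_ne _ _ hu,
    ENNReal.toReal_add (hf' _ _) (ENNReal.sum_ne_top.2 fun i _ => hf _ _),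
    ENNReal.toReal_sum (fun i _ => hf _ _), mul_add, Finset.mul_sum]
  congr 1
  · rw [ENNReal.toReal_mul, ENNReal.toReal_div, ht]
    simp only [Measure.real, ENNReal.coe_toReal]
    field_simp
  · refine Finset.sum_congr rfl fun i _ => ?_
    rw [ENNReal.toReal_mul, ENNReal.toReal_div, ht]
    simp only [Measure.real, ENNReal.toReal_one]
    field_simp

lemma vertexConductance_root (lam : ℝ≥0) (hlam : lam ≠ 0) (T : PTree) :
    vertexConductance lam T [] = T [] := by
  unfold vertexConductance
  simp only [edgeConductance_eq lam hlam T PTree.IsVertex.root]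
  rw [ENNReal.tsum_mul_left]
  have := (step lam (T, [])).tsum_indicator_apply_singleton Set.univ MeasurableSet.univ
  have : ∑' v, step lam (T, []) {v} = 1 := by simpa using this
  simp [this]

/-- The effective conductance of `T` is the sum of the escape probabilities of the subtrees. -/
lemma effConductance_eq_sum (lam : ℝ≥0) (hlam : lam ≠ 0) (T : PTree) :
    effConductance lam T = ∑ i ∈ Finset.range (T []), escape lam (sub T i) := by
  have hm : MeasurableSet {X : ℕ → Vertex | ∀ n, 1 ≤ n → X n ≠ []} := by
    have : {X : ℕ → Vertex | ∀ n, 1 ≤ n → X n ≠ []} =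
        ⋂ n, ⋂ (_ : 1 ≤ n), (fun X : ℕ → Vertex => X n) ⁻¹' {[]}ᶜ := by ext; simp
    rw [this]
    exact MeasurableSet.iInter fun n => MeasurableSet.iInter fun _ =>
      measurable_pi_apply n (measurableSet_singleton _).compl
  unfold effConductance
  rw [vertexConductance_root lam hlam, walk_eq_chain]
  have : ((T [] : ℝ≥0∞)).toReal = (T [] : ℝ) := by simp
  rw [this, chain_real_root lam T hm]
  refine Finset.sum_congr rfl fun i _ => ?_
  rw [← chain_subtree_univ lam T (sub T i) (w := [i]) (by simp) (fun u => rfl)]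
  have := chain_stay lam T (w := [i]) (by simp)
  simp only [Measure.real]
  rw [← this]
  congr 2
  ext X
  simp only [Set.mem_ofPred_eq]
  constructor
  · intro h n
    exact h (n + 1) (by omega)
  · rintro h (_ | n) hn
    · omega
    · exact h n

lemma shiftInvariant_eq {A : Set (ℕ → Vertex)} (hinv : ShiftInvariant A) (x : Vertex) :
    {X | consSeq x X ∈ A} = A := Set.ext fun ω => hinv x ω

lemma ShiftInvariant.map {A : Set (ℕ → Vertex)} (hinv : ShiftInvariant A) (f : Vertex → Vertex) :
    ShiftInvariant {Y | (fun n => f (Y n)) ∈ A} := by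
  intro x ω
  have : (fun n => f (consSeq x ω n)) = consSeq (f x) fun n => f (ω n) := by
    funext n
    cases n <;> rfl
  simp only [Set.mem_ofPred_eq, this]
  exact hinv _ _

/-- Decomposition of an invariant event at the last visit of the root. -/
lemma effConductance_mul_chain (lam : ℝ≥0) (hlam : lam ≠ 0) (T : PTree) {A : Set (ℕ → Vertex)}
    (hA : MeasurableSet A) (hinv : ShiftInvariant A) :
    effConductance lam T * (chain (stepOn lam T) []).real A =
      ∑ i ∈ Finset.range (T []), (killedWalk lam (sub T i)).real {Y | (fun n => i :: Y n) ∈ A} := by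
  -- With `chain_descend`, the first step gives `ν P(A) = ∑ (K_i(A) + (1 - β_i) P(A))` for the
  -- killed laws `K_i` of the subtrees. The terms `ν P(A)` cancel and `∑ β_i` is the conductance.
  have h := chain_real_root lam T hA
  rw [shiftInvariant_eq hinv] at h
  rw [Finset.sum_congr rfl (fun i _ => chain_descend lam T (sub T i) (w := [i]) (by simp)
    (fun u => rfl) hA fun x _ => hinv x), Finset.sum_add_distrib] at h
  simp only [List.dropLast_singleton, ← Finset.sum_mul, Finset.sum_sub_distrib, Finset.sum_const,
    Finset.card_range, nsmul_eq_mul, mul_one] at h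
  rw [← effConductance_eq_sum lam hlam] at h
  have e : ∀ i, (killedWalk lam (sub T i)).real {Y | (fun n => [i] ++ Y n) ∈ A} =
    (killedWalk lam (sub T i)).real {Y | (fun n => i :: Y n) ∈ A} := fun i => rfl
  simp only [e] at h
  linarith

/-- The same first-step computation in `T_*` from `e`: the step to `e_*` contributes nothing, so its
weight `lam` survives on the left. The right side is that of `effConductance_mul_chain`; hence
killed and unkilled walk are proportional on invariant events. -/
lemma add_effConductance_mul_killedWalk (lam : ℝ≥0) (hlam : lam ≠ 0) (T : PTree)
    {A : Set (ℕ → Vertex)} (hA : MeasurableSet A) (hinv : ShiftInvariant A) :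
    (lam + effConductance lam T) * (killedWalk lam T).real A =
      ∑ i ∈ Finset.range (T []), (killedWalk lam (sub T i)).real {Y | (fun n => i :: Y n) ∈ A} := by
  set B : Set (ℕ → Vertex) := {X | (fun n => (X n).tail) ∈ A ∧ ∀ n, [0] <+: X n} with hB
  have hAt : MeasurableSet {X : ℕ → Vertex | (fun n => (X n).tail) ∈ A} := measurable_map_path _ hA
  have hBm : MeasurableSet B := hAt.inter (measurableSet_forall_vertex {v | [0] <+: v})
  have hK : ∀ C : Set (ℕ → Vertex), MeasurableSet C → killedWalk lam T C =
      chain (stepOn lam T.star) [0] {X | (fun n => (X n).tail) ∈ C ∧ ∀ n, [0] <+: X n} := by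
    intro C hC
    have := chain_subtree lam T.star T (w := [0]) (by simp) (fun u => rfl)
      (A := {X | (fun n => (X n).tail) ∈ C}) (measurable_map_path _ hC)
    refine Eq.trans ?_ this.symm
    rfl
  have h := chain_real_of_ne lam T.star (u := [0]) (by simp) hBm
  have e0 : {X : ℕ → Vertex | consSeq [0] X ∈ B} = B := by
    ext X
    simp only [hB, Set.mem_ofPred_eq]
    refine and_congr (hinv.map List.tail [0] X) ⟨fun h n => h (n + 1), ?_⟩
    rintro h (_ | n)
    · exact List.prefix_refl _
    · exact h n
  rw [e0] at h
  have hpar : (chain (stepOn lam T.star) [0].dropLast).real B = 0 := by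
    rw [Measure.real, ENNReal.toReal_eq_zero_iff]
    left
    have h2 := chain_zero_mem (stepOn lam T.star) [] (measurableSet_singleton []) rfl
    rw [ae_iff] at h2
    refine measure_mono_null ?_ h2
    rintro X ⟨-, hX⟩ h0
    have := hX 0
    rw [h0] at this
    simp at this
  rw [hpar, mul_zero, zero_add] at h
  have hKA : (killedWalk lam T).real A = (chain (stepOn lam T.star) [0]).real B := by
    rw [Measure.real, hK A hA]
    rfl
  have hchild : ∀ i, (chain (stepOn lam T.star) ([0] ++ [i])).real B =
      (killedWalk lam (sub T i)).real {Y | (fun n => i :: Y n) ∈ A} +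
        (1 - escape lam (sub T i)) * (chain (stepOn lam T.star) [0]).real B := by
    intro i
    rw [chain_descend lam T.star (sub T i) (w := [0] ++ [i]) (by simp) (fun u => rfl) hBm]
    · have : {Y : ℕ → Vertex | (fun n => [0] ++ [i] ++ Y n) ∈ B} =
          {Y | (fun n => i :: Y n) ∈ A} := by
        ext Y
        simp [hB]
      rw [this]
      rfl
    · intro x hx ω
      simp only [hB, Set.mem_ofPred_eq]
      refine and_congr (hinv.map List.tail x ω) ⟨fun h n => h (n + 1), ?_⟩
      rintro h (_ | n)
      · exact (List.prefix_append _ _).trans hx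
      · exact h n
  have hs : T.star [0] = T [] := rfl
  rw [hs, Finset.sum_congr rfl fun i _ => hchild i, Finset.sum_add_distrib, ← Finset.sum_mul,
    Finset.sum_sub_distrib, ← effConductance_eq_sum lam hlam, ← hKA] at h
  simp only [Finset.sum_const, Finset.card_range, nsmul_eq_mul, mul_one] at h
  linarith

/-- The whole space is an invariant event, for which the recursion of the killed walk reads `(lam +
C) β = C`. -/
lemma escape_eq (lam : ℝ≥0) (hlam : lam ≠ 0) (T : PTree) :
    escape lam T = effConductance lam T / (lam + effConductance lam T) := by
  have h := add_effConductance_mul_killedWalk lam hlam T MeasurableSet.univ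
    (fun _ _ => by simp)
  simp only [Set.mem_univ, Set.ofPred_true, killedWalk_real_univ,
    ← effConductance_eq_sum lam hlam] at h
  have h0 : (0 : ℝ) < lam := by positivity
  have := effConductance_nonneg lam T
  rw [eq_div_iff (by positivity), mul_comm]
  exact h

/-- On invariant events, the walk killed at `e_*` is the walk on `T`, up to the
escape probability. -/
lemma killedWalk_real_eq (lam : ℝ≥0) (hlam : lam ≠ 0) (T : PTree) {A : Set (ℕ → Vertex)}
    (hA : MeasurableSet A) (hinv : ShiftInvariant A) :
    (killedWalk lam T).real A = escape lam T * (chain (stepOn lam T) []).real A := by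
  have h1 := add_effConductance_mul_killedWalk lam hlam T hA hinv
  rw [← effConductance_mul_chain lam hlam T hA hinv] at h1
  have h0 : (0 : ℝ) < lam := by positivity
  have := effConductance_nonneg lam T
  rw [escape_eq lam hlam]
  field_simp
  linarith

/-- The last-exit decomposition with the killed walks replaced by full walks on the subtrees. It is
now a recursion for the walk itself and becomes the flow rule. -/
lemma effConductance_mul_chain_eq (lam : ℝ≥0) (hlam : lam ≠ 0) (T : PTree)
    {A : Set (ℕ → Vertex)} (hA : MeasurableSet A) (hinv : ShiftInvariant A) :
    effConductance lam T * (chain (stepOn lam T) []).real A =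
      ∑ i ∈ Finset.range (T []), escape lam (sub T i) *
        (chain (stepOn lam (sub T i)) []).real {Y | (fun n => i :: Y n) ∈ A} := by
  rw [effConductance_mul_chain lam hlam T hA hinv]
  refine Finset.sum_congr rfl fun i _ => ?_
  exact killedWalk_real_eq lam hlam (sub T i) (measurable_map_path _ hA) (hinv.map _)

/-! ### A supermartingale bound for the escape probability -/

/-- A function of the tree, bounded by one, which is dominated by one step of the conductance recursion
is a lower bound for the escape probability. -/
lemma le_escape_of_subinvariant (lam : ℝ≥0) (b : PTree → ℝ)
    (hb1 : ∀ T, b T ≤ 1)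
    (hb : ∀ T : PTree, lam * b T ≤ (∑ i ∈ Finset.range (T []), b (sub T i)) * (1 - b T))
    (T : PTree) : b T ≤ escape lam T := by
  let subAt : Vertex → PTree := fun u v => T (u ++ v)
  -- The product of `1 - b` over `u` and its ancestors. Extended by the value `1` at `e_*`, it is a
  -- supermartingale for the walk on `T_*`, so the probability of ever hitting `e_*` is at most its
  -- value `1 - b T` at the root.
  let r : Vertex → ℝ := fun u => ∏ k ∈ Finset.range (u.length + 1), (1 - b (subAt (u.take k)))
  let R : Vertex → ℝ := fun v => match v with
    | [] => 1
    | _ :: u => r u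
  have hr0 : ∀ u, 0 ≤ r u := fun u => Finset.prod_nonneg fun k _ => by linarith [hb1 (subAt (u.take k))]
  have hrc : ∀ u i, r (u ++ [i]) = r u * (1 - b (subAt (u ++ [i]))) := by
    intro u i
    simp only [r, List.length_append, List.length_singleton]
    rw [Finset.prod_range_succ]
    congr 1
    · refine Finset.prod_congr rfl fun k hk => ?_
      have := Finset.mem_range.1 hk
      rw [List.take_append_of_le_length (by omega)]
    · rw [List.take_of_length_le (by simp)]
  have hR0 : ∀ v, 0 ≤ R v := fun v => match v with
    | [] => zero_le_one
    | _ :: u => hr0 u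
  have hpar : ∀ u, R (0 :: u).dropLast * (1 - b (subAt u)) = r u := by
    intro u
    rcases List.eq_nil_or_concat u with rfl | ⟨u, i, rfl⟩
    · simp [R, r]
    · rw [List.concat_eq_append, hrc]
      have : (0 :: (u ++ [i])).dropLast = 0 :: u := by
        rw [← List.cons_append, List.dropLast_concat]
      rw [this]
  have hsuper : ∀ u, ∫⁻ v, ENNReal.ofReal (R v) ∂stepOn lam T.star (0 :: u) ≤
      ENNReal.ofReal (R (0 :: u)) := by
    intro u
    have hd : (0 : ℝ) < (T u : ℝ) + lam := by positivity
    have hs : T.star (0 :: u) = T u := rfl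
    have h1 : (lam / ((T u : ℝ≥0∞) + lam)) = ENNReal.ofReal (lam / ((T u : ℝ) + lam)) := by
      rw [ENNReal.ofReal_div_of_pos hd, ENNReal.ofReal_add (by positivity) (by positivity)]
      simp
    have h2 : (1 / ((T u : ℝ≥0∞) + lam)) = ENNReal.ofReal (1 / ((T u : ℝ) + lam)) := by
      rw [ENNReal.ofReal_div_of_pos hd, ENNReal.ofReal_add (by positivity) (by positivity)]
      simp
    rw [stepOn_apply, lintegral_step_of_ne lam _ (by simp), hs, h1, h2,
      ← ENNReal.ofReal_mul (by positivity)]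
    simp only [← ENNReal.ofReal_mul (show (0 : ℝ) ≤ 1 / ((T u : ℝ) + lam) by positivity)]
    rw [← ENNReal.ofReal_sum_of_nonneg fun i _ => mul_nonneg (by positivity) (hR0 _),
      ← ENNReal.ofReal_add (mul_nonneg (by positivity) (hR0 _))
        (Finset.sum_nonneg fun i _ => mul_nonneg (by positivity) (hR0 _))]
    refine ENNReal.ofReal_le_ofReal ?_
    have hc : ∀ i, R (0 :: u ++ [i]) = r u * (1 - b (subAt (u ++ [i]))) := fun i => hrc u i
    have hbu := hb (subAt u)
    have hroot : subAt u [] = T u := by simp [subAt]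
    have hsub : ∀ i, sub (subAt u) i = subAt (u ++ [i]) := fun i => by
      funext v; simp [sub, subAt]
    rw [hroot] at hbu
    simp only [hsub] at hbu
    set c := ∑ i ∈ Finset.range (T u), b (subAt (u ++ [i])) with hcdef
    have hρ := hpar u
    have hρ0 := hR0 (0 :: u).dropLast
    set ρ := R (0 :: u).dropLast
    have hsum : ∑ i ∈ Finset.range (T u), 1 / ((T u : ℝ) + lam) * R (0 :: u ++ [i]) =
        1 / ((T u : ℝ) + lam) * (r u * (T u - c)) := by
      rw [← Finset.mul_sum]
      simp only [hc, ← Finset.mul_sum, Finset.sum_sub_distrib]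
      simp [hcdef]
    have hRu : R (0 :: u) = r u := rfl
    rw [hsum, hRu, div_mul_eq_mul_div, div_mul_eq_mul_div, ← add_div, div_le_iff₀ hd]
    -- As `r u = ρ (1 - b)`, the claim `lam ρ + r (ν - c) ≤ r (ν + lam)`, with `ν` the number of
    -- children of `u`, reduces to `lam ρ b ≤ ρ (1 - b) c`.
    have := mul_le_mul_of_nonneg_left hbu hρ0
    rw [← hρ]
    nlinarith
  have hmeas : ∀ N : ℕ, MeasurableSet {X : ℕ → Vertex | ∃ n < N + 1, X n = []} := by
    intro N
    have : {X : ℕ → Vertex | ∃ n < N + 1, X n = []} =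
        ⋃ n, ⋃ (_ : n < N + 1), (fun X : ℕ → Vertex => X n) ⁻¹' {[]} := by ext; simp
    rw [this]
    exact MeasurableSet.iUnion fun n => MeasurableSet.iUnion fun _ =>
      measurable_pi_apply n (measurableSet_singleton _)
  -- Optional stopping at `e_*`, by induction on the time horizon.
  have hit : ∀ N : ℕ, ∀ v, (v = [] ∨ [0] <+: v) →
      chain (stepOn lam T.star) v {X | ∃ n < N + 1, X n = []} ≤ ENNReal.ofReal (R v) := by
    intro N
    induction N with
    | zero =>
      rintro _ (rfl | ⟨u, rfl⟩)
      · simpa [R] using prob_le_one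
      · have h2 := chain_zero_mem (stepOn lam T.star) ([0] ++ u)
          (measurableSet_singleton ([0] ++ u)) rfl
        rw [ae_iff] at h2
        refine (measure_mono_null ?_ h2).trans_le zero_le
        rintro X ⟨n, hn, hX⟩ h0
        obtain rfl : n = 0 := by omega
        rw [hX] at h0
        simp at h0
    | succ N ih =>
      rintro _ (rfl | ⟨u, rfl⟩)
      · simpa [R] using prob_le_one
      · rw [chain_apply_eq_lintegral _ _ (hmeas (N + 1))]
        refine le_trans ?_ (hsuper u)
        refine lintegral_mono_ae ?_
        filter_upwards [ae_stepMeasure_exit lam (T.star (0 :: u)) (w := [0]) (x := 0 :: u)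
          ⟨u, rfl⟩] with y hy
        refine le_trans (measure_mono ?_) (ih y hy.symm)
        rintro X ⟨_ | n, hn, hX⟩
        · simp at hX
        · exact ⟨n, by omega, hX⟩
  have hmon : Monotone fun N : ℕ => {X : ℕ → Vertex | ∃ n < N + 1, X n = []} := by
    rintro b c hbc ω ⟨n, hn, h⟩
    exact ⟨n, by omega, h⟩
  have t := tendsto_measure_iUnion_atTop (μ := chain (stepOn lam T.star) [0]) hmon
  have hle := le_of_tendsto' t fun N => hit N [0] (Or.inr (List.prefix_refl _))
  have hR1 : R [0] = 1 - b T := by simp [R, r, subAt]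
  have he : escape lam T = 1 - (chain (stepOn lam T.star) [0]).real
      (⋃ N : ℕ, {X : ℕ → Vertex | ∃ n < N + 1, X n = []}) := by
    rw [escape, walk_eq_chain, ← probReal_compl_eq_one_sub (MeasurableSet.iUnion hmeas)]
    congr 1
    ext X
    simp only [Set.mem_ofPred_eq, Set.mem_compl_iff, Set.mem_iUnion, not_exists, not_and]
    exact ⟨fun h N n _ => h n, fun h n => h n n (Nat.lt_succ_self n)⟩
  have := ENNReal.toReal_le_of_le_ofReal (hR0 [0]) hle
  rw [hR1] at this
  rw [he, Measure.real]
  linarith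

/-! ### The limiting ray of a transient path -/

/-- The path eventually stays in the subtree of a vertex at level `n`. -/
def ConvergesAt (X : ℕ → Vertex) (n : ℕ) : Prop :=
  ∃ v : Vertex, v.length = n ∧ ∀ᶠ k in Filter.atTop, (X k).take n = v

open Classical in
/-- The ray to which the path converges. -/
def rayOf (X : ℕ → Vertex) (n : ℕ) : Vertex :=
  if h : ConvergesAt X n then h.choose else []

lemma rayOf_eq {X : ℕ → Vertex} {n : ℕ} {v : Vertex} (hv : v.length = n)
    (h : ∀ᶠ k in Filter.atTop, (X k).take n = v) : rayOf X n = v := by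
  have hc : ConvergesAt X n := ⟨v, hv, h⟩
  unfold rayOf
  rw [dif_pos hc]
  obtain ⟨k, hk⟩ := (hc.choose_spec.2.and h).exists
  rw [← hk.1, hk.2]

lemma rayOf_spec {X : ℕ → Vertex} {n : ℕ} (h : ConvergesAt X n) :
    (rayOf X n).length = n ∧ ∀ᶠ k in Filter.atTop, (X k).take n = rayOf X n := by
  obtain ⟨v, hv, h⟩ := h
  rw [rayOf_eq hv h]
  exact ⟨hv, h⟩

lemma measurableSet_eventually_take (n : ℕ) (v : Vertex) :
    MeasurableSet {X : ℕ → Vertex | ∀ᶠ k in Filter.atTop, (X k).take n = v} := by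
  have : {X : ℕ → Vertex | ∀ᶠ k in Filter.atTop, (X k).take n = v} =
      ⋃ a : ℕ, ⋂ k : ℕ, ⋂ (_ : k ≥ a), (fun X : ℕ → Vertex => X k) ⁻¹' {u | u.take n = v} := by
    ext X; simp [Filter.eventually_atTop]
  rw [this]
  exact MeasurableSet.iUnion fun a => MeasurableSet.iInter fun k => MeasurableSet.iInter fun _ =>
    measurable_pi_apply k (Set.to_countable _).measurableSet

lemma measurableSet_convergesAt (n : ℕ) : MeasurableSet {X | ConvergesAt X n} := by
  have : {X | ConvergesAt X n} = ⋃ v : Vertex, ⋃ (_ : v.length = n),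
      {X : ℕ → Vertex | ∀ᶠ k in Filter.atTop, (X k).take n = v} := by
    ext X; simp [ConvergesAt]
  rw [this]
  exact MeasurableSet.iUnion fun v => MeasurableSet.iUnion fun _ =>
    measurableSet_eventually_take n v

lemma measurable_rayOf : Measurable rayOf := by
  refine measurable_pi_iff.2 fun n => measurable_to_countable' fun v => ?_
  have : (fun X => rayOf X n) ⁻¹' {v} =
      ({X | ConvergesAt X n} ∩ {X | ∀ᶠ k in Filter.atTop, (X k).take n = v}) ∪
        ({X | ConvergesAt X n}ᶜ ∩ {_X | v = []}) := by
    ext X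
    simp only [Set.mem_preimage, Set.mem_singleton_iff, Set.mem_union, Set.mem_inter_iff,
      Set.mem_ofPred_eq, Set.mem_compl_iff]
    by_cases h : ConvergesAt X n
    · simp only [h, true_and, not_true, false_and, or_false]
      constructor
      · rintro rfl
        exact (rayOf_spec h).2
      · intro h'
        obtain ⟨k, hk⟩ := ((rayOf_spec h).2.and h').exists
        rw [← hk.1, hk.2]
    · simp only [h, false_and, not_false_eq_true, true_and, false_or]
      rw [rayOf, dif_neg h]
      exact eq_comm
  rw [this]
  exact ((measurableSet_convergesAt n).inter (measurableSet_eventually_take n v)).union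
    ((measurableSet_convergesAt n).compl.inter (MeasurableSet.const _))

lemma eventually_consSeq {p : Vertex → Prop} (x : Vertex) (X : ℕ → Vertex) :
    (∀ᶠ k in Filter.atTop, p (consSeq x X k)) ↔ ∀ᶠ k in Filter.atTop, p (X k) := by
  conv_lhs => rw [← Filter.map_add_atTop_eq_nat 1, Filter.eventually_map]
  rfl

lemma convergesAt_consSeq (x : Vertex) (X : ℕ → Vertex) (n : ℕ) :
    ConvergesAt (consSeq x X) n ↔ ConvergesAt X n := by
  refine exists_congr fun v => and_congr_right fun _ => ?_
  exact eventually_consSeq (p := fun u => u.take n = v) x X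

/-- A limit ignores the beginning of the path. Events defined through `rayOf` are therefore
shift-invariant, which cannot be read off from the loop-erasure. -/
lemma rayOf_consSeq (x : Vertex) (X : ℕ → Vertex) : rayOf (consSeq x X) = rayOf X := by
  funext n
  by_cases h : ConvergesAt X n
  · obtain ⟨h1, h2⟩ := rayOf_spec h
    exact rayOf_eq h1 ((eventually_consSeq (p := fun u => u.take n = _) x X).2 h2)
  · have h' := h
    rw [← convergesAt_consSeq x] at h'
    rw [rayOf, rayOf, dif_neg h, dif_neg h']

/-- The ray of a tree which goes through the child `i` of the root and then follows the ray
`ξ` of the subtree at this child. -/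
def consRay (i : ℕ) (ξ : ℕ → Vertex) : ℕ → Vertex
  | 0 => []
  | n + 1 => i :: ξ n

lemma measurable_consRay (i : ℕ) : Measurable (consRay i) := by
  refine measurable_pi_iff.2 fun n => ?_
  cases n with
  | zero => exact measurable_const
  | succ n =>
    exact (measurable_of_countable (fun u : Vertex => (i :: u : Vertex))).comp
      (measurable_pi_apply n)

lemma convergesAt_zero (X : ℕ → Vertex) : ConvergesAt X 0 := ⟨[], rfl, by simp⟩

lemma rayOf_zero (X : ℕ → Vertex) : rayOf X 0 = [] := rayOf_eq rfl (by simp)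

lemma ConvergesAt.cons {X : ℕ → Vertex} {n : ℕ} (h : ConvergesAt X n) (i : ℕ) :
    ConvergesAt (fun k => i :: X k) (n + 1) ∧
      rayOf (fun k => i :: X k) (n + 1) = i :: rayOf X n := by
  obtain ⟨h1, h2⟩ := rayOf_spec h
  have h3 : ∀ᶠ k in Filter.atTop, (i :: X k).take (n + 1) = i :: rayOf X n := by
    filter_upwards [h2] with k hk
    rw [List.take_succ_cons, hk]
  exact ⟨⟨_, by simp [h1], h3⟩, rayOf_eq (by simp [h1]) h3⟩

/-- Convergence at every level is required because the default value `[]` of `rayOf` is not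
compatible with putting `i` in front. -/
lemma rayOf_cons {X : ℕ → Vertex} (h : ∀ n, ConvergesAt X n) (i : ℕ) :
    rayOf (fun k => i :: X k) = consRay i (rayOf X) := by
  funext n
  cases n with
  | zero => exact rayOf_zero _
  | succ n => exact ((h n).cons i).2

lemma effConductance_pos (lam : ℝ≥0) (hlam : lam ≠ 0) {T : PTree} (h : escape lam T ≠ 0) :
    0 < effConductance lam T := by
  refine lt_of_le_of_ne (effConductance_nonneg lam T) fun h0 => h ?_
  rw [escape_eq lam hlam, ← h0, zero_div]

/-- The walk on a transient tree converges to a ray. -/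
lemma ae_convergesAt (lam : ℝ≥0) (hlam : lam ≠ 0) (n : ℕ) :
    ∀ T : PTree, 0 < effConductance lam T →
      (chain (stepOn lam T) []).real {X | ¬ ConvergesAt X n} = 0 := by
  induction n with
  | zero =>
    intro T _
    simp [convergesAt_zero]
  | succ n ih =>
    intro T hT
    -- Failure at level `n + 1` is an invariant event, and inside the subtree at `i` it implies
    -- failure at level `n`. Recurrent subtrees enter with weight zero.
    have h := effConductance_mul_chain_eq lam hlam T (measurableSet_convergesAt (n + 1)).compl
      (fun x ω => not_congr (convergesAt_consSeq x ω (n + 1)))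
    rw [Finset.sum_eq_zero] at h
    · exact (mul_eq_zero.1 h).resolve_left hT.ne'
    · intro i _
      by_cases hi : escape lam (sub T i) = 0
      · rw [hi, zero_mul]
      · refine mul_eq_zero_of_right _ ?_
        refine le_antisymm ?_ measureReal_nonneg
        rw [← ih (sub T i) (effConductance_pos lam hlam hi)]
        exact measureReal_mono (fun Y hY h => hY (h.cons i).1)

lemma ae_forall_convergesAt (lam : ℝ≥0) (hlam : lam ≠ 0) {T : PTree}
    (hT : 0 < effConductance lam T) :
    ∀ᵐ X ∂chain (stepOn lam T) [], ∀ n, ConvergesAt X n := by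
  rw [ae_all_iff]
  intro n
  rw [ae_iff]
  exact (measureReal_eq_zero_iff).1 (ae_convergesAt lam hlam n T hT)

/-! ### Loop-erasure -/

lemma prefix_of_step {w x y : Vertex} (hxy : (∃ i, y = x ++ [i]) ∨ y = x.dropLast)
    (h : w <+: x) : w <+: y ∨ y = w.dropLast := by
  rcases hxy with ⟨i, rfl⟩ | rfl
  · exact Or.inl (h.trans (List.prefix_append _ _))
  · by_cases hx : x = w
    · exact Or.inr (by rw [hx])
    · exact Or.inl (isPrefix_dropLast h hx)

lemma eq_of_step {w x y : Vertex} (hxy : (∃ i, y = x ++ [i]) ∨ y = x.dropLast)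
    (h : ¬ w <+: x) (h' : w <+: y) : y = w := by
  rcases hxy with ⟨i, rfl⟩ | rfl
  · rw [List.prefix_concat_iff] at h'
    rcases h' with h' | h'
    · exact h'.symm
    · exact absurd h' h
  · exact absurd (h'.trans (List.dropLast_prefix x)) h

lemma prefix_iff_take {w x : Vertex} : w <+: x ↔ x.take w.length = w := by
  rw [List.prefix_iff_eq_take]
  exact eq_comm

/-- The loop-erasure of a path which converges to a ray is this ray. -/
lemma loopErasure_eq_rayOf {T : PTree} {X : ℕ → Vertex} (h0 : X 0 = [])
    (hstep : ∀ n, (∃ i < (T (X n) : ℕ), X (n + 1) = X n ++ [i]) ∨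
      (X n ≠ [] ∧ X (n + 1) = (X n).dropLast))
    (hc : ∀ n, ConvergesAt X n) : loopErasure X = rayOf X ∧ T.IsRay (rayOf X) := by
  have hst : ∀ n, (∃ i, X (n + 1) = X n ++ [i]) ∨ X (n + 1) = (X n).dropLast := fun n =>
    (hstep n).imp (fun ⟨i, _, h⟩ => ⟨i, h⟩) fun h => h.2
  have hlen : ∀ n, (rayOf X n).length = n := fun n => (rayOf_spec (hc n)).1
  have hev : ∀ n, ∀ᶠ k in Filter.atTop, rayOf X n <+: X k := by
    intro n
    filter_upwards [(rayOf_spec (hc n)).2] with k hk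
    rw [prefix_iff_take, hlen, hk]
  have key : ∀ n, X (lastVisit X (rayOf X n)) = rayOf X n ∧
      X (lastVisit X (rayOf X n) + 1) = rayOf X (n + 1) ∧
      T.IsChild (rayOf X n) (rayOf X (n + 1)) := by
    intro n
    set v := rayOf X n with hv
    -- At the first time from which the path stays below `v`, it is at `v`: this time is either `0`,
    -- or the path has just entered the subtree, which is possible only at `v`.
    have hne : {k | X k = v}.Nonempty := by
      classical
      have hex : ∃ a, ∀ k ≥ a, v <+: X k := Filter.eventually_atTop.1 (hev n)
      have hspec := Nat.find_spec hex
      have hmin := fun m (hm : m < Nat.find hex) => Nat.find_min hex hm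
      rcases h : Nat.find hex with _ | a
      · rw [h] at hspec
        refine ⟨0, ?_⟩
        have := hspec 0 le_rfl
        rw [h0] at this
        change X 0 = v
        rw [h0, List.prefix_nil.1 this]
      · rw [h] at hspec hmin
        refine ⟨a + 1, eq_of_step (hst a) (fun hp => hmin a (Nat.lt_succ_self a) ?_)
          (hspec (a + 1) le_rfl)⟩
        intro k hk
        rcases hk.eq_or_lt with rfl | hk
        · exact hp
        · exact hspec k hk
    have hbdd : BddAbove {k | X k = v} := by
      obtain ⟨a, ha⟩ := Filter.eventually_atTop.1 (hev (n + 1))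
      refine ⟨a, fun k hk => ?_⟩
      by_contra hlt
      have := (ha k (not_le.1 hlt).le).length_le
      rw [hlen, show X k = v from hk, hv, hlen] at this
      omega
    have hL : X (lastVisit X v) = v := Nat.sSup_mem hne hbdd
    have hafter : ∀ k, lastVisit X v < k → X k ≠ v := fun k hk h =>
      absurd (le_csSup hbdd h) (not_le.2 hk)
    set L := lastVisit X v
    refine ⟨hL, ?_⟩
    -- After the last visit to `v`, a step to the parent would leave the subtree forever, because
    -- any return passes through `v`.
    have hchild : ∃ i < (T v : ℕ), X (L + 1) = v ++ [i] := by
      rcases hstep L with h | ⟨hne', h⟩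
      · rwa [hL] at h
      · exfalso
        rw [hL] at hne' h
        have hout : ∀ k, ¬ v <+: X (L + 1 + k) := by
          intro k
          induction k with
          | zero => rw [add_zero, h]; exact not_isPrefix_dropLast hne'
          | succ k ih => exact fun h' => hafter _ (by omega) (eq_of_step (hst _) ih h')
        obtain ⟨a, ha⟩ := Filter.eventually_atTop.1 (hev n)
        exact hout a (ha _ (by omega))
    obtain ⟨i, hi, hLi⟩ := hchild
    have hin : ∀ k, v ++ [i] <+: X (L + 1 + k) := by
      intro k
      induction k with
      | zero => rw [add_zero, hLi]
      | succ k ih =>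
        refine (prefix_of_step (hst (L + 1 + k)) ih).resolve_right ?_
        rw [List.dropLast_concat]
        exact hafter _ (by omega)
    have hξ : rayOf X (n + 1) = v ++ [i] := by
      refine rayOf_eq (by simp [hv, hlen]) (Filter.eventually_atTop.2 ⟨L + 1, fun k hk => ?_⟩)
      have := hin (k - (L + 1))
      rw [show L + 1 + (k - (L + 1)) = k by omega, prefix_iff_take] at this
      rwa [List.length_append, List.length_singleton, hv, hlen, ← hv] at this
    exact ⟨by rw [hLi, hξ], i, hi, hξ⟩
  refine ⟨?_, rayOf_zero X, fun n => (key n).2.2⟩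
  funext n
  induction n with
  | zero => rw [rayOf_zero]; exact h0
  | succ n ih =>
    rw [loopErasure, ih]
    exact (key n).2.1

lemma measurableSet_lastVisit (v : Vertex) (m : ℕ) :
    MeasurableSet {X | lastVisit X v = m} := by
  -- `sSup` has the value `0` both without visits and with unboundedly many, so the explicit
  -- description holds only for `m ≠ 0`; the value `0` is then obtained by complement.
  have hpos : ∀ m, m ≠ 0 → MeasurableSet {X | lastVisit X v = m} := by
    intro m hm
    have : {X | lastVisit X v = m} = ((fun X : ℕ → Vertex => X m) ⁻¹' {v}) ∩
        ⋂ k, ⋂ (_ : m < k), (fun X : ℕ → Vertex => X k) ⁻¹' {v}ᶜ := by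
      ext X
      simp only [Set.mem_ofPred_eq, Set.mem_inter_iff, Set.mem_preimage, Set.mem_singleton_iff,
        Set.mem_iInter, Set.mem_compl_iff]
      constructor
      · intro h
        have hne : {k | X k = v}.Nonempty := by
          by_contra hne
          rw [Set.not_nonempty_iff_eq_empty] at hne
          simp only [lastVisit, hne, csSup_empty] at h
          exact hm h.symm
        have hbdd : BddAbove {k | X k = v} := by
          by_contra hb
          rw [lastVisit, csSup_of_not_bddAbove hb, csSup_empty] at h
          exact hm h.symm
        refine ⟨?_, fun k hk hX => ?_⟩
        · have := Nat.sSup_mem hne hbdd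
          rw [← h]
          exact this
        · have := le_csSup hbdd hX
          unfold lastVisit at h
          omega
      · rintro ⟨h1, h2⟩
        exact IsGreatest.csSup_eq ⟨h1, fun k hk => not_lt.1 fun hlt => h2 k hlt hk⟩
    rw [this]
    exact (measurable_pi_apply m (measurableSet_singleton v)).inter
      (MeasurableSet.iInter fun k => MeasurableSet.iInter fun _ =>
        measurable_pi_apply k (measurableSet_singleton v).compl)
  rcases eq_or_ne m 0 with rfl | hm
  · have : {X | lastVisit X v = 0} = ⋂ m, ⋂ (_ : m ≠ 0), {X | lastVisit X v = m}ᶜ := by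
      ext X
      simp only [Set.mem_ofPred_eq, Set.mem_iInter, Set.mem_compl_iff]
      exact ⟨fun h m hm h' => hm (h'.symm.trans h), fun h => by_contra fun h' => h _ h' rfl⟩
    rw [this]
    exact MeasurableSet.iInter fun m => MeasurableSet.iInter fun hm => (hpos m hm).compl
  · exact hpos m hm

lemma measurable_loopErasure : Measurable loopErasure := by
  refine measurable_pi_iff.2 fun n => ?_
  induction n with
  | zero => exact measurable_pi_apply 0
  | succ n ih =>
    refine measurable_to_countable' fun w => ?_
    have : (fun X => loopErasure X (n + 1)) ⁻¹' {w} = ⋃ v : Vertex, ⋃ m : ℕ,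
        ((fun X => loopErasure X n) ⁻¹' {v}) ∩ {X | lastVisit X v = m} ∩
          ((fun X : ℕ → Vertex => X (m + 1)) ⁻¹' {w}) := by
      ext X
      simp [loopErasure]
    rw [this]
    exact MeasurableSet.iUnion fun v => MeasurableSet.iUnion fun m =>
      ((ih (measurableSet_singleton v)).inter (measurableSet_lastVisit v m)).inter
        (measurable_pi_apply (m + 1) (measurableSet_singleton w))

/-! ### The flow rule for the harmonic measure -/

instance (lam : ℝ≥0) : IsMarkovKernel (walk lam) := by
  unfold walk
  exact Kernel.IsMarkovKernel.map _ (by fun_prop)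

instance (lam : ℝ≥0) : IsMarkovKernel (harmonicMeasure lam) := by
  unfold harmonicMeasure
  exact Kernel.IsMarkovKernel.map _ measurable_loopErasure

lemma harmonicMeasure_apply (lam : ℝ≥0) (T : PTree) :
    harmonicMeasure lam T = (chain (stepOn lam T) []).map loopErasure := by
  unfold harmonicMeasure
  rw [Kernel.map_apply _ measurable_loopErasure, Kernel.comap_apply, walk_eq_chain]

lemma ae_loopErasure (lam : ℝ≥0) (hlam : lam ≠ 0) {T : PTree} (hT : 0 < effConductance lam T) :
    ∀ᵐ X ∂chain (stepOn lam T) [], loopErasure X = rayOf X ∧ T.IsRay (rayOf X) := by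
  have h1 := ae_chain_step (stepOn lam T)
    (R := fun x y => (∃ i < (T x : ℕ), y = x ++ [i]) ∨ (x ≠ [] ∧ y = x.dropLast))
    ((Set.to_countable _).measurableSet) (fun x => ae_stepMeasure lam (T x) x) []
  have h2 := chain_zero_mem (stepOn lam T) [] (measurableSet_singleton []) rfl
  filter_upwards [h1, h2, ae_forall_convergesAt lam hlam hT] with X hX h0 hc
  exact loopErasure_eq_rayOf h0 hX hc

lemma measurableSet_isRay (T : PTree) : MeasurableSet {ξ | T.IsRay ξ} := by
  have : {ξ | T.IsRay ξ} = ((fun ξ : ℕ → Vertex => ξ 0) ⁻¹' {[]}) ∩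
      ⋂ n, (fun ξ : ℕ → Vertex => (ξ n, ξ (n + 1))) ⁻¹' {q | T.IsChild q.1 q.2} := by
    ext ξ; simp [PTree.IsRay]
  rw [this]
  exact (measurable_pi_apply 0 (measurableSet_singleton _)).inter (MeasurableSet.iInter fun n =>
    ((measurable_pi_apply n).prodMk (measurable_pi_apply (n + 1)))
      (Set.to_countable _).measurableSet)

lemma ae_isRay (lam : ℝ≥0) (hlam : lam ≠ 0) {T : PTree} (hT : 0 < effConductance lam T) :
    ∀ᵐ ξ ∂harmonicMeasure lam T, T.IsRay ξ := by
  rw [harmonicMeasure_apply, ae_map_iff measurable_loopErasure.aemeasurable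
    (measurableSet_isRay T)]
  filter_upwards [ae_loopErasure lam hlam hT] with X hX
  rw [hX.1]
  exact hX.2

lemma harmonicMeasure_eq_map_rayOf (lam : ℝ≥0) (hlam : lam ≠ 0) {T : PTree}
    (hT : 0 < effConductance lam T) :
    harmonicMeasure lam T = (chain (stepOn lam T) []).map rayOf := by
  rw [harmonicMeasure_apply]
  refine Measure.map_congr ?_
  filter_upwards [ae_loopErasure lam hlam hT] with X hX
  exact hX.1

/-- The harmonic ray goes through the child `i` of the root with probability proportional to the
escape probability of the subtree at `i`, and then it is a harmonic ray of this subtree. -/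
lemma harmonicMeasure_flow (lam : ℝ≥0) (hlam : lam ≠ 0) (T : PTree) {B : Set (ℕ → Vertex)}
    (hB : MeasurableSet B) :
    effConductance lam T * (harmonicMeasure lam T).real B =
      ∑ i ∈ Finset.range (T []), escape lam (sub T i) *
        (harmonicMeasure lam (sub T i)).real (consRay i ⁻¹' B) := by
  -- On a recurrent tree both sides are zero, so the rule holds for every tree.
  rcases (effConductance_nonneg lam T).eq_or_lt with h0 | hT
  · rw [← h0, zero_mul]
    rw [effConductance_eq_sum lam hlam] at h0
    symm
    refine Finset.sum_eq_zero fun i hi => ?_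
    rw [(Finset.sum_eq_zero_iff_of_nonneg fun i _ => escape_nonneg lam (sub T i)).1 h0.symm i hi,
      zero_mul]
  · rw [harmonicMeasure_eq_map_rayOf lam hlam hT, map_measureReal_apply measurable_rayOf hB,
      effConductance_mul_chain_eq lam hlam T (measurable_rayOf hB)
        (fun x ω => by simp [rayOf_consSeq])]
    refine Finset.sum_congr rfl fun i _ => ?_
    by_cases hi : escape lam (sub T i) = 0
    · rw [hi, zero_mul, zero_mul]
    · have hi' := effConductance_pos lam hlam hi
      rw [harmonicMeasure_eq_map_rayOf lam hlam hi',
        map_measureReal_apply measurable_rayOf (measurable_consRay i hB)]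
      congr 1
      refine measureReal_congr ?_
      filter_upwards [ae_forall_convergesAt lam hlam hi'] with X hX
      refine propext ?_
      change rayOf (fun n => i :: X n) ∈ B ↔ consRay i (rayOf X) ∈ B
      rw [rayOf_cons hX]

lemma lintegral_harmonicMeasure_flow (lam : ℝ≥0) (hlam : lam ≠ 0) (T : PTree)
    {H : (ℕ → Vertex) → ℝ≥0∞} (hH : Measurable H) :
    ENNReal.ofReal (effConductance lam T) * ∫⁻ ξ, H ξ ∂harmonicMeasure lam T =
      ∑ i ∈ Finset.range (T []), ENNReal.ofReal (escape lam (sub T i)) *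
        ∫⁻ ξ, H (consRay i ξ) ∂harmonicMeasure lam (sub T i) := by
  have hm : ENNReal.ofReal (effConductance lam T) • harmonicMeasure lam T =
      ∑ i ∈ Finset.range (T []), ENNReal.ofReal (escape lam (sub T i)) •
        (harmonicMeasure lam (sub T i)).map (consRay i) := by
    ext B hB
    simp only [Measure.smul_apply, Measure.finsetSum_apply, smul_eq_mul,
      Measure.map_apply (measurable_consRay _) hB]
    have h := congrArg ENNReal.ofReal (harmonicMeasure_flow lam hlam T hB)
    rw [ENNReal.ofReal_mul (effConductance_nonneg lam T), ENNReal.ofReal_sum_of_nonneg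
      fun i _ => mul_nonneg (escape_nonneg lam _) measureReal_nonneg] at h
    simp only [ENNReal.ofReal_mul (escape_nonneg lam _)] at h
    simpa only [ofReal_measureReal (measure_ne_top _ _)] using h
  have := congrArg (fun m => ∫⁻ ξ, H ξ ∂m) hm
  simp only [lintegral_smul_measure, lintegral_finsetSum_measure, smul_eq_mul] at this
  rw [this]
  refine Finset.sum_congr rfl fun i _ => ?_
  rw [lintegral_map hH (measurable_consRay i)]

/-! ### Exchanging subtrees of independent Galton-Watson trees -/

/-- The tree `S` with the subtree at the child `i` of the root replaced by `T`. -/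
def graft (S : PTree) (i : ℕ) (T : PTree) : PTree
  | [] => S []
  | j :: u => if j = i then T u else S (j :: u)

@[simp] lemma graft_nil (S : PTree) (i : ℕ) (T : PTree) : graft S i T [] = S [] := rfl

lemma sub_graft_self (S : PTree) (i : ℕ) (T : PTree) : sub (graft S i T) i = T := by
  funext u; simp [sub, graft]

lemma sub_graft_of_ne (S : PTree) {i j : ℕ} (h : j ≠ i) (T : PTree) :
    sub (graft S i T) j = sub S j := by
  funext u; simp [sub, graft, h]

lemma graft_graft_sub (S : PTree) (i : ℕ) (T : PTree) :
    graft (graft S i T) i (sub S i) = S := by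
  funext u
  cases u with
  | nil => rfl
  | cons j u => by_cases h : j = i <;> simp [graft, sub, h]

/-- Exchange the first tree with the subtree at the child `i` of the root of the second tree; the
second tree, modified in this way, comes first. -/
def exchange (i : ℕ) (x : PTree × PTree) : PTree × PTree := (graft x.2 i x.1, sub x.2 i)

lemma measurable_sub (i : ℕ) : Measurable fun T : PTree => sub T i :=
  measurable_pi_iff.2 fun u => measurable_pi_apply (i :: u)

lemma measurable_graft (i : ℕ) : Measurable fun x : PTree × PTree => graft x.2 i x.1 := by
  refine measurable_pi_iff.2 fun u => ?_
  cases u with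
  | nil => exact (measurable_pi_apply _).comp measurable_snd
  | cons j u =>
    by_cases h : j = i
    · simp only [graft, h, if_true]
      exact (measurable_pi_apply _).comp measurable_fst
    · simp only [graft, h, if_false]
      exact (measurable_pi_apply _).comp measurable_snd

lemma measurable_exchange (i : ℕ) : Measurable (exchange i) :=
  (measurable_graft i).prodMk ((measurable_sub i).comp measurable_snd)

/-- Reading an i.i.d. family at distinct indices gives an i.i.d. family. -/
lemma infinitePi_map_comp_injective {α β X : Type*} [MeasurableSpace X] (μ : Measure X)
    [IsProbabilityMeasure μ] {σ : α → β} (hσ : Function.Injective σ) :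
    (Measure.infinitePi fun _ : β => μ).map (fun f a => f (σ a)) =
      Measure.infinitePi fun _ : α => μ := by
  classical
  have hm : Measurable fun (f : β → X) a => f (σ a) :=
    measurable_pi_iff.2 fun a => measurable_pi_apply _
  refine Measure.eq_infinitePi _ fun s t ht => ?_
  rw [Measure.map_apply hm (MeasurableSet.pi (Finset.countable_toSet s) fun i _ => ht i)]
  rcases isEmpty_or_nonempty α with h | h
  · have : s = ∅ := Finset.eq_empty_of_isEmpty s
    subst this
    simp
  · have e : (fun (f : β → X) a => f (σ a)) ⁻¹' (s : Set α).pi t =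
        ((s.image σ : Finset β) : Set β).pi fun b => t (Function.invFun σ b) := by
      ext f
      simp [Set.mem_pi, Function.leftInverse_invFun hσ _]
    rw [e, Measure.infinitePi_pi _ fun i _ => ht _, Finset.prod_image (hσ.injOn)]
    simp [Function.leftInverse_invFun hσ _]

lemma prod_infinitePi_map_elim {α β X : Type*} [MeasurableSpace X] (μ : Measure X)
    [IsProbabilityMeasure μ] :
    ((Measure.infinitePi fun _ : α => μ).prod (Measure.infinitePi fun _ : β => μ)).map
      (fun x => Sum.elim x.1 x.2) = Measure.infinitePi fun _ : α ⊕ β => μ := by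
  have hm : Measurable fun x : (α → X) × (β → X) => Sum.elim x.1 x.2 := by
    refine measurable_pi_iff.2 fun a => ?_
    cases a with
    | inl a => exact (measurable_pi_apply a).comp measurable_fst
    | inr a => exact (measurable_pi_apply a).comp measurable_snd
  refine Measure.eq_infinitePi _ fun s t ht => ?_
  rw [Measure.map_apply hm (MeasurableSet.pi (Finset.countable_toSet s) fun i _ => ht i)]
  have e : (fun x : (α → X) × (β → X) => Sum.elim x.1 x.2) ⁻¹' (s : Set (α ⊕ β)).pi t =
      ((s.toLeft : Set α).pi fun a => t (Sum.inl a)) ×ˢ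
        ((s.toRight : Set β).pi fun a => t (Sum.inr a)) := by
    ext x
    simp [Set.mem_pi]
  rw [e, Measure.prod_prod, Measure.infinitePi_pi _ fun i _ => ht _,
    Measure.infinitePi_pi _ fun i _ => ht _]
  conv_rhs => rw [← Finset.toLeft_disjSum_toRight (u := s)]
  rw [Finset.prod_disjSum]

/-- Seen as one family of labels, the pair is i.i.d. and `exchange i` only moves labels around.
Labels exist at all words, so `i` need not be an actual child of the root. -/
lemma measurePreserving_exchange (p : PMF ℕ+) (i : ℕ) :
    MeasurePreserving (exchange i) ((GW p).prod (GW p)) ((GW p).prod (GW p)) := by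
  refine ⟨measurable_exchange i, ?_⟩
  let elim : PTree × PTree → (Vertex ⊕ Vertex → ℕ+) := fun x => Sum.elim x.1 x.2
  have helim : Measurable elim := by
    refine measurable_pi_iff.2 fun a => ?_
    cases a with
    | inl a => exact (measurable_pi_apply a).comp measurable_fst
    | inr a => exact (measurable_pi_apply a).comp measurable_snd
  let split : (Vertex ⊕ Vertex → ℕ+) → PTree × PTree := fun f =>
    (fun u => f (Sum.inl u), fun u => f (Sum.inr u))
  have hsplit : Measurable split :=
    (measurable_pi_iff.2 fun u => measurable_pi_apply _).prodMk
      (measurable_pi_iff.2 fun u => measurable_pi_apply _)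
  -- `σ a` is the place in the original pair from which the label at `a` in the exchanged pair is
  -- read; `inl` refers to the first tree, `inr` to the second.
  let σ : Vertex ⊕ Vertex → Vertex ⊕ Vertex := fun a => match a with
    | Sum.inl [] => Sum.inr []
    | Sum.inl (j :: u) => if j = i then Sum.inl u else Sum.inr (j :: u)
    | Sum.inr u => Sum.inr (i :: u)
  have hσ : Function.Injective σ := by
    rintro (_ | ⟨j, u⟩ | u) (_ | ⟨k, v⟩ | v) h <;> simp only [σ] at h <;> grind
  have hcomm : ∀ x, elim (exchange i x) = fun a => elim x (σ a) := by
    intro x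
    funext a
    match a with
    | Sum.inl [] => rfl
    | Sum.inl (j :: u) =>
      by_cases h : j = i
      · simp [elim, exchange, graft, σ, h]
      · simp [elim, exchange, graft, σ, h]
    | Sum.inr u => rfl
  have h0 : ((GW p).prod (GW p)).map elim = Measure.infinitePi fun _ => p.toMeasure :=
    prod_infinitePi_map_elim p.toMeasure
  have h1 : (((GW p).prod (GW p)).map (exchange i)).map elim = ((GW p).prod (GW p)).map elim := by
    have hc : elim ∘ exchange i = (fun f a => f (σ a)) ∘ elim := funext hcomm
    rw [Measure.map_map helim (measurable_exchange i), hc, ← Measure.map_map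
      (measurable_pi_iff.2 fun a => measurable_pi_apply _) helim, h0]
    exact infinitePi_map_comp_injective p.toMeasure hσ
  have h2 := congrArg (fun m => m.map split) h1
  simp only [Measure.map_map hsplit helim] at h2
  have hid : split ∘ elim = id := rfl
  rwa [hid, Measure.map_id, Measure.map_id] at h2

lemma lintegral_exchange (p : PMF ℕ+) (i : ℕ) {f : PTree × PTree → ℝ≥0∞} (hf : Measurable f) :
    ∫⁻ x, f (exchange i x) ∂((GW p).prod (GW p)) = ∫⁻ x, f x ∂((GW p).prod (GW p)) :=
  (measurePreserving_exchange p i).lintegral_comp hf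

/-! ### The branching property -/

/-- Independence of a subtree and the rest of the tree, as a case of exchange: the subtree at `n`
trades places with an independent copy, which `f` does not notice. -/
lemma lintegral_mul_sub (p : PMF ℕ+) (n : ℕ) {f h : PTree → ℝ≥0∞} (hf : Measurable f)
    (hh : Measurable h) (hfn : ∀ T S, f (graft T n S) = f T) :
    ∫⁻ T, f T * h (sub T n) ∂GW p = (∫⁻ T, f T ∂GW p) * ∫⁻ T, h T ∂GW p := by
  have hF : Measurable fun x : PTree × PTree => f x.1 * h x.2 :=
    (hf.comp measurable_fst).mul (hh.comp measurable_snd)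
  have h1 := lintegral_exchange p n hF
  rw [lintegral_prod_mul hf.aemeasurable hh.aemeasurable] at h1
  rw [← h1]
  have h2 : ∀ x : PTree × PTree, f (exchange n x).1 * h (exchange n x).2 =
      f x.2 * h (sub x.2 n) := fun x => by simp [exchange, hfn]
  simp only [h2]
  have hG : Measurable fun T => f T * h (sub T n) := hf.mul (hh.comp (measurable_sub n))
  have := (measurePreserving_snd (μ := GW p) (ν := GW p)).lintegral_comp hG
  exact this.symm

lemma lintegral_GW_root (p : PMF ℕ+) (g : ℕ+ → ℝ≥0∞) :
    ∫⁻ T, g (T []) ∂GW p = ∑' k, p k * g k := by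
  have h := (measurePreserving_eval_infinitePi (fun _ : Vertex => p.toMeasure) []).lintegral_comp
    (f := g) (measurable_of_countable g)
  refine h.trans ?_
  rw [lintegral_countable']
  refine tsum_congr fun k => ?_
  rw [PMF.toMeasure_apply_singleton _ _ (measurableSet_singleton k), mul_comm]

/-- Once the number of children of the root is fixed, the factors are independent and are split off
one at a time. -/
lemma lintegral_prod_sub (p : PMF ℕ+) {h : PTree → ℝ≥0∞} (hh : Measurable h) :
    ∫⁻ T, ∏ i ∈ Finset.range (T []), h (sub T i) ∂GW p =
      ∑' k : ℕ+, p k * (∫⁻ T, h T ∂GW p) ^ (k : ℕ) := by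
  have hroot : Measurable fun T : PTree => T [] := measurable_pi_apply _
  have hind : ∀ k : ℕ+, Measurable fun T : PTree => if T [] = k then (1 : ℝ≥0∞) else 0 :=
    fun k => (measurable_of_countable fun j : ℕ+ => if j = k then (1 : ℝ≥0∞) else 0).comp hroot
  have key : ∀ (k : ℕ+) (n : ℕ), ∫⁻ T : PTree, (if T [] = k then (1 : ℝ≥0∞) else 0) *
      ∏ i ∈ Finset.range n, h (sub T i) ∂GW p = p k * (∫⁻ T, h T ∂GW p) ^ n := by
    intro k n
    induction n with
    | zero =>
      simp only [Finset.range_zero, Finset.prod_empty, mul_one, pow_zero]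
      rw [lintegral_GW_root p fun j => if j = k then (1 : ℝ≥0∞) else 0]
      simp
    | succ n ih =>
      simp only [Finset.prod_range_succ, ← mul_assoc]
      rw [lintegral_mul_sub p n (f := fun T : PTree => (if T [] = k then (1 : ℝ≥0∞) else 0) *
        ∏ i ∈ Finset.range n, h (sub T i)) ((hind k).mul (Finset.measurable_fun_prod _ fun i _ =>
          hh.comp (measurable_sub i))) hh, ih, pow_succ, mul_assoc]
      intro T S
      simp only [graft_nil]
      congr 1
      refine Finset.prod_congr rfl fun i hi => ?_
      rw [sub_graft_of_ne]
      have := Finset.mem_range.1 hi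
      omega
  have hsum : ∀ T : PTree, ∏ i ∈ Finset.range (T []), h (sub T i) =
      ∑' k : ℕ+, (if T [] = k then (1 : ℝ≥0∞) else 0) * ∏ i ∈ Finset.range k, h (sub T i) := by
    intro T
    rw [tsum_eq_single (T [])]
    · simp
    · intro k hk
      simp [hk.symm]
  simp only [hsum]
  rw [lintegral_tsum]
  · exact tsum_congr fun k => key k k
  · exact fun k => ((hind k).mul (Finset.measurable_fun_prod _ fun i _ =>
      hh.comp (measurable_sub i))).aemeasurable

/-! ### Transience with positive probability -/

/-- The probability that the root of `T` is not connected to level `n + 1` of the tree `T_*`, when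
each edge is kept with probability `q`. -/
def extinction (q : ℝ) : ℕ → PTree → ℝ
  | 0, _ => 1 - q
  | n + 1, T => 1 - q + q * ∏ i ∈ Finset.range (T []), extinction q n (sub T i)

section Extinction

variable {q : ℝ}

lemma extinction_mem (hq0 : 0 ≤ q) (hq1 : q ≤ 1) (n : ℕ) :
    ∀ T, 1 - q ≤ extinction q n T ∧ extinction q n T ≤ 1 := by
  induction n with
  | zero => exact fun T => ⟨le_rfl, by simp [extinction, hq0]⟩
  | succ n ih =>
    intro T
    have h0 : 0 ≤ ∏ i ∈ Finset.range (T []), extinction q n (sub T i) :=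
      Finset.prod_nonneg fun i _ => by linarith [(ih (sub T i)).1]
    have h1 : ∏ i ∈ Finset.range (T []), extinction q n (sub T i) ≤ 1 :=
      Finset.prod_le_one (fun i _ => by linarith [(ih (sub T i)).1]) fun i _ => (ih (sub T i)).2
    simp only [extinction]
    constructor <;> nlinarith

lemma extinction_mono (hq0 : 0 ≤ q) (hq1 : q ≤ 1) (T : PTree) :
    Monotone fun n => extinction q n T := by
  refine monotone_nat_of_le_succ fun n => ?_
  induction n generalizing T with
  | zero => exact (extinction_mem hq0 hq1 1 T).1
  | succ n ih =>
    simp only [extinction]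
    gcongr with i hi
    · exact fun i _ => by linarith [(extinction_mem hq0 hq1 n (sub T i)).1]
    · exact ih (sub T i)

lemma measurable_extinction (n : ℕ) : Measurable (extinction q n) := by
  induction n with
  | zero => exact measurable_const
  | succ n ih =>
    have hk : ∀ k : ℕ, Measurable fun T : PTree =>
        1 - q + q * ∏ i ∈ Finset.range k, extinction q n (sub T i) := fun k =>
      ((Finset.measurable_fun_prod _ fun i _ => ih.comp (measurable_sub i)).const_mul q).const_add _
    have h : Measurable fun x : PTree × ℕ+ =>
        1 - q + q * ∏ i ∈ Finset.range x.2, extinction q n (sub x.1 i) :=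
      measurable_from_prod_countable_left fun k => hk k
    exact h.comp (measurable_id.prodMk (measurable_pi_apply []))

/-- The limit of the extinction probabilities. -/
def extinctionLim (q : ℝ) (T : PTree) : ℝ := ⨆ n, extinction q n T

lemma tendsto_extinction (hq0 : 0 ≤ q) (hq1 : q ≤ 1) (T : PTree) :
    Filter.Tendsto (fun n => extinction q n T) Filter.atTop (nhds (extinctionLim q T)) :=
  tendsto_atTop_ciSup (extinction_mono hq0 hq1 T)
    ⟨1, by rintro _ ⟨n, rfl⟩; exact (extinction_mem hq0 hq1 n T).2⟩

lemma extinctionLim_mem (hq0 : 0 ≤ q) (hq1 : q ≤ 1) (T : PTree) :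
    1 - q ≤ extinctionLim q T ∧ extinctionLim q T ≤ 1 :=
  ⟨ge_of_tendsto' (tendsto_extinction hq0 hq1 T) fun n => (extinction_mem hq0 hq1 n T).1,
    le_of_tendsto' (tendsto_extinction hq0 hq1 T) fun n => (extinction_mem hq0 hq1 n T).2⟩

lemma extinctionLim_eq (hq0 : 0 ≤ q) (hq1 : q ≤ 1) (T : PTree) :
    extinctionLim q T = 1 - q + q * ∏ i ∈ Finset.range (T []), extinctionLim q (sub T i) := by
  have h1 := (Filter.tendsto_add_atTop_iff_nat 1).2 (tendsto_extinction hq0 hq1 T)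
  have h2 := ((tendsto_finsetProd (Finset.range (T [])) fun i _ =>
    tendsto_extinction hq0 hq1 (sub T i)).const_mul q).const_add (1 - q)
  exact tendsto_nhds_unique h1 h2

/-- With `y = 1 - x` one has `x / (2 - x) = (1 - y) / (1 + y)`, formally the hyperbolic tangent of
`-log y / 2`. The inequality is the subadditivity of this function on nonnegative arguments, where
products of `y` become sums. -/
lemma prod_one_sub_bound (s : Finset ℕ) (x : ℕ → ℝ) (hx0 : ∀ i, 0 ≤ x i) (hx1 : ∀ i, x i ≤ 1) :
    (1 - ∏ i ∈ s, (1 - x i)) / (1 + ∏ i ∈ s, (1 - x i)) ≤ ∑ i ∈ s, x i / (2 - x i) := by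
  classical
  induction s using Finset.induction_on with
  | empty => simp
  | insert a s ha ih =>
    rw [Finset.prod_insert ha, Finset.sum_insert ha]
    have hP0 : 0 ≤ ∏ i ∈ s, (1 - x i) := Finset.prod_nonneg fun i _ => by linarith [hx1 i]
    have hP1 : ∏ i ∈ s, (1 - x i) ≤ 1 :=
      Finset.prod_le_one (fun i _ => by linarith [hx1 i]) fun i _ => by linarith [hx0 i]
    set P := ∏ i ∈ s, (1 - x i)
    refine le_trans ?_ (add_le_add_right ih _)
    have ha0 := hx0 a
    have ha1 := hx1 a
    have hy : 0 ≤ 1 - x a := by linarith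
    have hyP : 0 ≤ (1 - x a) * P := mul_nonneg hy hP0
    rw [div_add_div _ _ (by linarith) (by linarith), div_le_div_iff₀ (by linarith)
      (mul_pos (by linarith) (by linarith))]
    have hid : (x a * (1 + P) + (2 - x a) * (1 - P)) * (1 + (1 - x a) * P) -
        (1 - (1 - x a) * P) * ((2 - x a) * (1 + P)) =
        x a * (1 - P) * (1 - (1 - x a) * P) := by ring
    have hyP1 : (1 - x a) * P ≤ 1 := mul_le_one₀ (by linarith) hP0 hP1
    have : 0 ≤ x a * (1 - P) * (1 - (1 - x a) * P) :=
      mul_nonneg (mul_nonneg ha0 (by linarith)) (by linarith)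
    linarith

end Extinction

/-- If percolation with parameter `1 / l` survives, so does the walk for every bias up to `l`. The
survival probability `x` satisfies `∏ (1 - x_i) = 1 - l x`, and a function of `x` is subinvariant in
the sense of `le_escape_of_subinvariant`. -/
lemma escape_pos_of_extinctionLim_lt_one (lam : ℝ≥0) {l : ℝ} (hl1 : 1 < l) (hl : lam ≤ l)
    {T : PTree} (hT : extinctionLim l⁻¹ T < 1) : 0 < escape lam T := by
  have hl0 : 0 < l := by linarith
  have hq0 : 0 ≤ l⁻¹ := by positivity
  have hq1 : l⁻¹ ≤ 1 := inv_le_one_of_one_le₀ hl1.le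
  let x : PTree → ℝ := fun T => 1 - extinctionLim l⁻¹ T
  have hx0 : ∀ T, 0 ≤ x T := fun T => by
    have := (extinctionLim_mem hq0 hq1 T).2
    simp only [x]; linarith
  have hxq : ∀ T, l * x T ≤ 1 := fun T => by
    have := (extinctionLim_mem hq0 hq1 T).1
    have h : x T ≤ l⁻¹ := by simp only [x]; linarith
    calc l * x T ≤ l * l⁻¹ := by gcongr
      _ = 1 := mul_inv_cancel₀ hl0.ne'
  have hx1 : ∀ T, x T ≤ 1 := fun T => by nlinarith [hxq T, hx0 T]
  -- The factor `l - 1` makes `1 - b = (2 - l x) / (2 - x)`. The product bound gives `∑ b_i ≥ (l -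
  -- 1) l x / (2 - l x)`, and this times `1 - b` is exactly `l b`.
  let b : PTree → ℝ := fun T => (l - 1) * (x T / (2 - x T))
  have hb0 : ∀ T, 0 ≤ b T := fun T =>
    mul_nonneg (by linarith) (div_nonneg (hx0 T) (by linarith [hx1 T]))
  have h1b : ∀ T, 1 - b T = (2 - l * x T) / (2 - x T) := by
    intro T
    have : 2 - x T ≠ 0 := by linarith [hx1 T]
    simp only [b]
    field_simp
    ring
  have h1b0 : ∀ T, 0 ≤ 1 - b T := fun T => by
    rw [h1b]
    exact div_nonneg (by linarith [hxq T]) (by linarith [hx1 T])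
  have hle := le_escape_of_subinvariant lam b (fun T => by linarith [h1b0 T]) (by
    intro T
    have hfix := extinctionLim_eq hq0 hq1 T
    have hθ : ∏ i ∈ Finset.range (T []), (1 - x (sub T i)) = 1 - l * x T := by
      simp only [x, sub_sub_cancel]
      rw [hfix]
      field_simp
      ring
    have hpb := prod_one_sub_bound (Finset.range (T [])) (fun i => x (sub T i))
      (fun i => hx0 _) fun i => hx1 _
    rw [hθ] at hpb
    have hc : (l - 1) * ((1 - (1 - l * x T)) / (1 + (1 - l * x T))) ≤
        ∑ i ∈ Finset.range (T []), b (sub T i) := by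
      simp only [b]
      rw [← Finset.mul_sum]
      exact mul_le_mul_of_nonneg_left hpb (by linarith)
    calc lam * b T ≤ l * b T := mul_le_mul_of_nonneg_right hl (hb0 T)
      _ = (l - 1) * ((1 - (1 - l * x T)) / (1 + (1 - l * x T))) * (1 - b T) := by
        rw [h1b]
        have h2 : 2 - x T ≠ 0 := by linarith [hx1 T]
        have h3 : 1 + (1 - l * x T) ≠ 0 := by linarith [hxq T]
        have h4 : 2 - l * x T = 1 + (1 - l * x T) := by ring
        rw [h4]
        simp only [b]
        field_simp
        ring
      _ ≤ _ := mul_le_mul_of_nonneg_right hc (h1b0 T)) T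
  refine lt_of_lt_of_le ?_ hle
  have : 0 < x T := by simp only [x]; linarith
  exact mul_pos (by linarith) (div_pos this (by linarith [hx1 T]))

/-- For `lam ≤ 1` the constant `1 - lam` is subinvariant because every vertex has a child; this is
the comparison with a half-line. -/
lemma one_sub_le_escape (lam : ℝ≥0) (T : PTree) : 1 - lam ≤ escape lam T := by
  rcases le_total (1 : ℝ) lam with h | h
  · linarith [escape_nonneg lam T]
  · refine le_escape_of_subinvariant lam (fun _ => 1 - lam) (fun _ => by
      have : (0 : ℝ) ≤ lam := lam.2
      linarith) (fun T => ?_) T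
    have h1 : (1 : ℝ) ≤ (T [] : ℝ) := by exact_mod_cast (T []).pos
    have h0 : (0 : ℝ) ≤ lam := lam.2
    simp only [Finset.sum_const, Finset.card_range, nsmul_eq_mul, sub_sub_cancel]
    nlinarith [mul_nonneg h0 (sub_nonneg.2 h)]

/-! ### Survival of percolation on Galton-Watson trees -/

/-- The generating function of a supercritical offspring distribution is below a line of slope
larger than one near the fixed point `1`. -/
lemma exists_generating_bound (p : PMF ℕ+) {l : ℝ} (hl : 1 < l)
    (hm : ENNReal.ofReal l < mean p) : ∃ t : ℝ, 0 < t ∧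
      ENNReal.ofReal t + ∑' k : ℕ+, p k * ENNReal.ofReal (1 - l⁻¹ * t) ^ (k : ℕ) ≤ 1 := by
  have hl0 : 0 < l := by linarith
  obtain ⟨c, hc1, hc2⟩ := ENNReal.lt_iff_exists_nnreal_btwn.1 hm
  have hlc : l < c := by
    rw [ENNReal.ofReal_lt_iff_lt_toReal hl0.le (by simp)] at hc1
    simpa using hc1
  rw [mean, ENNReal.tsum_eq_iSup_sum, lt_iSup_iff] at hc2
  obtain ⟨I, hI⟩ := hc2
  obtain ⟨N, hN0, hN⟩ : ∃ N : ℕ, 0 < N ∧ ∀ k ∈ I, (k : ℕ) ≤ N :=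
    ⟨I.sup (fun k => (k : ℕ)) + 1, by omega, fun k hk =>
      (Finset.le_sup (f := fun k : ℕ+ => (k : ℕ)) hk).trans (Nat.le_succ _)⟩
  have hN0' : (0 : ℝ) < N := by exact_mod_cast hN0
  -- The mean is truncated to sizes in `I`, all at most `N`, with truncated mean above `c > l`. For
  -- `x = t / l` and `k ≤ N`, `1 - (1 - x) ^ k ≥ k x / (1 + N x)`, so it suffices that `t ≤ c x / (1
  -- + N x)`, that is, `l + N t ≤ c`.
  let t : ℝ := min 1 ((c - l) / N)
  have ht0 : 0 < t := lt_min one_pos (div_pos (by linarith) hN0')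
  have ht1 : t ≤ 1 := min_le_left _ _
  have htN : N * t ≤ c - l := by
    have : t ≤ (c - l) / N := min_le_right _ _
    rw [le_div_iff₀ hN0'] at this
    linarith
  have hq0 : 0 < l⁻¹ := by positivity
  have hq1 : l⁻¹ ≤ 1 := inv_le_one_of_one_le₀ hl.le
  set x := l⁻¹ * t with hx
  have hx0 : 0 < x := mul_pos hq0 ht0
  have hx1 : x ≤ 1 := mul_le_one₀ hq1 ht0.le ht1
  refine ⟨t, ht0, ?_⟩
  have hlx : l * x = t := by rw [hx, ← mul_assoc, mul_inv_cancel₀ hl0.ne', one_mul]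
  have hD : 0 < 1 + N * x := by positivity
  have hpow : ∀ k : ℕ, (1 - x) ^ k * (1 + k * x) ≤ 1 := by
    intro k
    have h1 : 1 + k * x ≤ (1 + x) ^ k := one_add_mul_le_pow (by linarith) k
    calc (1 - x) ^ k * (1 + k * x) ≤ (1 - x) ^ k * (1 + x) ^ k :=
          mul_le_mul_of_nonneg_left h1 (pow_nonneg (by linarith) k)
      _ = ((1 - x) * (1 + x)) ^ k := (mul_pow _ _ _).symm
      _ ≤ 1 := pow_le_one₀ (mul_nonneg (by linarith) (by linarith)) (by nlinarith)
  have hterm : ∀ k ∈ I, (1 - x) ^ (k : ℕ) + k * (x / (1 + N * x)) ≤ 1 := by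
    intro k hk
    have hkN : (k : ℝ) ≤ N := by exact_mod_cast hN k hk
    have hk0 : (0 : ℝ) ≤ k := by positivity
    have hDk : 0 < 1 + k * x := by positivity
    have h1 : (1 - x) ^ (k : ℕ) ≤ 1 / (1 + k * x) := by
      rw [le_div_iff₀ hDk]
      exact hpow k
    have h2 : k * (x / (1 + N * x)) ≤ k * x / (1 + k * x) :=
      (mul_le_mul_of_nonneg_left (div_le_div_of_nonneg_left hx0.le hDk
        (add_le_add_right (mul_le_mul_of_nonneg_right hkN hx0.le) 1)) hk0).trans_eq
        (mul_div_assoc _ _ _).symm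
    have h3 : 1 / (1 + k * x) + k * x / (1 + k * x) = 1 := by
      rw [← add_div, div_self hDk.ne']
    linarith
  have ht : t ≤ c * (x / (1 + N * x)) := by
    rw [← mul_div_assoc, le_div_iff₀ hD]
    nlinarith
  calc ENNReal.ofReal t + ∑' k : ℕ+, p k * ENNReal.ofReal (1 - x) ^ (k : ℕ)
      ≤ (∑ k ∈ I, (k : ℝ≥0∞) * p k) * ENNReal.ofReal (x / (1 + N * x)) +
          ∑' k : ℕ+, p k * ENNReal.ofReal (1 - x) ^ (k : ℕ) := by
        gcongr
        calc ENNReal.ofReal t ≤ ENNReal.ofReal (c * (x / (1 + N * x))) :=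
              ENNReal.ofReal_le_ofReal ht
          _ = c * ENNReal.ofReal (x / (1 + N * x)) := by
              rw [ENNReal.ofReal_mul (NNReal.coe_nonneg c)]; simp
          _ ≤ _ := by gcongr
    _ = ∑' k : ℕ+, ((if k ∈ I then (k : ℝ≥0∞) * p k * ENNReal.ofReal (x / (1 + N * x)) else 0) +
          p k * ENNReal.ofReal (1 - x) ^ (k : ℕ)) := by
        rw [ENNReal.tsum_add]
        congr 1
        rw [Finset.sum_mul, tsum_eq_sum (s := I) (fun k hk => by simp [hk])]
        exact Finset.sum_congr rfl fun k hk => by simp [hk]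
    _ ≤ ∑' k : ℕ+, p k := by
        refine ENNReal.tsum_le_tsum fun k => ?_
        have h1 : ENNReal.ofReal (1 - x) ^ (k : ℕ) = ENNReal.ofReal ((1 - x) ^ (k : ℕ)) :=
          (ENNReal.ofReal_pow (by linarith) _).symm
        rw [h1]
        by_cases hk : k ∈ I
        · rw [if_pos hk]
          have h2 : (k : ℝ≥0∞) * p k * ENNReal.ofReal (x / (1 + N * x)) =
              p k * ENNReal.ofReal (k * (x / (1 + N * x))) := by
            rw [ENNReal.ofReal_mul (by positivity)]
            simp only [ENNReal.ofReal_natCast]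
            ring
          rw [h2, ← mul_add, ← ENNReal.ofReal_add (by positivity) (pow_nonneg (by linarith) _)]
          refine mul_le_of_le_one_right' ?_
          rw [ENNReal.ofReal_le_one]
          linarith [hterm k hk]
        · rw [if_neg hk, zero_add]
          refine mul_le_of_le_one_right' ?_
          rw [ENNReal.ofReal_le_one]
          exact pow_le_one₀ (by linarith) (by linarith)
    _ = 1 := p.tsum_coe

/-- With `q = 1 / l` and `f` the generating function, the branching property turns the mean `ρ` at
one level into `1 - q + q f(ρ)` at the next. The condition `t + f(1 - q t) ≤ 1` says that this
recursion preserves the bound `ρ ≤ 1 - q t`. -/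
lemma lintegral_extinction (p : PMF ℕ+) {l t : ℝ} (hl : 1 < l) (ht0 : 0 < t)
    (ht : ENNReal.ofReal t + ∑' k : ℕ+, p k * ENNReal.ofReal (1 - l⁻¹ * t) ^ (k : ℕ) ≤ 1)
    (n : ℕ) : ENNReal.ofReal (l⁻¹ * t) + ∫⁻ T, ENNReal.ofReal (extinction l⁻¹ n T) ∂GW p ≤ 1 := by
  have hl0 : 0 < l := by linarith
  have hq0 : 0 ≤ l⁻¹ := by positivity
  have hq1 : l⁻¹ ≤ 1 := inv_le_one_of_one_le₀ hl.le
  have htle : t ≤ 1 := by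
    have : ENNReal.ofReal t ≤ 1 := le_self_add.trans ht
    rwa [ENNReal.ofReal_le_one] at this
  induction n with
  | zero =>
    simp only [extinction, lintegral_const, measure_univ, mul_one]
    rw [← ENNReal.ofReal_add (by positivity) (by linarith), ENNReal.ofReal_le_one]
    nlinarith
  | succ n ih =>
    set ρ := ∫⁻ T, ENNReal.ofReal (extinction l⁻¹ n T) ∂GW p with hρ
    have hρle : ρ ≤ ENNReal.ofReal (1 - l⁻¹ * t) := by
      rw [ENNReal.ofReal_sub _ (by positivity), ENNReal.ofReal_one]
      exact ENNReal.le_sub_of_add_le_left ENNReal.ofReal_ne_top ih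
    have hmeas : Measurable fun T => ENNReal.ofReal (extinction l⁻¹ n T) :=
      (measurable_extinction n).ennreal_ofReal
    have e : ∀ T, ENNReal.ofReal (extinction l⁻¹ (n + 1) T) = ENNReal.ofReal (1 - l⁻¹) +
        ENNReal.ofReal l⁻¹ * ∏ i ∈ Finset.range (T []),
          ENNReal.ofReal (extinction l⁻¹ n (sub T i)) := by
      intro T
      have h0 : ∀ i ∈ Finset.range (T []), 0 ≤ extinction l⁻¹ n (sub T i) := fun i _ => by
        linarith [(extinction_mem hq0 hq1 n (sub T i)).1]
      rw [extinction, ENNReal.ofReal_add (by linarith) (mul_nonneg hq0 (Finset.prod_nonneg h0)),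
        ENNReal.ofReal_mul hq0, ENNReal.ofReal_prod_of_nonneg h0]
    simp only [e]
    rw [lintegral_add_left measurable_const, lintegral_const_mul' _ _ ENNReal.ofReal_ne_top,
      lintegral_prod_sub p hmeas, ← hρ]
    simp only [lintegral_const, measure_univ, mul_one]
    have h1 : ∑' k : ℕ+, p k * ρ ^ (k : ℕ) ≤
        ∑' k : ℕ+, p k * ENNReal.ofReal (1 - l⁻¹ * t) ^ (k : ℕ) :=
      ENNReal.tsum_le_tsum fun k => by gcongr
    calc ENNReal.ofReal (l⁻¹ * t) + (ENNReal.ofReal (1 - l⁻¹) +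
          ENNReal.ofReal l⁻¹ * ∑' k : ℕ+, p k * ρ ^ (k : ℕ))
        = ENNReal.ofReal (1 - l⁻¹) + ENNReal.ofReal l⁻¹ *
          (ENNReal.ofReal t + ∑' k : ℕ+, p k * ρ ^ (k : ℕ)) := by
          rw [ENNReal.ofReal_mul hq0]; ring
      _ ≤ ENNReal.ofReal (1 - l⁻¹) + ENNReal.ofReal l⁻¹ * 1 := by
          gcongr
          exact le_trans (by gcongr) ht
      _ = 1 := by
          rw [mul_one, ← ENNReal.ofReal_add (by linarith) hq0]
          simp

/-- For `lam ≥ 1`, if almost every tree had zero escape probability, the extinction probabilities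
would increase to `1` almost surely, against the uniform bound on their means. -/
lemma measure_escape_pos (p : PMF ℕ+) (lam : ℝ≥0) (hlam : (lam : ℝ≥0∞) < mean p) :
    GW p {T | 0 < escape lam T} ≠ 0 := by
  rcases lt_or_ge (lam : ℝ) 1 with h | h
  · have : {T : PTree | 0 < escape lam T} = Set.univ := by
      refine Set.eq_univ_of_forall fun T => ?_
      have := one_sub_le_escape lam T
      change 0 < escape lam T
      linarith
    simp [this]
  · obtain ⟨l, hl1, hl2⟩ := ENNReal.lt_iff_exists_nnreal_btwn.1 hlam
    have hl1' : (lam : ℝ) < l := by exact_mod_cast hl1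
    have hl : (1 : ℝ) < l := by linarith
    have hq0 : 0 ≤ (l : ℝ)⁻¹ := by positivity
    have hq1 : (l : ℝ)⁻¹ ≤ 1 := inv_le_one_of_one_le₀ hl.le
    obtain ⟨t, ht0, ht⟩ := exists_generating_bound p hl (by simpa using hl2)
    intro hnull
    have hae : ∀ᵐ T ∂GW p, extinctionLim (l : ℝ)⁻¹ T = 1 := by
      rw [ae_iff]
      refine measure_mono_null (fun T hT => ?_) hnull
      exact escape_pos_of_extinctionLim_lt_one lam hl hl1'.le
        (lt_of_le_of_ne (extinctionLim_mem hq0 hq1 T).2 hT)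
    have hlim : Filter.Tendsto (fun n => ∫⁻ T, ENNReal.ofReal (extinction (l : ℝ)⁻¹ n T) ∂GW p)
        Filter.atTop (nhds (∫⁻ T, ENNReal.ofReal (extinctionLim (l : ℝ)⁻¹ T) ∂GW p)) := by
      refine lintegral_tendsto_of_tendsto_of_monotone
        (fun n => (measurable_extinction n).ennreal_ofReal.aemeasurable)
        (Filter.Eventually.of_forall fun T m n hmn =>
          ENNReal.ofReal_le_ofReal (extinction_mono hq0 hq1 T hmn))
        (Filter.Eventually.of_forall fun T =>
          (ENNReal.continuous_ofReal.tendsto _).comp (tendsto_extinction hq0 hq1 T))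
    have h1 : ∫⁻ T, ENNReal.ofReal (extinctionLim (l : ℝ)⁻¹ T) ∂GW p = 1 := by
      rw [lintegral_congr_ae (g := fun _ => 1) (by
        filter_upwards [hae] with T hT
        simp [hT])]
      simp
    have h2 := le_of_tendsto' (hlim.const_add (ENNReal.ofReal ((l : ℝ)⁻¹ * t))) fun n =>
      lintegral_extinction p hl ht0 ht n
    rw [h1] at h2
    have h3 : ENNReal.ofReal ((l : ℝ)⁻¹ * t) ≠ 0 := by
      rw [Ne, ENNReal.ofReal_eq_zero, not_le]
      positivity
    exact absurd h2 (not_le.2 (by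
      rw [add_comm]
      exact ENNReal.lt_add_right ENNReal.one_ne_top h3))

/-! ### Re-rooting a joined tree -/

lemma MarkedTree.mk_eq_of_equiv {A B : MarkedTree} (φ : Vertex ≃ Vertex)
    (hadj : ∀ u v, B.graph.Adj (φ u) (φ v) ↔ A.graph.Adj u v) (hray : ∀ n, φ (A.ray n) = B.ray n) :
    Quotient.mk MarkedTree.setoid A = Quotient.mk MarkedTree.setoid B := by
  let e : A.graph ≃g B.graph := ⟨φ, hadj _ _⟩
  refine Quotient.sound ⟨φ, ?_, fun u _ v _ => hadj u v, hray⟩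
  have hr : ∀ v, v ∈ A.verts ↔ φ v ∈ B.verts := by
    intro v
    change A.graph.Reachable _ _ ↔ B.graph.Reachable _ _
    rw [← hray 0]
    exact e.reachable_iff.symm
  refine ⟨fun v hv => (hr v).1 hv, φ.injective.injOn, fun v hv => ?_⟩
  obtain ⟨u, rfl⟩ := φ.surjective v
  exact ⟨u, (hr u).2 hv, rfl⟩

lemma MarkedTree.move_ray_one (A : MarkedTree) :
    (A.move (A.ray 1)).graph = A.graph ∧ (A.move (A.ray 1)).ray = fun n => A.ray (n + 1) := by
  obtain ⟨h1, h2⟩ := A.move_moveRay (A.ray_adj 0)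
  exact ⟨h1, by rw [h2]; simp [moveRay]⟩

lemma MarkedTree.mk_move_ray_one_congr {A B : MarkedTree} (h : Iso A B) :
    Quotient.mk setoid (A.move (A.ray 1)) = Quotient.mk setoid (B.move (B.ray 1)) := by
  obtain ⟨φ, hφ, hadj, hray⟩ := h
  refine Quotient.sound ⟨φ, ?_, ?_, ?_⟩
  · rw [move_verts A (A.ray_adj 0), move_verts B (B.ray_adj 0)]
    exact hφ
  · rw [move_verts A (A.ray_adj 0), A.move_ray_one.1, B.move_ray_one.1]
    exact hadj
  · intro n
    rw [A.move_ray_one.2, B.move_ray_one.2]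
    exact hray _

/-- Moving to a neighbour which is not on the marked ray and back again. -/
lemma MarkedTree.mk_move_move (A : MarkedTree) {x : Vertex} (hx : A.graph.Adj (A.ray 0) x)
    (hne : x ≠ A.ray 1) :
    Quotient.mk setoid ((A.move x).move ((A.move x).ray 1)) = Quotient.mk setoid A := by
  obtain ⟨h1, h2⟩ := A.move_moveRay hx
  obtain ⟨h3, h4⟩ := (A.move x).move_ray_one
  refine mk_eq_of_equiv (Equiv.refl _) (fun u v => ?_) fun n => ?_
  · rw [h3, h1]; rfl
  · rw [h4, h2]
    simp [moveRay, hne]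

/-- The change of labels when the tree `join T S` is re-rooted at the child `i` of the root of
`S`. -/
def reroot (i : ℕ) : Vertex → Vertex
  | [] => [0]
  -- The old root becomes the root `[0]` of the first tree, in which `T` takes over the label `i`
  -- left free by the subtree of the new root.
  | 0 :: u => 0 :: i :: u
  | (j + 1) :: u => if j = i then (match u with
      | [] => []
      | k :: w => (k + 1) :: w) else 0 :: j :: u

/-- The inverse of `reroot`. -/
def rerootInv (i : ℕ) : Vertex → Vertex
  | [] => [i + 1]
  | (k + 1) :: u => (i + 1) :: k :: u
  | [0] => []
  | 0 :: j :: u => if j = i then 0 :: u else (j + 1) :: u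

/-- `reroot` as a bijection. -/
def rerootEquiv (i : ℕ) : Vertex ≃ Vertex where
  toFun := reroot i
  invFun := rerootInv i
  left_inv u := by
    match u with
    | [] => rfl
    | 0 :: u => simp [reroot, rerootInv]
    | (j + 1) :: u =>
      by_cases h : j = i
      · subst h
        cases u <;> simp [reroot, rerootInv]
      · simp [reroot, rerootInv, h]
  right_inv u := by
    match u with
    | [] => simp [reroot, rerootInv]
    | (k + 1) :: u => simp [reroot, rerootInv]
    | [0] => rfl
    | 0 :: j :: u =>
      by_cases h : j = i
      · subst h
        simp [reroot, rerootInv]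
      · simp [reroot, rerootInv, h]

lemma PTree.adj_concat {T : PTree} (u : Vertex) {k : ℕ} (hk : k < (T u : ℕ)) :
    T.graph.Adj u (u ++ [k]) := Or.inl ⟨k, hk, rfl⟩

/-- The edge from the old root to its child `i` reverses its direction, so the conclusion can only
be adjacency. Together with the same statement for the inverse map it gives an isomorphism of
graphs. -/
lemma adj_reroot {T S : PTree} {i : ℕ} (hi : i < (S [] : ℕ)) {u v : Vertex}
    (h : (PTree.join T S).IsChild u v) :
    (PTree.join (graft S i T) (sub S i)).graph.Adj (reroot i u) (reroot i v) := by
  obtain ⟨k, hk, rfl⟩ := h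
  match u with
  | [] =>
    match k with
    | 0 => exact PTree.adj_concat (T := PTree.join (graft S i T) (sub S i)) [0] (k := i) hi
    | j + 1 =>
      by_cases hj : j = i
      · subst hj
        have := (PTree.adj_concat (T := PTree.join (graft S j T) (sub S j)) [] (k := 0)
          (PNat.pos _)).symm
        simpa [reroot] using this
      · have hj' : j < (S [] : ℕ) := by simpa [PTree.join] using hk
        have := PTree.adj_concat (T := PTree.join (graft S i T) (sub S i)) [0] (k := j) hj'
        simpa [reroot, hj] using this
  | 0 :: u =>
    refine PTree.adj_concat (T := PTree.join (graft S i T) (sub S i)) (0 :: i :: u) (k := k) ?_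
    simpa [PTree.join, graft] using hk
  | [j + 1] =>
    by_cases hj : j = i
    · subst hj
      have hk' : k < (S [j] : ℕ) := hk
      have := PTree.adj_concat (T := PTree.join (graft S j T) (sub S j)) [] (k := k + 1)
        (by simpa [PTree.join, sub] using hk')
      simpa [reroot] using this
    · have hk' : k < (S [j] : ℕ) := hk
      have := PTree.adj_concat (T := PTree.join (graft S i T) (sub S i)) [0, j] (k := k)
        (by simpa [PTree.join, graft, hj] using hk')
      simpa [reroot, hj] using this
  | (j + 1) :: l :: u =>
    have hk' : k < (S (j :: l :: u) : ℕ) := hk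
    by_cases hj : j = i
    · subst hj
      have := PTree.adj_concat (T := PTree.join (graft S j T) (sub S j)) ((l + 1) :: u) (k := k)
        (by simpa [PTree.join, sub] using hk')
      simpa [reroot] using this
    · have := PTree.adj_concat (T := PTree.join (graft S i T) (sub S i)) (0 :: j :: l :: u)
        (k := k) (by simpa [PTree.join, graft, hj] using hk')
      simpa [reroot, hj] using this

lemma adj_rerootInv {T S : PTree} {i : ℕ} (hi : i < (S [] : ℕ)) {u v : Vertex}
    (h : (PTree.join (graft S i T) (sub S i)).IsChild u v) :
    (PTree.join T S).graph.Adj (rerootInv i u) (rerootInv i v) := by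
  obtain ⟨k, hk, rfl⟩ := h
  match u with
  | [] =>
    match k with
    | 0 =>
      have := (PTree.adj_concat (T := PTree.join T S) [] (k := i + 1)
        (by simpa [PTree.join] using hi)).symm
      simpa [rerootInv] using this
    | k + 1 =>
      have hk' : k < (S [i] : ℕ) := by simpa [PTree.join, sub] using hk
      exact PTree.adj_concat (T := PTree.join T S) [i + 1] (k := k) hk'
  | (l + 1) :: u =>
    exact PTree.adj_concat (T := PTree.join T S) ((i + 1) :: l :: u) (k := k) hk
  | [0] =>
    have hk' : k < (S [] : ℕ) := hk
    by_cases hj : k = i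
    · subst hj
      have := PTree.adj_concat (T := PTree.join T S) [] (k := 0) (PNat.pos _)
      simpa [rerootInv] using this
    · have := PTree.adj_concat (T := PTree.join T S) [] (k := k + 1)
        (by simpa [PTree.join] using hk')
      simpa [rerootInv, hj] using this
  | 0 :: j :: u =>
    have hk' : k < (graft S i T (j :: u) : ℕ) := hk
    by_cases hj : j = i
    · subst hj
      have := PTree.adj_concat (T := PTree.join T S) (0 :: u) (k := k)
        (by simpa [PTree.join, graft] using hk')
      simpa [rerootInv] using this
    · have := PTree.adj_concat (T := PTree.join T S) ((j + 1) :: u) (k := k)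
        (by simpa [PTree.join, graft, hj] using hk')
      simpa [rerootInv, hj] using this

lemma adj_rerootEquiv {T S : PTree} {i : ℕ} (hi : i < (S [] : ℕ)) (u v : Vertex) :
    (PTree.join (graft S i T) (sub S i)).graph.Adj (rerootEquiv i u) (rerootEquiv i v) ↔
      (PTree.join T S).graph.Adj u v := by
  constructor
  · intro h
    have hinv : ∀ w, rerootInv i (rerootEquiv i w) = w := (rerootEquiv i).left_inv
    rw [← hinv u, ← hinv v]
    rcases h with h | h
    · exact adj_rerootInv hi h
    · exact (adj_rerootInv hi h).symm
  · rintro (h | h)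
    · exact adj_reroot hi h
    · exact (adj_reroot hi h).symm

/-! ### Rays and moves in joined trees -/

lemma isRay_consRay_iff {T : PTree} {i : ℕ} {ξ : ℕ → Vertex} :
    T.IsRay (consRay i ξ) ↔ i < (T [] : ℕ) ∧ (sub T i).IsRay ξ := by
  constructor
  · rintro ⟨-, h⟩
    obtain ⟨j, hj, h1⟩ := h 0
    have h1' : i :: ξ 0 = [j] := h1
    simp only [List.cons.injEq] at h1'
    obtain ⟨rfl, h0⟩ := h1'
    refine ⟨hj, h0, fun n => ?_⟩
    obtain ⟨k, hk, h2⟩ := h (n + 1)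
    have h2' : i :: ξ (n + 1) = i :: (ξ n ++ [k]) := h2
    exact ⟨k, hk, (List.cons.inj h2').2⟩
  · rintro ⟨hi, h0, h⟩
    refine ⟨rfl, ?_⟩
    rintro (_ | n)
    · exact ⟨i, hi, by simp [consRay, h0]⟩
    · obtain ⟨k, hk, h2⟩ := h n
      exact ⟨k, hk, by simp [consRay, h2]⟩

/-- The labelled representative of `RayedPair.toTreeStar`. -/
def RayedPair.toMarked (x : RayedPair) : MarkedTree :=
  (PTree.join x.1.1.1 x.1.1.2).marked
    (by have := (x.1.1.2 []).pos; simp only [PTree.join, PNat.add_coe, PNat.one_coe]; omega)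
    (PTree.joinRay x.1.2) (PTree.isRay_joinRay _ x.2)

lemma RayedPair.toTreeStar_eq (x : RayedPair) :
    x.toTreeStar = Quotient.mk MarkedTree.setoid x.toMarked := rfl

lemma isRay_exchange {T S : PTree} {ξ : ℕ → Vertex} (h : T.IsRay ξ) {i : ℕ}
    (hi : i < (S [] : ℕ)) : (graft S i T).IsRay (consRay i ξ) :=
  isRay_consRay_iff.2 ⟨hi, by rwa [sub_graft_self]⟩

lemma RayedPair.adj_root (x : RayedPair) {k : ℕ} (hk : k < (x.1.1.2 [] : ℕ) + 1) :
    x.toMarked.graph.Adj (x.toMarked.ray 0) [k] :=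
  PTree.adj_concat (T := PTree.join x.1.1.1 x.1.1.2) [] hk

lemma RayedPair.ray_one (x : RayedPair) : x.toMarked.ray 1 = [0] := by
  change 0 :: x.1.2 0 = [0]
  rw [x.2.1]

/-- Moving away from the marked ray. -/
lemma mk_move_succ {T S : PTree} {ξ : ℕ → Vertex} (h : T.IsRay ξ) {i : ℕ}
    (hi : i < (S [] : ℕ)) :
    Quotient.mk MarkedTree.setoid ((RayedPair.toMarked ⟨((T, S), ξ), h⟩).move [i + 1]) =
      RayedPair.toTreeStar ⟨((graft S i T, sub S i), consRay i ξ), isRay_exchange h hi⟩ := by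
  set x : RayedPair := ⟨((T, S), ξ), h⟩
  obtain ⟨h1, h2⟩ := x.toMarked.move_moveRay (x.adj_root (k := i + 1) (by simpa [x] using hi))
  refine MarkedTree.mk_eq_of_equiv (rerootEquiv i) (fun u v => ?_) fun n => ?_
  · rw [h1]
    exact adj_rerootEquiv hi u v
  · rw [h2, MarkedTree.moveRay, if_neg (by rw [x.ray_one]; simp)]
    match n with
    | 0 =>
      change reroot i [i + 1] = []
      simp [reroot]
    | 1 => rfl
    | n + 2 => rfl

/-- Moving along the marked ray. -/
lemma mk_move_zero {T S : PTree} {ξ : ℕ → Vertex} (h : T.IsRay ξ) {i : ℕ}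
    (hi : i < (S [] : ℕ)) :
    Quotient.mk MarkedTree.setoid ((RayedPair.toMarked
        ⟨((graft S i T, sub S i), consRay i ξ), isRay_exchange h hi⟩).move [0]) =
      RayedPair.toTreeStar ⟨((T, S), ξ), h⟩ := by
  set x : RayedPair := ⟨((T, S), ξ), h⟩
  set y : RayedPair := ⟨((graft S i T, sub S i), consRay i ξ), isRay_exchange h hi⟩
  -- No second relabelling is needed: the inward move undoes the outward move, and moving along the
  -- ray is well defined up to isomorphism.
  have hiso : MarkedTree.Iso (x.toMarked.move [i + 1]) y.toMarked :=
    Quotient.exact (mk_move_succ h hi)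
  have h1 := MarkedTree.mk_move_ray_one_congr hiso
  rw [y.ray_one] at h1
  rw [← h1, x.toTreeStar_eq]
  exact x.toMarked.mk_move_move (x.adj_root (k := i + 1) (by simpa [x] using hi))
    (by rw [x.ray_one]; simp)

lemma RayedPair.rootDegree_toMarked (x : RayedPair) :
    x.toMarked.rootDegree = (x.1.1.2 [] : ℕ) + 1 := by
  have : x.toMarked.graph.neighborSet (x.toMarked.ray 0) =
      ((Finset.range ((x.1.1.2 [] : ℕ) + 1)).image fun k => ([k] : Vertex) : Finset Vertex) := by
    ext v
    change (PTree.join x.1.1.1 x.1.1.2).graph.Adj [] v ↔ _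
    simp only [Finset.coe_image, Set.mem_image, Finset.coe_range, Set.mem_Iio]
    constructor
    · rintro (⟨k, hk, rfl⟩ | ⟨k, hk, h⟩)
      · exact ⟨k, hk, rfl⟩
      · simp at h
    · rintro ⟨k, hk, rfl⟩
      exact x.adj_root hk
  rw [MarkedTree.rootDegree, this, Set.ncard_coe_finset, Finset.card_image_of_injective,
    Finset.card_range]
  exact fun a b hab => by simpa using hab

lemma lintegral_rwKernel (lam : ℝ≥0) (x : RayedPair) {F : TreeStar → ℝ≥0∞} (hF : Measurable F) :
    ∫⁻ q, F q ∂rwKernel lam x.toTreeStar =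
      (∑ i ∈ Finset.range (x.1.1.2 []), 1 / ((x.1.1.2 [] : ℝ≥0∞) + lam) *
        F (Quotient.mk MarkedTree.setoid (x.toMarked.move [i + 1]))) +
      lam / ((x.1.1.2 [] : ℝ≥0∞) + lam) *
        F (Quotient.mk MarkedTree.setoid (x.toMarked.move [0])) := by
  classical
  have h0 : rwKernel lam x.toTreeStar = x.toMarked.stepLaw lam := rfl
  have hadj : ∀ v, x.toMarked.graph.Adj (x.toMarked.ray 0) v →
      v ∈ (Finset.range ((x.1.1.2 [] : ℕ) + 1)).image fun k => ([k] : Vertex) := by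
    intro v hv
    change (PTree.join x.1.1.1 x.1.1.2).graph.Adj [] v at hv
    rcases hv with ⟨k, hk, rfl⟩ | ⟨k, hk, h⟩
    · exact Finset.mem_image.2 ⟨k, Finset.mem_range.2 hk, rfl⟩
    · simp at h
  rw [h0, MarkedTree.stepLaw, lintegral_sum_measure]
  simp only [lintegral_smul_measure, lintegral_dirac' _ hF, smul_eq_mul]
  rw [tsum_eq_sum (s := (Finset.range ((x.1.1.2 [] : ℕ) + 1)).image fun k => ([k] : Vertex))
    (fun v hv => by
      have : ¬ x.toMarked.graph.Adj (x.toMarked.ray 0) v := fun h => hv (hadj v h)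
      simp [MarkedTree.stepProb, this]),
    Finset.sum_image (fun a _ b _ hab => by simpa using hab), Finset.sum_range_succ']
  congr 1
  · refine Finset.sum_congr rfl fun i hi => ?_
    have := Finset.mem_range.1 hi
    rw [MarkedTree.stepProb, if_pos (x.adj_root (by omega)), if_neg (by rw [x.ray_one]; simp),
      x.rootDegree_toMarked]
    simp
  · rw [MarkedTree.stepProb, if_pos (x.adj_root (by omega)), if_pos x.ray_one.symm,
      x.rootDegree_toMarked]
    simp

/-! ### Measurability -/

lemma measurable_star : Measurable PTree.star := by
  refine measurable_pi_iff.2 fun u => ?_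
  match u with
  | [] => exact measurable_const
  | 0 :: u => exact measurable_pi_apply u
  | (_ + 1) :: _ => exact measurable_const

lemma measurable_escape (lam : ℝ≥0) : Measurable (escape lam) := by
  have hm : MeasurableSet {X : ℕ → Vertex | ∀ n, X n ≠ []} :=
    measurableSet_forall_vertex {[]}ᶜ
  have h := (Kernel.measurable_coe (walk lam) hm).comp
    (measurable_star.prodMk (measurable_const (a := ([0] : Vertex))))
  exact h.ennreal_toReal

lemma measurable_effConductance (lam : ℝ≥0) (hlam : lam ≠ 0) :
    Measurable (effConductance lam) := by
  have h : Measurable fun x : PTree × ℕ+ =>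
      ∑ i ∈ Finset.range x.2, escape lam (sub x.1 i) := by
    have hk : ∀ k : ℕ+, Measurable fun T : PTree => ∑ i ∈ Finset.range k, escape lam (sub T i) :=
      fun k => Finset.measurable_fun_sum _ fun i _ => (measurable_escape lam).comp (measurable_sub i)
    exact measurable_from_prod_countable_left fun k => hk k
  have h2 := h.comp (measurable_id.prodMk (measurable_pi_apply []))
  have e : effConductance lam = fun T => ∑ i ∈ Finset.range (T []), escape lam (sub T i) :=
    funext fun T => effConductance_eq_sum lam hlam T
  rw [e]
  exact h2

lemma measurable_join : Measurable fun x : PTree × PTree => PTree.join x.1 x.2 := by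
  refine measurable_pi_iff.2 fun u => ?_
  match u with
  | [] =>
    have h : Measurable fun k : ℕ+ => k + 1 := measurable_of_countable _
    exact h.comp ((measurable_pi_apply _).comp measurable_snd)
  | 0 :: u => exact (measurable_pi_apply u).comp measurable_fst
  | (i + 1) :: u => exact (measurable_pi_apply (i :: u)).comp measurable_snd

lemma measurableSet_isChild (u v : Vertex) : MeasurableSet {T : PTree | T.IsChild u v} :=
  measurable_pi_apply (X := fun _ : Vertex => ℕ+) u
    (MeasurableSpace.measurableSet_top (s := {k : ℕ+ | ∃ i < (k : ℕ), v = u ++ [i]}))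

lemma measurableSet_isRay_prod :
    MeasurableSet {z : (PTree × PTree) × (ℕ → Vertex) | z.1.1.IsRay z.2} := by
  have : {z : (PTree × PTree) × (ℕ → Vertex) | z.1.1.IsRay z.2} =
      {z | z.2 0 = []} ∩ ⋂ n : ℕ, ⋃ u : Vertex, ⋃ v : Vertex,
        ({z | z.1.1.IsChild u v} ∩ ({z | z.2 n = u} ∩ {z | z.2 (n + 1) = v})) := by
    ext z
    simp [PTree.IsRay]
  have hξ : ∀ (n : ℕ) (u : Vertex),
      MeasurableSet {z : (PTree × PTree) × (ℕ → Vertex) | z.2 n = u} := fun n u => by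
    have h : Measurable fun z : (PTree × PTree) × (ℕ → Vertex) => z.2 n :=
      (measurable_pi_apply n).comp measurable_snd
    exact h (measurableSet_singleton u)
  rw [this]
  refine (hξ 0 []).inter (MeasurableSet.iInter fun n => MeasurableSet.iUnion fun u =>
    MeasurableSet.iUnion fun v => ?_)
  exact ((measurable_fst.comp measurable_fst) (measurableSet_isChild u v)).inter
    ((hξ n u).inter (hξ (n + 1) v))

lemma measurable_toMarked : Measurable RayedPair.toMarked := by
  refine measurable_comap_iff.2 (Measurable.prodMk ?_ ?_)
  · refine measurable_pi_iff.2 fun u => measurable_pi_iff.2 fun v => ?_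
    have hj : Measurable fun x : RayedPair => PTree.join x.1.1.1 x.1.1.2 :=
      measurable_join.comp (measurable_fst.comp measurable_subtype_coe)
    exact measurableSet_setOfPred.1 (hj
      ((measurableSet_isChild u v).union (measurableSet_isChild v u)))
  · refine measurable_pi_iff.2 fun n => ?_
    match n with
    | 0 => exact measurable_const
    | n + 1 =>
      exact (measurable_of_countable (fun u : Vertex => (0 :: u : Vertex))).comp
        ((measurable_pi_apply n).comp (measurable_snd.comp measurable_subtype_coe))

lemma measurable_toTreeStar : Measurable RayedPair.toTreeStar :=
  measurable_quotient_mk'.comp measurable_toMarked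

/-! ### Test functions on pairs of trees with a ray -/

open Classical in
/-- A function of a tree with a marked ray as a function of two trees and a sequence of vertices,
which vanishes if the sequence is not a ray of the first tree. -/
def onPairs (F : TreeStar → ℝ≥0∞) (z : (PTree × PTree) × (ℕ → Vertex)) : ℝ≥0∞ :=
  if h : z.1.1.IsRay z.2 then F (RayedPair.toTreeStar ⟨z, h⟩) else 0

open Classical in
/-- The value of a function after the root has moved along the marked ray. -/
def afterReturn (F : TreeStar → ℝ≥0∞) (z : (PTree × PTree) × (ℕ → Vertex)) : ℝ≥0∞ :=
  if h : z.1.1.IsRay z.2 then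
    F (Quotient.mk MarkedTree.setoid ((RayedPair.toMarked ⟨z, h⟩).move [0])) else 0

variable {F : TreeStar → ℝ≥0∞}

lemma measurable_onPairs (hF : Measurable F) : Measurable (onPairs F) := by
  classical
  exact Measurable.dite (s := {z : (PTree × PTree) × (ℕ → Vertex) | z.1.1.IsRay z.2})
    (f := fun x => F (RayedPair.toTreeStar x)) (g := fun _ => 0)
    (hF.comp measurable_toTreeStar) measurable_const measurableSet_isRay_prod

lemma measurable_afterReturn (hF : Measurable F) : Measurable (afterReturn F) := by
  classical
  exact Measurable.dite (s := {z : (PTree × PTree) × (ℕ → Vertex) | z.1.1.IsRay z.2})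
    (f := fun x => F (Quotient.mk MarkedTree.setoid ((RayedPair.toMarked x).move [0])))
    (g := fun _ => 0)
    (hF.comp (measurable_quotient_mk'.comp
      ((MarkedTree.measurable_move [0]).comp measurable_toMarked)))
    measurable_const measurableSet_isRay_prod

lemma onPairs_exchange {T S : PTree} {ξ : ℕ → Vertex} {i : ℕ} (h : ¬ T.IsRay ξ) :
    onPairs F (exchange i (T, S), consRay i ξ) = 0 := by
  refine dif_neg fun h' => h ?_
  have := (isRay_consRay_iff.1 h').2
  rwa [exchange, sub_graft_self] at this

/-- Every pair whose ray starts through `i` arises by an outward move, namely from `T_i` and the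
tree `T` with `S` grafted at `i`. Moving along the ray leads back there. -/
lemma afterReturn_consRay {T S : PTree} {ξ : ℕ → Vertex} {i : ℕ} (hi : i < (T [] : ℕ)) :
    afterReturn F ((T, S), consRay i ξ) = onPairs F ((sub T i, graft T i S), ξ) := by
  obtain ⟨T', S', rfl, rfl⟩ : ∃ T' S', T = graft S' i T' ∧ S = sub S' i :=
    ⟨sub T i, graft T i S, (graft_graft_sub T i S).symm, (sub_graft_self T i S).symm⟩
  rw [sub_graft_self, graft_graft_sub]
  unfold afterReturn onPairs
  by_cases h : T'.IsRay ξ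
  · have h' : (graft S' i T').IsRay (consRay i ξ) := isRay_exchange h hi
    rw [dif_pos h, dif_pos h']
    exact congrArg F (mk_move_zero (T := T') (S := S') (i := i) h hi)
  · rw [dif_neg h, dif_neg]
    intro h'
    have := (isRay_consRay_iff.1 h').2
    rw [sub_graft_self] at this
    exact h this

lemma onPairs_rwKernel (lam : ℝ≥0) (hF : Measurable F) (T S : PTree) (ξ : ℕ → Vertex) :
    onPairs (fun q => ∫⁻ q', F q' ∂rwKernel lam q) ((T, S), ξ) =
      (∑ i ∈ Finset.range (S []), 1 / ((S [] : ℝ≥0∞) + lam) *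
        onPairs F (exchange i (T, S), consRay i ξ)) +
      lam / ((S [] : ℝ≥0∞) + lam) * afterReturn F ((T, S), ξ) := by
  by_cases h : T.IsRay ξ
  · rw [onPairs, dif_pos h, lintegral_rwKernel lam _ hF, afterReturn, dif_pos h]
    congr 1
    refine Finset.sum_congr rfl fun i hi => ?_
    have hi' := Finset.mem_range.1 hi
    congr 1
    have e : onPairs F (exchange i (T, S), consRay i ξ) =
        F (RayedPair.toTreeStar ⟨(exchange i (T, S), consRay i ξ), isRay_exchange h hi'⟩) :=
      dif_pos (isRay_exchange h hi')
    rw [e, mk_move_succ h hi']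
    rfl
  · rw [onPairs, dif_neg h, afterReturn, dif_neg h, mul_zero, add_zero]
    symm
    refine Finset.sum_eq_zero fun i _ => ?_
    rw [onPairs_exchange h, mul_zero]

/-! ### The density -/

/-- The common denominator of the densities. -/
def denom (lam : ℝ≥0) (T S : PTree) : ℝ :=
  (lam + effConductance lam T) * (lam + effConductance lam S) - lam

section Density

variable {lam : ℝ≥0}

lemma denom_comm (T S : PTree) : denom lam T S = denom lam S T := by
  unfold denom; ring

lemma add_effConductance_pos (hlam : lam ≠ 0) (T : PTree) :
    (0 : ℝ) < lam + effConductance lam T := by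
  have h0 : (0 : ℝ) < lam := by positivity
  linarith [effConductance_nonneg lam T]

/-- The denominator in `density` is not symmetric in the two trees; multiplied by `lam + C(T)` it
becomes so. -/
lemma denom_div (hlam : lam ≠ 0) (T S : PTree) :
    denom lam T S / (lam + effConductance lam T) =
      lam - 1 + escape lam T + effConductance lam S := by
  have := (add_effConductance_pos hlam T).ne'
  rw [escape_eq lam hlam, denom]
  field_simp
  ring

lemma denom_nonneg (hlam : lam ≠ 0) (T S : PTree) : 0 ≤ denom lam T S := by
  have h := denom_div hlam T S
  rw [div_eq_iff (add_effConductance_pos hlam T).ne'] at h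
  rw [h]
  exact mul_nonneg (by linarith [one_sub_le_escape lam T, effConductance_nonneg lam S])
    (add_effConductance_pos hlam T).le

lemma density_eq (hlam : lam ≠ 0) (T S : PTree) :
    density lam T S = (lam + (S [] : ℕ)) * (effConductance lam T / denom lam T S) := by
  rw [density, ← denom_div hlam, escape_eq lam hlam, mul_div_assoc,
    div_div_div_cancel_right₀ (add_effConductance_pos hlam T).ne']

lemma one_sub_escape (hlam : lam ≠ 0) (T : PTree) :
    1 - escape lam T = lam / (lam + effConductance lam T) := by
  have := (add_effConductance_pos hlam T).ne'
  rw [escape_eq lam hlam]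
  field_simp
  ring

/-- The conductance is a sum of escape probabilities over the children, and grafting changes only
the summand at `i`. -/
lemma effConductance_graft (hlam : lam ≠ 0) (T S : PTree) {i : ℕ} (hi : i < (S [] : ℕ)) :
    effConductance lam (graft S i T) + escape lam (sub S i) =
      effConductance lam S + escape lam T := by
  rw [effConductance_eq_sum lam hlam, effConductance_eq_sum lam hlam, graft_nil,
    ← Finset.add_sum_erase _ _ (Finset.mem_range.2 hi),
    ← Finset.add_sum_erase (Finset.range (S [])) (fun j => escape lam (sub S j))
      (Finset.mem_range.2 hi), sub_graft_self,
    Finset.sum_congr rfl (g := fun j => escape lam (sub S j)) fun j hj => by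
      rw [sub_graft_of_ne S (Finset.ne_of_mem_erase hj)]]
  ring

/-- By `denom_div` and symmetry the inverse ratios are `lam - 1` plus the two sides of
`effConductance_graft`. This conservation law is what makes the density the right one. -/
lemma denom_exchange (hlam : lam ≠ 0) (T S : PTree) {i : ℕ} (hi : i < (S [] : ℕ)) :
    (lam + effConductance lam (sub S i)) / denom lam (graft S i T) (sub S i) =
      (lam + effConductance lam T) / denom lam T S := by
  rw [← inv_div, ← inv_div (denom lam T S), denom_div hlam, denom_comm, denom_div hlam]
  congr 1
  linarith [effConductance_graft hlam T S hi]

lemma measurable_denom (hlam : lam ≠ 0) :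
    Measurable fun x : PTree × PTree => denom lam x.1 x.2 := by
  have h := measurable_effConductance lam hlam
  exact (((h.comp measurable_fst).const_add _).mul ((h.comp measurable_snd).const_add _)).sub_const _

lemma measurable_density (hlam : lam ≠ 0) :
    Measurable fun x : PTree × PTree => density lam x.1 x.2 := by
  have hroot : Measurable fun x : PTree × PTree => ((x.2 [] : ℕ) : ℝ) :=
    (measurable_of_countable fun k : ℕ+ => ((k : ℕ) : ℝ)).comp
      ((measurable_pi_apply []).comp measurable_snd)
  simp only [density_eq hlam]
  exact (hroot.const_add _).mul
    (((measurable_effConductance lam hlam).comp measurable_fst).div (measurable_denom hlam))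

lemma le_effConductance (hlam : lam ≠ 0) (S : PTree) :
    (S [] : ℕ) * (1 - lam : ℝ) ≤ effConductance lam S := by
  rw [effConductance_eq_sum lam hlam]
  calc ((S [] : ℕ) : ℝ) * (1 - lam) = ∑ i ∈ Finset.range (S []), (1 - lam : ℝ) := by
        rw [Finset.sum_const, Finset.card_range, nsmul_eq_mul]
    _ ≤ _ := Finset.sum_le_sum fun i _ => one_sub_le_escape lam _

/-- For `lam ≥ 1` positivity of `lam - 1 + β(T) + C(S)` comes from `β(T) > 0`. For `lam < 1` it
comes from `C(S) > 0`, since `β(T) ≥ 1 - lam`. -/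
lemma denom_pos (hlam : lam ≠ 0) {T S : PTree} (hT : 0 < effConductance lam T) :
    0 < denom lam T S := by
  have h := denom_div hlam T S
  rw [div_eq_iff (add_effConductance_pos hlam T).ne'] at h
  rw [h]
  refine mul_pos ?_ (add_effConductance_pos hlam T)
  have hβ : 0 < escape lam T := by
    rw [escape_eq lam hlam]
    exact div_pos hT (add_effConductance_pos hlam T)
  rcases le_or_gt (1 : ℝ) lam with h1 | h1
  · linarith [effConductance_nonneg lam S]
  · have h2 := le_effConductance hlam S
    have h3 : (1 : ℝ) ≤ (S [] : ℕ) := by exact_mod_cast (S []).pos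
    have h4 : 0 < ((S [] : ℕ) : ℝ) * (1 - lam) := mul_pos (by linarith) (by linarith)
    linarith [one_sub_le_escape lam T]

lemma density_pos_iff (hlam : lam ≠ 0) (T S : PTree) :
    0 < density lam T S ↔ 0 < effConductance lam T := by
  have hl : (0 : ℝ) < lam := by positivity
  rw [density_eq hlam]
  constructor
  · intro h
    refine lt_of_le_of_ne (effConductance_nonneg lam T) fun h0 => ?_
    rw [← h0] at h
    simp at h
  · intro h
    exact mul_pos (by positivity) (div_pos h (denom_pos hlam h))

/-- For `lam ≥ 1` the symmetric denominator is at least `C(T)`, so the constant `1` works. For `lam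
< 1` the original denominator is at least `1 - lam` and `β ≤ 1`. -/
lemma density_le (hlam : lam ≠ 0) : ∃ K : ℝ≥0, ∀ T S : PTree,
    density lam T S ≤ K * (lam + (S [] : ℕ)) := by
  have hl : (0 : ℝ) < lam := by positivity
  have hlS : ∀ S : PTree, (0 : ℝ) ≤ lam + (S [] : ℕ) := fun S => by positivity
  rcases le_or_gt (1 : ℝ) lam with h1 | h1
  · refine ⟨1, fun T S => ?_⟩
    rw [density_eq hlam, NNReal.coe_one, one_mul]
    refine mul_le_of_le_one_right (hlS S) (div_le_one_of_le₀ ?_ (denom_nonneg hlam T S))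
    unfold denom
    nlinarith [effConductance_nonneg lam T, effConductance_nonneg lam S,
      mul_nonneg (effConductance_nonneg lam T) (effConductance_nonneg lam S),
      mul_nonneg (sub_nonneg.2 h1) (effConductance_nonneg lam T)]
  · have hpos : (0 : ℝ) < 1 - lam := by linarith
    refine ⟨⟨1 / (1 - lam), by positivity⟩, fun T S => ?_⟩
    have h2 := le_effConductance hlam S
    have h3 : (1 : ℝ) ≤ (S [] : ℕ) := by exact_mod_cast (S []).pos
    have h4 : (1 - lam : ℝ) ≤ lam - 1 + escape lam T + effConductance lam S := by
      nlinarith [one_sub_le_escape lam T]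
    change density lam T S ≤ 1 / (1 - lam) * (lam + (S [] : ℕ))
    rw [density, one_div_mul_eq_div]
    refine div_le_div₀ (hlS S) ?_ hpos h4
    exact mul_le_of_le_one_right (hlS S) (escape_le_one lam T)

end Density

/-! ### Normalization -/

lemma normConst_ne_top (p : PMF ℕ+) (hm : mean p ≠ ∞) {lam : ℝ≥0} (hlam : lam ≠ 0) :
    normConst p lam ≠ ∞ := by
  obtain ⟨K, hK⟩ := density_le hlam
  have hg : Measurable fun k : ℕ+ => (K : ℝ≥0∞) * (lam + (k : ℕ)) := measurable_of_countable _
  have h1 : normConst p lam ≤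
      ∫⁻ x : PTree × PTree, (K : ℝ≥0∞) * (lam + (x.2 [] : ℕ)) ∂((GW p).prod (GW p)) := by
    refine lintegral_mono fun x => ?_
    refine (ENNReal.ofReal_le_ofReal (hK x.1 x.2)).trans_eq ?_
    rw [ENNReal.ofReal_mul (NNReal.coe_nonneg K), ENNReal.ofReal_add (NNReal.coe_nonneg lam) (by positivity)]
    simp
  refine ne_top_of_le_ne_top ?_ h1
  have h2 := (measurePreserving_snd (μ := GW p) (ν := GW p)).lintegral_comp
    (f := fun S : PTree => (K : ℝ≥0∞) * (lam + (S [] : ℕ)))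
    (hg.comp (measurable_pi_apply (X := fun _ : Vertex => ℕ+) []))
  have h2' : ∫⁻ x : PTree × PTree, (K : ℝ≥0∞) * (lam + (x.2 [] : ℕ)) ∂((GW p).prod (GW p)) =
      ∫⁻ S : PTree, (K : ℝ≥0∞) * (lam + (S [] : ℕ)) ∂GW p := h2
  rw [h2', lintegral_GW_root p fun k => (K : ℝ≥0∞) * (lam + (k : ℕ))]
  have e : ∀ k : ℕ+, p k * ((K : ℝ≥0∞) * (lam + (k : ℕ))) =
      (K : ℝ≥0∞) * (lam * p k + k * p k) := fun k => by
    ring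
  simp only [e]
  rw [ENNReal.tsum_mul_left, ENNReal.tsum_add, ENNReal.tsum_mul_left, p.tsum_coe, mul_one]
  exact ENNReal.mul_ne_top ENNReal.coe_ne_top
    (ENNReal.add_ne_top.2 ⟨ENNReal.coe_ne_top, hm⟩)

lemma normConst_ne_zero (p : PMF ℕ+) {lam : ℝ≥0} (hlam0 : lam ≠ 0)
    (hlam : (lam : ℝ≥0∞) < mean p) : normConst p lam ≠ 0 := by
  intro h
  rw [normConst, lintegral_eq_zero_iff (measurable_density hlam0).ennreal_ofReal] at h
  have h1 : ((GW p).prod (GW p)) ({T | 0 < escape lam T} ×ˢ Set.univ) = 0 := by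
    refine measure_mono_null ?_ (ae_iff.1 h)
    rintro ⟨T, S⟩ ⟨hT, -⟩ h0
    have hd := (density_pos_iff hlam0 T S).2
      (effConductance_pos lam hlam0 (ne_of_gt (show 0 < escape lam T from hT)))
    exact absurd (ENNReal.ofReal_eq_zero.1 h0) (not_le.2 hd)
  rw [Measure.prod_prod, measure_univ, mul_one] at h1
  exact measure_escape_pos p lam hlam h1

/-- Restricting to `RayedPair` discards the sequences that are not rays, and there `onPairs` is
zero; so the integral can be taken over all sequences. -/
lemma lintegral_AGW (p : PMF ℕ+) {lam : ℝ≥0} (hlam : lam ≠ 0) (hF : Measurable F) :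
    ∫⁻ q, F q ∂AGW p lam = (normConst p lam)⁻¹ * ∫⁻ x, ENNReal.ofReal (density lam x.1 x.2) *
      ∫⁻ ξ, onPairs F (x, ξ) ∂harmonicMeasure lam x.1 ∂((GW p).prod (GW p)) := by
  have hD : Measurable fun z : (PTree × PTree) × (ℕ → Vertex) =>
      ENNReal.ofReal (density lam z.1.1 z.1.2) :=
    (measurable_density hlam).ennreal_ofReal.comp measurable_fst
  have hG := measurable_onPairs hF
  unfold AGW
  rw [lintegral_smul_measure, lintegral_map hF measurable_toTreeStar, smul_eq_mul]
  congr 1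
  set ν := (pairLaw p lam).withDensity fun x => ENNReal.ofReal (density lam x.1.1 x.1.2) with hν
  have h1 : ∫⁻ x : RayedPair, F x.toTreeStar ∂(ν.comap Subtype.val) =
      ∫⁻ x : RayedPair, onPairs F x ∂(ν.comap Subtype.val) :=
    lintegral_congr fun x => by
      rw [onPairs, dif_pos x.2]
  have h2 : ∫⁻ x : RayedPair, onPairs F x ∂(ν.comap Subtype.val) =
      ∫⁻ z in {z | z.1.1.IsRay z.2}, onPairs F z ∂ν :=
    lintegral_subtype_comap measurableSet_isRay_prod _
  rw [h1, h2, ← lintegral_indicator measurableSet_isRay_prod]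
  have h3 : {z : (PTree × PTree) × (ℕ → Vertex) | z.1.1.IsRay z.2}.indicator (onPairs F) =
      onPairs F := by
    rw [Set.indicator_eq_self]
    intro z hz
    by_contra h
    exact hz (dif_neg h)
  rw [h3, hν, lintegral_withDensity_eq_lintegral_mul _ hD hG, pairLaw,
    Measure.lintegral_compProd (hD.mul hG)]
  refine lintegral_congr fun x => ?_
  simp only [Pi.mul_apply, Kernel.comap_apply]
  exact lintegral_const_mul _ (hG.comp measurable_prodMk_left)

lemma isProbabilityMeasure_AGW (p : PMF ℕ+) (hm : mean p ≠ ∞) {lam : ℝ≥0} (hlam0 : lam ≠ 0)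
    (hlam : (lam : ℝ≥0∞) < mean p) : IsProbabilityMeasure (AGW p lam) := by
  refine ⟨?_⟩
  have h := lintegral_AGW p hlam0 (F := fun _ => 1) measurable_const
  rw [lintegral_one] at h
  rw [h]
  have e : ∀ x : PTree × PTree, ENNReal.ofReal (density lam x.1 x.2) *
      ∫⁻ ξ, onPairs (fun _ => 1) (x, ξ) ∂harmonicMeasure lam x.1 =
      ENNReal.ofReal (density lam x.1 x.2) := by
    intro x
    -- On a recurrent tree the harmonic measure is not known to charge only rays, but the density
    -- vanishes.
    by_cases hx : 0 < effConductance lam x.1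
    · have : ∫⁻ ξ, onPairs (fun _ => 1) (x, ξ) ∂harmonicMeasure lam x.1 = 1 := by
        rw [lintegral_congr_ae (g := fun _ => 1), lintegral_one, measure_univ]
        filter_upwards [ae_isRay lam hlam0 hx] with ξ hξ
        exact dif_pos hξ
      rw [this, mul_one]
    · have : ENNReal.ofReal (density lam x.1 x.2) = 0 := by
        rw [ENNReal.ofReal_eq_zero, ← not_lt, density_pos_iff hlam0]
        exact hx
      rw [this, zero_mul]
  simp only [e]
  exact ENNReal.inv_mul_cancel (normConst_ne_zero p hlam0 hlam) (normConst_ne_top p hm hlam0)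

/-! ### Invariance -/

/-- The contribution to the marked tree law of the rays through the child `i` of the root of the
first tree. -/
def flowTerm (lam : ℝ≥0) (F : TreeStar → ℝ≥0∞) (i : ℕ) (x : PTree × PTree) : ℝ≥0∞ :=
  if i < (x.1 [] : ℕ) then
    ENNReal.ofReal ((lam + effConductance lam x.2) / denom lam x.1 x.2) *
      (ENNReal.ofReal (escape lam (sub x.1 i)) *
        ∫⁻ ξ, onPairs F (x, consRay i ξ) ∂harmonicMeasure lam (sub x.1 i)) else 0

/-- The contribution to the marked tree law of the returns to the root of the second tree from
its child `i`. -/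
def returnTerm (lam : ℝ≥0) (F : TreeStar → ℝ≥0∞) (i : ℕ) (x : PTree × PTree) : ℝ≥0∞ :=
  if i < (x.2 [] : ℕ) then
    ENNReal.ofReal (effConductance lam x.1 / denom lam x.1 x.2) *
      (ENNReal.ofReal (1 - escape lam (sub x.2 i)) *
        ∫⁻ ξ, onPairs F (x, ξ) ∂harmonicMeasure lam x.1) else 0

/-- The number of summands depends on the tree. As a series with a fixed index set, the sum can be
exchanged with the integral and `exchange i` applied for each fixed `i`. -/
lemma sum_range_eq_tsum (n : ℕ) (a : ℕ → ℝ≥0∞) :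
    ∑ i ∈ Finset.range n, a i = ∑' i, if i < n then a i else 0 := by
  rw [tsum_eq_sum (s := Finset.range n) fun i hi => if_neg (by simpa using hi)]
  exact Finset.sum_congr rfl fun i hi => (if_pos (Finset.mem_range.1 hi)).symm

section Invariance

variable {lam : ℝ≥0}

lemma measurableSet_lt_root (i : ℕ) : MeasurableSet {T : PTree | i < (T [] : ℕ)} :=
  measurable_pi_apply (X := fun _ : Vertex => ℕ+) []
    (MeasurableSpace.measurableSet_top (s := {k : ℕ+ | i < (k : ℕ)}))

lemma measurable_flowTerm (hlam : lam ≠ 0) (hF : Measurable F) (i : ℕ) :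
    Measurable (flowTerm lam F i) := by
  have hs : Measurable fun x : PTree × PTree => sub x.1 i := (measurable_sub i).comp measurable_fst
  refine Measurable.ite (measurable_fst (measurableSet_lt_root i)) ?_ measurable_const
  refine Measurable.mul ?_ (Measurable.mul ?_ ?_)
  · exact ((((measurable_effConductance lam hlam).comp measurable_snd).const_add _).div
      (measurable_denom hlam)).ennreal_ofReal
  · exact ((measurable_escape lam).comp hs).ennreal_ofReal
  · exact Measurable.lintegral_kernel_prod_right'
      (κ := (harmonicMeasure lam).comap (fun x : PTree × PTree => sub x.1 i) hs)
      (f := fun z => onPairs F (z.1, consRay i z.2))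
      ((measurable_onPairs hF).comp
        (measurable_fst.prodMk ((measurable_consRay i).comp measurable_snd)))

lemma measurable_returnTerm (hlam : lam ≠ 0) (hF : Measurable F) (i : ℕ) :
    Measurable (returnTerm lam F i) := by
  have hs : Measurable fun x : PTree × PTree => sub x.2 i := (measurable_sub i).comp measurable_snd
  refine Measurable.ite (measurable_snd (measurableSet_lt_root i)) ?_ measurable_const
  refine Measurable.mul ?_ (Measurable.mul ?_ ?_)
  · exact (((measurable_effConductance lam hlam).comp measurable_fst).div
      (measurable_denom hlam)).ennreal_ofReal
  · exact (((measurable_escape lam).comp hs).const_sub 1).ennreal_ofReal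
  · exact Measurable.lintegral_kernel_prod_right'
      (κ := (harmonicMeasure lam).comap (fun x : PTree × PTree => x.1) measurable_fst)
      (measurable_onPairs hF)

/-- Splits `lam + ν = (lam + C(S)) + ∑ (1 - β(S_i))` and applies the flow rule of `T` to the first
part. -/
lemma density_mul_eq_terms (hlam : lam ≠ 0) (hF : Measurable F) (x : PTree × PTree) :
    ENNReal.ofReal (density lam x.1 x.2) * ∫⁻ ξ, onPairs F (x, ξ) ∂harmonicMeasure lam x.1 =
      ∑' i, flowTerm lam F i x + ∑' i, returnTerm lam F i x := by
  obtain ⟨T, S⟩ := x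
  have hl : (0 : ℝ) < lam := by positivity
  have hCT := effConductance_nonneg lam T
  have hLS := add_effConductance_pos hlam S
  have hW := denom_nonneg hlam T S
  have hflow := lintegral_harmonicMeasure_flow lam hlam T
    (H := fun ξ => onPairs F ((T, S), ξ)) ((measurable_onPairs hF).comp measurable_prodMk_left)
  simp only [flowTerm, returnTerm]
  rw [← sum_range_eq_tsum, ← sum_range_eq_tsum, ← Finset.mul_sum, ← Finset.mul_sum, ← hflow,
    ← Finset.sum_mul, ← mul_assoc, ← mul_assoc, ← add_mul,
    ← ENNReal.ofReal_sum_of_nonneg fun i _ => by linarith [escape_le_one lam (sub S i)],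
    ← ENNReal.ofReal_mul (by positivity), ← ENNReal.ofReal_mul (by positivity),
    ← ENNReal.ofReal_add (by positivity) (mul_nonneg (by positivity)
      (Finset.sum_nonneg fun i _ => by linarith [escape_le_one lam (sub S i)]))]
  congr 2
  rw [Finset.sum_sub_distrib, ← effConductance_eq_sum lam hlam, density_eq hlam]
  simp only [Finset.sum_const, Finset.card_range, nsmul_eq_mul, mul_one]
  ring

/-- Outward steps to the child `i` are flow terms of the exchanged pair. The inward step, decomposed
by the flow rule according to the child `i` of `T` on the ray, gives return terms of the pair
exchanged with the roles of the trees reversed. -/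
lemma density_mul_kernel_eq_terms (hlam : lam ≠ 0) (hF : Measurable F) (x : PTree × PTree) :
    ENNReal.ofReal (density lam x.1 x.2) *
      ∫⁻ ξ, onPairs (fun q => ∫⁻ q', F q' ∂rwKernel lam q) (x, ξ) ∂harmonicMeasure lam x.1 =
      ∑' i, flowTerm lam F i (exchange i x) +
        ∑' i, returnTerm lam F i (exchange i x.swap).swap := by
  obtain ⟨T, S⟩ := x
  have hl : (0 : ℝ) < lam := by positivity
  have hCT := effConductance_nonneg lam T
  have hW := denom_nonneg hlam T S
  have hd : (0 : ℝ) < (S [] : ℕ) + lam := by positivity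
  have hν : ((S [] : ℝ≥0∞) + lam) = ENNReal.ofReal ((S [] : ℕ) + lam) := by
    rw [ENNReal.ofReal_add (by positivity) (by positivity)]; simp
  -- The total weight of the step cancels the factor `lam + ν` of the density.
  have hdens : ∀ c : ℝ≥0∞, ENNReal.ofReal (density lam T S) * (c / ((S [] : ℝ≥0∞) + lam)) =
      c * ENNReal.ofReal (effConductance lam T / denom lam T S) := by
    intro c
    rw [density_eq hlam, add_comm (lam : ℝ), ENNReal.ofReal_mul hd.le, ← hν, mul_right_comm,
      ENNReal.mul_div_cancel (by simp) (by simp)]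
  have hGm : ∀ i, Measurable fun ξ => onPairs F (exchange i (T, S), consRay i ξ) := fun i =>
    (measurable_onPairs hF).comp (measurable_const.prodMk (measurable_consRay i))
  have hRm : Measurable fun ξ => afterReturn F ((T, S), ξ) :=
    (measurable_afterReturn hF).comp measurable_prodMk_left
  have hflow := lintegral_harmonicMeasure_flow lam hlam T hRm
  simp only [onPairs_rwKernel lam hF]
  rw [lintegral_add_left (Finset.measurable_fun_sum _ fun i _ => (hGm i).const_mul _),
    lintegral_finsetSum _ fun i _ => (hGm i).const_mul _, lintegral_const_mul _ hRm, mul_add,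
    Finset.mul_sum]
  congr 1
  · rw [sum_range_eq_tsum]
    refine tsum_congr fun i => ?_
    simp only [flowTerm, exchange, graft_nil, sub_graft_self]
    split_ifs with hi
    · have hGi : Measurable fun ξ => onPairs F ((graft S i T, sub S i), consRay i ξ) := hGm i
      rw [lintegral_const_mul _ hGi, ← mul_assoc, hdens, one_mul, denom_exchange hlam T S hi,
        ← mul_assoc, ← ENNReal.ofReal_mul (div_nonneg (add_effConductance_pos hlam T).le hW)]
      congr 2
      have := (add_effConductance_pos hlam T).ne'
      rw [escape_eq lam hlam, div_mul_div_comm, mul_comm (denom lam T S),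
        mul_div_mul_left _ _ this]
    · rfl
  · rw [← mul_assoc, hdens, div_eq_mul_one_div, mul_comm (effConductance lam T),
      ENNReal.ofReal_mul (by positivity), mul_assoc, mul_assoc, hflow, sum_range_eq_tsum,
      ← ENNReal.tsum_mul_left, ← ENNReal.tsum_mul_left]
    refine tsum_congr fun i => ?_
    simp only [returnTerm, exchange, Prod.swap, graft_nil, sub_graft_self]
    split_ifs with hi
    · simp only [afterReturn_consRay hi]
      rw [← mul_assoc, ← mul_assoc, ← mul_assoc]
      congr 1
      have hlam' : (lam : ℝ≥0∞) = ENNReal.ofReal lam := by simp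
      rw [hlam', ← ENNReal.ofReal_mul hl.le, ← ENNReal.ofReal_mul (by positivity),
        ← ENNReal.ofReal_mul (div_nonneg (effConductance_nonneg lam _) (denom_nonneg hlam _ _))]
      congr 1
      have hx := denom_exchange hlam S T hi
      have h1 := (add_effConductance_pos hlam (sub T i)).ne'
      have h2 := (add_effConductance_pos hlam S).ne'
      rw [denom_comm (graft T i S), denom_comm S T] at hx
      -- `C = β (lam + C)` for the subtree, followed by `denom_exchange` with the roles of the trees
      -- reversed. The factor `lam + C(S)` then cancels against `1 - β(S) = lam / (lam + C(S))`.
      have h3 : effConductance lam (sub T i) / denom lam (sub T i) (graft T i S) =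
          escape lam (sub T i) * ((lam + effConductance lam S) / denom lam T S) := by
        rw [← hx, escape_eq lam hlam (sub T i)]
        field_simp
      rw [h3, one_sub_escape hlam]
      field_simp
    · simp

lemma lintegral_exchange_swap (p : PMF ℕ+) (i : ℕ) {f : PTree × PTree → ℝ≥0∞}
    (hf : Measurable f) : ∫⁻ x, f (exchange i x.swap).swap ∂((GW p).prod (GW p)) =
      ∫⁻ x, f x ∂((GW p).prod (GW p)) := by
  have hswap : MeasurePreserving Prod.swap ((GW p).prod (GW p)) ((GW p).prod (GW p)) :=
    Measure.measurePreserving_swap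
  exact ((hswap.comp (measurePreserving_exchange p i)).comp hswap).lintegral_comp hf

/-- The augmented Galton-Watson measure is invariant. -/
lemma invariant_AGW (p : PMF ℕ+) (hlam : lam ≠ 0) :
    Kernel.Invariant (rwKernel lam) (AGW p lam) := by
  refine Measure.ext_of_lintegral _ fun F hF => ?_
  have hH : Measurable fun q => ∫⁻ q', F q' ∂rwKernel lam q := hF.lintegral_kernel
  rw [Measure.lintegral_bind (Kernel.measurable _).aemeasurable hF.aemeasurable,
    lintegral_AGW p hlam hH, lintegral_AGW p hlam hF]
  congr 1
  -- Both integrands are now sums of the same terms, on one side composed with maps that preserve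
  -- the law of the pair.
  simp only [density_mul_eq_terms hlam hF, density_mul_kernel_eq_terms hlam hF]
  have hA := measurable_flowTerm hlam hF
  have hB := measurable_returnTerm hlam hF
  have hA' : ∀ i, Measurable fun x => flowTerm lam F i (exchange i x) := fun i =>
    (hA i).comp (measurable_exchange i)
  have hB' : ∀ i, Measurable fun x : PTree × PTree =>
      returnTerm lam F i (exchange i x.swap).swap := fun i =>
    (hB i).comp (measurable_swap.comp ((measurable_exchange i).comp measurable_swap))
  rw [lintegral_add_left (Measurable.tsum hA'), lintegral_add_left (Measurable.tsum hA),
    lintegral_tsum fun i => (hA' i).aemeasurable, lintegral_tsum fun i => (hB' i).aemeasurable,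
    lintegral_tsum fun i => (hA i).aemeasurable, lintegral_tsum fun i => (hB i).aemeasurable]
  congr 1
  · exact tsum_congr fun i => lintegral_exchange p i (hA i)
  · exact tsum_congr fun i => lintegral_exchange_swap p i (hB i)

end Invariance

end BiasedWalk

end

theorem proposition3p1 (p : PMF ℕ+) (hp : ∀ k, p k < 1) (hm : BiasedWalk.mean p ≠ ∞)
    (lam : ℝ≥0) (hlam0 : 0 < lam) (hlam : (lam : ℝ≥0∞) < BiasedWalk.mean p) :
    IsProbabilityMeasure (BiasedWalk.AGW p lam) ∧
      Kernel.Invariant (BiasedWalk.rwKernel lam) (BiasedWalk.AGW p lam) ∧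
      MeasurePreserving BiasedWalk.shift
        (BiasedWalk.chainLaw (BiasedWalk.rwKernel lam) (BiasedWalk.AGW p lam))
        (BiasedWalk.chainLaw (BiasedWalk.rwKernel lam) (BiasedWalk.AGW p lam)) := by
  have hinv := BiasedWalk.invariant_AGW p hlam0.ne'
  exact ⟨BiasedWalk.isProbabilityMeasure_AGW p hm hlam0.ne' hlam, hinv,
    BiasedWalk.measurePreserving_shift _ hinv⟩
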